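/- **Setting.** Let $d\ge 1$, let $E$ be a finite set and $P$ a stochastic matrix on $E$. Let $\mathcal V=\{\pm e_1,\dots,\pm e_d\}\subset\mathbb R^d$, and for $x\in\mathbb R^d$, $i\in E$ let $(p(x,i,v))_{v\in\mathcal V}$ be a probability on $\mathcal V$. Assume: (A.1) there is $K<\infty$ with $|p(x,i,v)-p(y,i,v)|\le K|x-y|$ for all $x,y,i,v$; (A.2) $p(x,i,v)>0$ for all $x,i,v$; (A.3) $P$ is irreducible; $\mu$ denotes its invariant probability. Put $\bar f(x)=\sum_{v}v\sum_{i}\mu(i)p(x,i,v)$. Let $(\xi_n)$ be the Markov chain with transition matrix $P$, and put $$H(x,\alpha)=\lim_{n\to\infty}\frac1n\ln\mathbb E^i\prod_{k=1}^n\Big[\sum_{v\in\mathcal V}e^{\langle\alpha,v\rangle}p(x,\xi_k,v)\Big]$$ (the limit does not depend on $\xi_0=i$), and $L(x,v)=\sup_\alpha(\langle\alpha,v\rangle-H(x,\alpha))\in[0,+\infty]$. For $x\in[0,1]^d$ let $\mathcal N(x)$ be the set of unit vectors $n$ with $n_j=0$ if $0<x_j<1$, $n_j\le0$ if $x_j=0$,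 $n_j\ge0$ if $x_j=1$; let $\mathbb R_+\mathcal N(x)$ be the cone it generates ($\{0\}$ if $x\in(0,1)^d$) and ${\bf e}(x)=\mathcal N(x)\cap\mathcal V$. A path $\phi:[0,T]\to[0,1]^d$ is the Skorokhod reflection of a continuous path $\psi$, written $\phi=\Psi(\psi)$, if $\psi=\phi+k$ with $\phi,k$ continuous, $k$ of bounded variation, $k_t=\int_0^t n_s\,d|k|_s$, $n_s\in\mathcal N(\phi_s)$, and $d|k|$ carried by $\{s:\phi_s\in\partial[0,1]^d\}$. A path $\chi$ solves the reflected equation from $x_0\in[0,1]^d$ if, on every $[0,T]$, it is the Skorokhod reflection of $t\mapsto x_0+\int_0^t\bar f(\chi_s)\,ds$. Assume further, for some $\ell\in(0,d)$: (A.4) $0$ is the unique equilibrium of the reflected equation, it is stable, and every solution with $x_0\in[0,1]^d$, $|x_0|_1\le\ell$, satisfies $|\chi_t|_1<\ell$ for $t>0$ and $\chi_t\to0$ as $t\to\infty$. Let $J_{0,T}(\phi)=\inf\{\int_0^TL(\phi_s,\dot\psi_s)\,ds:\ \psi\text{ absolutely continuous},\ \Psi(\psi)=\phi\}$, and let $V(x)=\inf\{J_{0,T}(\phi):T>0,\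 \phi_0=0,\ \phi_T=x\}$ be the quasi-potential. Let $L^{\rm ref}(x,\cdot)=L(x,\cdot)$ for $x\in(0,1)^d$; for $x\in\partial[0,1]^d$ let $L^{\rm ref}(x,v)$ be $+\infty$ if $\langle v,n\rangle>0$ for some $n\in\mathcal N(x)$, $L(x,v)$ if $\langle v,n\rangle<0$ for all $n\in\mathcal N(x)$, and $\inf\{L(x,v+\beta n):\beta\ge0,\ n\in\mathcal N(x),\ n\perp v\}$ otherwise. For a path $\psi:(-\infty,0]\to[0,1]^d$ put $J_{-\infty,0}(\psi)=\int_{-\infty}^0L^{\rm ref}(\psi_t,\dot\psi_t)\,dt$ if $\psi$ is absolutely continuous on compact intervals, and $+\infty$ otherwise. For $W$ differentiable at $x\in[0,1]^d$ (one-sidedly at the boundary) let $(\nabla_+W(x))_j$ be $\partial_jW(x)$ if $0<x_j<1$, $\min(\partial_jW(x),0)$ if $x_j=0$, and $\max(\partial_jW(x),0)$ if $x_j=1$. **Theorem.** Assume (A.1)–(A.4) and $\langle x,\bar f(x)\rangle<0$ for all $x\in[0,1]^d\setminus\{0\}$. Let $W\in C([0,1]^d,\mathbb R)$ be continuously differentiable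 on $[0,1]^d\setminus\{0\}$ with $W(0)=0$, such that * $H(x,\nabla W(x))=0$ for all $x\in(0,1)^d$; * for all $x\in\partial[0,1]^d\setminus\{0\}$, $H(x,\nabla_+W(x))=0$ and $\langle\nabla_\alpha H(x,\nabla_+W(x)),e\rangle\ge0$ for all $e\in{\bf e}(x)$; * for all $x\in\partial[0,1]^d\setminus\{0\}$ and all $e\in{\bf e}(x)$ with $\langle\nabla_\alpha H(x,\nabla_+W(x)),e\rangle=0$ there is a neighborhood $U$ of $x$ such that either $\langle\nabla W(y),e\rangle\le0$ for all $y\in U\cap\partial[0,1]^d$ with $e\in\mathcal N(y)$, or $\langle\nabla W(y),e\rangle\ge0$ for all such $y$. Then $V(x)=W(x)$ for all $x\in[0,1]^d$. Moreover, let $x\in[0,1]^d\setminus\{0\}$. Then there are a path $\varphi:(-\infty,0]\to[0,1]^d$, absolutely continuous on compact intervals, with $\varphi_0=x$, an $i(\varphi)\in(0,+\infty]$ with $\varphi_t=0$ for $t\le-i(\varphi)$ and $\varphi_t\ne0$ for $-i(\varphi)<t\le0$, and a function $k$, absolutely continuous on the compact intervals of $(-i(\varphi),0]$, such that for a.e.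 $t\in(-i(\varphi),0]$ $$\dot\varphi_t=\nabla_\alpha H(\varphi_t,\nabla_+W(\varphi_t))-\dot k_t,\qquad \dot k_t\in\mathbb R_+\mathcal N(\varphi_t),\qquad\langle\dot k_t,\nabla_+W(\varphi_t)\rangle=0 .$$ Every such $\varphi$ satisfies $\lim_{t\to-\infty}\varphi_t=0$ and $J_{-\infty,0}(\varphi)=V(x)$, and it minimizes $J_{-\infty,0}$ among all continuous paths $\psi:(-\infty,0]\to[0,1]^d$ with $\psi_0=x$ and $\lim_{t\to-\infty}\psi_t=0$. -/

import Mathlib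

open MeasureTheory Filter Topology Set
open scoped ENNReal

noncomputable section

namespace ReflectedWalk

/-- `ℝ^d` with the Euclidean scalar product and norm. -/
abbrev Space (d : ℕ) := EuclideanSpace ℝ (Fin d)

/-! ### Steps of the walker, environment, averaged drift -/

/-- Labels of the steps `e_1, -e_1, …, e_d, -e_d`. -/
abbrev Step (d : ℕ) := Fin d × Bool

/-- `(j, true)` is the step `e_j`, `(j, false)` is the step `-e_j`. -/
def stepVec {d : ℕ} (s : Step d) : Space d :=
  EuclideanSpace.single s.1 (if s.2 then (1 : ℝ) else -1)

/-- For every position `x` and environment state `i`, `p x i` is a probability on the steps. -/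
def IsStepLaw {d : ℕ} {E : Type*} (p : Space d → E → Step d → ℝ) : Prop :=
  ∀ x i, (∀ s, 0 ≤ p x i s) ∧ ∑ s, p x i s = 1

/-- Lipschitz continuity of the step probabilities, with a common constant. -/
def LipschitzSteps {d : ℕ} {E : Type*} (p : Space d → E → Step d → ℝ) : Prop :=
  ∃ K : ℝ, ∀ x y i s, |p x i s - p y i s| ≤ K * ‖x - y‖

/-- Ellipticity. -/
def EllipticSteps {d : ℕ} {E : Type*} (p : Space d → E → Step d → ℝ) : Prop :=
  ∀ x i s, 0 < p x i s

/-- `μ` is an invariant probability of the transition matrix `P`. -/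
def IsInvariantProbability {E : Type*} [Fintype E] (P : Matrix E E ℝ) (μ : E → ℝ) : Prop :=
  μ ∈ stdSimplex ℝ E ∧ Matrix.vecMul μ P = μ

/-- The averaged drift `f̄(x) = ∑_v v 𝔼^μ p(x, ξ, v)`. -/
def avgDrift {d : ℕ} {E : Type*} [Fintype E] (p : Space d → E → Step d → ℝ) (μ : E → ℝ)
    (x : Space d) : Space d :=
  ∑ s, (∑ i, μ i * p x i s) • stepVec s

/-! ### Hamiltonian and Lagrangian -/

/-- `∑_v exp⟨α, v⟩ p(x, i, v)`. -/
def stepMGF {d : ℕ} {E : Type*} (p : Space d → E → Step d → ℝ) (x α : Space d) (i : E) : ℝ :=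
  ∑ s, Real.exp (inner ℝ α (stepVec s)) * p x i s

/-- `𝔼^i ∏_{k=1}^n [∑_v exp⟨α, v⟩ p(x, ξ_k, v)]` for the Markov chain `ξ` with transition matrix
`P` and `ξ_0 = i`: the sum over all trajectories `(ξ_1, …, ξ_n)` (here `ξ k` is `ξ_{k+1}` and
`Fin.cons i ξ` is the trajectory together with its starting point). -/
def expMoment {d : ℕ} {E : Type*} [Fintype E] (P : Matrix E E ℝ)
    (p : Space d → E → Step d → ℝ) (x α : Space d) (i : E) (n : ℕ) : ℝ :=
  ∑ ξ : Fin n → E,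
    (∏ k : Fin n, P ((Fin.cons i ξ : Fin (n + 1) → E) k.castSucc) (ξ k)) *
      ∏ k : Fin n, stepMGF p x α (ξ k)

/-- The Hamiltonian `H(x, α) = lim_n n⁻¹ ln 𝔼^i ∏_{k=1}^n [∑_v exp⟨α, v⟩ p(x, ξ_k, v)]`, the
environment being started from `i` (for an irreducible environment the limit exists and does not
depend on `i`). -/
def hamiltonian {d : ℕ} {E : Type*} [Fintype E] (P : Matrix E E ℝ)
    (p : Space d → E → Step d → ℝ) (i : E) (x α : Space d) : ℝ :=
  limUnder atTop (fun n : ℕ => (n : ℝ)⁻¹ * Real.log (expMoment P p x α i n))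

/-- The gradient `∇_α H(x, α)` in the second variable. -/
def gradAlpha {d : ℕ} (H : Space d → Space d → ℝ) (x α : Space d) : Space d :=
  gradient (H x) α

/-- The Legendre transform `L(x, v) = sup_α (⟨α, v⟩ - H(x, α)) ∈ (-∞, +∞]`. -/
def lagrangian {d : ℕ} (H : Space d → Space d → ℝ) (x v : Space d) : EReal :=
  ⨆ α : Space d, ((inner ℝ α v - H x α : ℝ) : EReal)

/-! ### The hypercube and its normals -/

/-- The hypercube `[0,1]^d`. -/
def cube (d : ℕ) : Set (Space d) := {x | ∀ j, 0 ≤ x j ∧ x j ≤ 1}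

/-- The open hypercube `(0,1)^d`. -/
def openCube (d : ℕ) : Set (Space d) := {x | ∀ j, 0 < x j ∧ x j < 1}

/-- The boundary `∂[0,1]^d`. -/
def cubeBoundary (d : ℕ) : Set (Space d) := cube d \ openCube d

/-- The set `𝒩(x)` of unit outward normals at `x ∈ [0,1]^d` (empty when `x ∈ (0,1)^d`). -/
def normals {d : ℕ} (x : Space d) : Set (Space d) :=
  {v | ‖v‖ = 1 ∧ ∀ j, (0 < x j → x j < 1 → v j = 0) ∧ (x j = 0 → v j ≤ 0) ∧ (x j = 1 → 0 ≤ v j)}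

/-- `ℝ₊ 𝒩(x)`, which is `{0}` when `x ∈ (0,1)^d`. -/
def normalCone {d : ℕ} (x : Space d) : Set (Space d) :=
  {v | v = 0 ∨ ∃ β : ℝ, 0 ≤ β ∧ ∃ n ∈ normals x, v = β • n}

/-! ### Skorokhod problem, reflected differential equation -/

/-- `(x, k)` solves on `[0,T]` the Skorokhod problem driven by `w`: `w = x + k`, `x` and `k` are
continuous, `x` is `[0,1]^d`-valued, `k_t = ∫_0^t n_s d|k|_s` with `n_s ∈ 𝒩(x_s)`, and `d|k|` is
carried by `{s : x_s ∈ ∂[0,1]^d}`. The finite measure `ν` is `d|k|`: as `|n_s| = 1` for `ν`-almost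
every `s`, the relation `dk = n dν` forces `ν` to be the total variation measure of `k`. -/
structure IsSkorokhodSolution {d : ℕ} (T : ℝ) (w x k : ℝ → Space d) : Prop where
  continuousOn_path : ContinuousOn x (Icc 0 T)
  continuousOn_push : ContinuousOn k (Icc 0 T)
  mem_cube : ∀ t ∈ Icc 0 T, x t ∈ cube d
  eq_add : ∀ t ∈ Icc 0 T, w t = x t + k t
  push : ∃ (ν : Measure ℝ) (n : ℝ → Space d), IsFiniteMeasure ν ∧ Measurable n ∧
    (∀ᵐ s ∂(ν.restrict (Ioc 0 T)), x s ∈ cubeBoundary d ∧ n s ∈ normals (x s)) ∧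
    ∀ t ∈ Icc 0 T, k t = ∫ s in Ioc 0 t, n s ∂ν

/-- `(χ_t)_{t ≥ 0}` solves the reflected differential equation
`χ_t = x₀ + ∫_0^t b(χ_s) ds - k_t`, with `k` the pushing process of the Skorokhod problem. -/
def IsRDESolution {d : ℕ} (b : Space d → Space d) (x₀ : Space d) (χ : ℝ → Space d) : Prop :=
  ∀ T > 0, ∃ k : ℝ → Space d,
    IsSkorokhodSolution T (fun t => x₀ + ∫ s in (0 : ℝ)..t, b (χ s)) χ k

/-- `{x ∈ [0,1]^d : |x|_1 < ℓ}`. -/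
def region (d : ℕ) (ℓ : ℝ) : Set (Space d) := {x ∈ cube d | ∑ j, |x j| < ℓ}

/-- `{x ∈ [0,1]^d : |x|_1 ≤ ℓ}`. -/
def closedRegion (d : ℕ) (ℓ : ℝ) : Set (Space d) := {x ∈ cube d | ∑ j, |x j| ≤ ℓ}

/-- The origin is the unique equilibrium point of the reflected differential equation driven by
`b`, it is stable, and it attracts the closed region of level `ℓ`, whose points enter the open
region immediately and never leave it. -/
structure IsAttractingOrigin {d : ℕ} (b : Space d → Space d) (ℓ : ℝ) : Prop where
  equilibrium : ∀ y ∈ cube d, IsRDESolution b y (fun _ => y) ↔ y = 0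
  stable : ∀ ε > 0, ∃ δ > 0, ∀ x₀ ∈ cube d, ‖x₀‖ < δ → ∀ χ, IsRDESolution b x₀ χ →
    ∀ t ≥ 0, ‖χ t‖ < ε
  attracts : ∀ x₀ ∈ closedRegion d ℓ, ∀ χ, IsRDESolution b x₀ χ →
    (∀ t > 0, χ t ∈ region d ℓ) ∧ Tendsto χ atTop (𝓝 0)

/-! ### Action functionals and quasi-potential -/

/-- The action `J_{0,T}(φ)`: the infimum of `∫_0^T L(φ_s, ψ'_s) ds` over the absolutely continuous
paths `ψ` on `[0,T]` whose Skorokhod reflection is `φ` (`+∞` if there are none). The Lagrangian of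
the model is non-negative because `H(x, 0) = 0`. -/
def action {d : ℕ} (H : Space d → Space d → ℝ) (T : ℝ) (φ : ℝ → Space d) : ℝ≥0∞ :=
  ⨅ ψ ∈ {ψ : ℝ → Space d | AbsolutelyContinuousOnInterval ψ 0 T ∧
      ∃ k, IsSkorokhodSolution T ψ φ k},
    ∫⁻ t in Icc 0 T, (lagrangian H (φ t) (deriv ψ t)).toENNReal

/-- The quasi-potential `V(x, y) = inf {J_{0,T}(φ) : φ_0 = x, φ_T = y, T > 0}`. -/
def quasiPotential {d : ℕ} (H : Space d → Space d → ℝ) (x y : Space d) : ℝ≥0∞ :=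
  ⨅ (T : ℝ) (_ : 0 < T) (φ : ℝ → Space d) (_ : φ 0 = x) (_ : φ T = y), action H T φ

open Classical in
/-- The reflected Lagrangian `L^ref`. -/
def reflectedLagrangian {d : ℕ} (H : Space d → Space d → ℝ) (x v : Space d) : EReal :=
  if x ∈ openCube d then lagrangian H x v
  else if ∃ n ∈ normals x, 0 < inner ℝ v n then ⊤
  else if ∀ n ∈ normals x, inner ℝ v n < 0 then lagrangian H x v
  else ⨅ (β : ℝ) (_ : 0 ≤ β) (n : Space d) (_ : n ∈ normals x) (_ : inner ℝ n v = 0),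
    lagrangian H x (v + β • n)

/-- Absolute continuity of `(ψ_t)_{t ≤ 0}` (on compact intervals). -/
def IsACOnNonpos {d : ℕ} (ψ : ℝ → Space d) : Prop :=
  ∀ a ≤ 0, AbsolutelyContinuousOnInterval ψ a 0

open Classical in
/-- The action `J_{-∞,0}(ψ) = ∫_{-∞}^0 L^ref(ψ_t, ψ'_t) dt`, equal to `+∞` when `ψ` is not
absolutely continuous. -/
def backwardAction {d : ℕ} (H : Space d → Space d → ℝ) (ψ : ℝ → Space d) : ℝ≥0∞ :=
  if IsACOnNonpos ψ then
    ∫⁻ t in Iic 0, (reflectedLagrangian H (ψ t) (deriv ψ t)).toENNReal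
  else ⊤

/-- The continuous paths `(ψ_t)_{t ≤ 0}` in `[0,1]^d` with `ψ_t → 0` as `t → -∞` and `ψ_0 = x`. -/
def backwardPaths {d : ℕ} (x : Space d) : Set (ℝ → Space d) :=
  {ψ | ContinuousOn ψ (Iic 0) ∧ (∀ t ≤ 0, ψ t ∈ cube d) ∧ Tendsto ψ atBot (𝓝 0) ∧ ψ 0 = x}

/-! ### The Hamilton-Jacobi equation and the backward reflected equation -/

/-- The gradient `∇W` of a function on `[0,1]^d` (one-sided at the boundary). -/
def grad {d : ℕ} (W : Space d → ℝ) (x : Space d) : Space d := gradientWithin W (cube d) x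

/-- The modified gradient `∇₊W`, equal to `∇W` in `(0,1)^d`. -/
def gradPlus {d : ℕ} (W : Space d → ℝ) (x : Space d) : Space d :=
  WithLp.toLp 2 (fun j =>
    if x j = 0 then min (grad W x j) 0
    else if x j = 1 then max (grad W x j) 0
    else grad W x j)

/-- `W ∈ C([0,1]^d)` is of class `C¹` on `[0,1]^d ∖ {0}`, solves `H(x, ∇W) = 0` in `(0,1)^d` with
the boundary condition `H(x, ∇₊W) = 0` on `∂[0,1]^d ∖ {0}`, and satisfies the two sign conditions
on the boundary. -/
structure IsClassicalSolution {d : ℕ} (H : Space d → Space d → ℝ) (W : Space d → ℝ) : Prop where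
  continuousOn : ContinuousOn W (cube d)
  contDiffOn : ContDiffOn ℝ 1 W (cube d \ {0})
  interior_eq : ∀ x ∈ openCube d, H x (grad W x) = 0
  boundary_eq : ∀ x ∈ cubeBoundary d, x ≠ 0 → H x (gradPlus W x) = 0
  normal_nonneg : ∀ x ∈ cubeBoundary d, x ≠ 0 → ∀ s : Step d, stepVec s ∈ normals x →
    0 ≤ inner ℝ (gradAlpha H x (gradPlus W x)) (stepVec s)
  sign_const : ∀ x ∈ cubeBoundary d, x ≠ 0 → ∀ s : Step d, stepVec s ∈ normals x →
    inner ℝ (gradAlpha H x (gradPlus W x)) (stepVec s) = 0 →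
    ∃ U ∈ 𝓝 x,
      (∀ y ∈ U ∩ cubeBoundary d, stepVec s ∈ normals y → inner ℝ (grad W y) (stepVec s) ≤ 0) ∨
      (∀ y ∈ U ∩ cubeBoundary d, stepVec s ∈ normals y → 0 ≤ inner ℝ (grad W y) (stepVec s))

/-- `(φ_t)_{t ≤ 0}` is an absolutely continuous path in `[0,1]^d` ending at `x`, which vanishes
exactly for `t ≤ -i`, and which solves on `(-i, 0]` the backward reflected equation
`φ' = ∇_α H(φ, ∇₊W(φ)) - k'` with `k' ∈ ℝ₊ 𝒩(φ)` and `⟨k', ∇₊W(φ)⟩ = 0`. -/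
structure IsBackwardReflectedPath {d : ℕ} (H : Space d → Space d → ℝ) (W : Space d → ℝ)
    (x : Space d) (φ k : ℝ → Space d) (i : EReal) : Prop where
  path_ac : IsACOnNonpos φ
  mem_cube : ∀ t ≤ 0, φ t ∈ cube d
  terminal : φ 0 = x
  life_pos : 0 < i
  eq_zero : ∀ t : ℝ, t ≤ 0 → (t : EReal) ≤ -i → φ t = 0
  ne_zero : ∀ t : ℝ, t ≤ 0 → -i < (t : EReal) → φ t ≠ 0
  push_ac : ∀ a : ℝ, a ≤ 0 → -i < (a : EReal) → AbsolutelyContinuousOnInterval k a 0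
  equation : ∀ᵐ (t : ℝ) ∂(volume.restrict (Iic (0 : ℝ))), -i < (t : EReal) →
    deriv φ t = gradAlpha H (φ t) (gradPlus W (φ t)) - deriv k t
  push_mem : ∀ᵐ (t : ℝ) ∂(volume.restrict (Iic (0 : ℝ))), -i < (t : EReal) →
    deriv k t ∈ normalCone (φ t)
  compatible : ∀ᵐ (t : ℝ) ∂(volume.restrict (Iic (0 : ℝ))), -i < (t : EReal) →
    inner ℝ (deriv k t) (gradPlus W (φ t)) = 0

end ReflectedWalk

end

open MeasureTheory Filter Topology Set
open scoped ENNReal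

noncomputable section

namespace ReflectedWalk

/-! ### Perron–Frobenius theory for irreducible matrices -/

section Perron

open Matrix

variable {E : Type*} [Fintype E]

/-! The argument is a verification theorem: `W` is a calibration for the action, and the backward
reflected paths are its calibrated curves.

Hamiltonian. `exp H(x, α)` is the Perron eigenvalue of the matrix `P(i, j) ∑_v exp⟨α, v⟩ p(x, j,
v)`. Perron–Frobenius theory and Jensen's inequality show that `H` is convex and differentiable in
`α`, with a jointly continuous gradient of norm at most `1`, and that `∇_α H(x, 0)` is the averaged
drift. This and a coercivity bound are collected in `IsRegularHamiltonian`; the rest of the proof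
sees the walk only through them.

Lower bound. A path in the cube has, at almost every time, zero velocity across the faces that it
touches, so that `W(φ)` has derivative `⟨∇₊W(φ), φ'⟩`: truncating the normal components of `∇W` is
invisible. Testing the Legendre transform at `∇₊W`, where `H` vanishes, gives `L(φ, φ' + κ) ≥ ⟨∇₊W,
φ'⟩ + ⟨∇₊W, κ⟩`, and the last term is nonnegative for every push `κ` in the normal cone. Integration
from the last visit to the origin yields `W ≤ V` (`IsClassicalSolution.le_quasiPotential`) and `W(x)
≤ J(ψ)` (`IsClassicalSolution.le_backwardAction`).

Equality. Both inequalities are equalities when `φ' + k' = ∇_α H(φ, ∇₊W)` and `⟨k', ∇₊W⟩ = 0`, which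
is the backward reflected equation. Two facts remain.

Such paths come from the origin. A velocity far from the averaged drift makes `W` grow at a
proportional rate, and a velocity close to it makes `‖φ‖²` decrease. Hence `‖φ‖² - C W(φ)` decreases
at a definite rate away from the origin (`exists_lyapunov`). As `W(φ)` is monotone and bounded, a
path that does not tend to the origin in the past would have unbounded norm there.

Such paths exist. In reversed time the obstacle is the discontinuity of `∇₊W` at the boundary. The
sign conditions on `W` split the faces through a point into sliding ones, on which the normal
component of `∇₊W` is zero and the path is kept, and others, near which no truncation occurs and the
reversed velocity points inwards. On the intersection of the sliding faces `∇₊W` is continuous, so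
Peano's theorem applies (`exists_local_reversedPath`), and Zorn's lemma extends the solution until
it reaches the origin.

Finally, a short straight segment from the origin to an early point of a backward path, followed by
that path, has a cost arbitrarily close to at most `W(x)`, whence `V ≤ W`. -/

lemma mulVec_mono_of_nonneg {M : Matrix E E ℝ} (hM : ∀ i j, 0 ≤ M i j) {v : E → ℝ}
    (hv : ∀ i, 0 ≤ v i) (i : E) : 0 ≤ (M *ᵥ v) i :=
  Finset.sum_nonneg fun j _ => mul_nonneg (hM i j) (hv j)

lemma mulVec_pos_of_pos {M : Matrix E E ℝ} (hM : ∀ i j, 0 < M i j) {v : E → ℝ}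
    (hv : ∀ i, 0 ≤ v i) (hv0 : v ≠ 0) (i : E) : 0 < (M *ᵥ v) i := by
  obtain ⟨j, hj⟩ := Function.ne_iff.1 hv0
  refine Finset.sum_pos' (fun k _ => mul_nonneg (hM i k).le (hv k)) ⟨j, Finset.mem_univ j, ?_⟩
  exact mul_pos (hM i j) (lt_of_le_of_ne (hv j) (Ne.symm hj))

lemma ne_zero_of_mem_stdSimplex {v : E → ℝ} (hv : v ∈ stdSimplex ℝ E) : v ≠ 0 := by
  rintro rfl
  have := hv.2
  simp at this

variable [DecidableEq E]

lemma pow_nonneg_entries {M : Matrix E E ℝ} (hM : ∀ i j, 0 ≤ M i j) (k : ℕ) (i j : E) :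
    0 ≤ (M ^ k) i j := by
  induction k generalizing i j with
  | zero =>
    rw [pow_zero, Matrix.one_apply]; split_ifs <;> norm_num
  | succ k ih =>
    rw [pow_succ, Matrix.mul_apply]
    exact Finset.sum_nonneg fun l _ => mul_nonneg (ih i l) (hM l j)

lemma pow_mulVec_of_eigen {M : Matrix E E ℝ} {r : ℝ} {v : E → ℝ} (h : M *ᵥ v = r • v) (k : ℕ) :
    (M ^ k) *ᵥ v = r ^ k • v := by
  induction k with
  | zero => simp
  | succ k ih =>
    rw [pow_succ, ← Matrix.mulVec_mulVec, h, Matrix.mulVec_smul, ih, smul_smul, pow_succ, mul_comm]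

/-- A nonnegative eigenvector of an irreducible matrix is positive, and so is its eigenvalue. -/
lemma eigen_pos {M : Matrix E E ℝ} (hM : M.IsIrreducible) {r : ℝ} {v : E → ℝ}
    (hv : ∀ i, 0 ≤ v i) (hv0 : v ≠ 0) (h : M *ᵥ v = r • v) : 0 < r ∧ ∀ i, 0 < v i := by
  obtain ⟨j, hj⟩ := Function.ne_iff.1 hv0
  have hj : 0 < v j := lt_of_le_of_ne (hv j) (Ne.symm hj)
  have key : ∀ i, ∃ k > 0, 0 < r ^ k * v i := by
    intro i
    obtain ⟨k, hk, hpos⟩ := (isIrreducible_iff_exists_pow_pos hM.nonneg).1 hM i j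
    refine ⟨k, hk, ?_⟩
    have := congrFun (pow_mulVec_of_eigen h k) i
    rw [Pi.smul_apply, smul_eq_mul] at this
    rw [← this]
    exact Finset.sum_pos' (fun l _ => mul_nonneg (pow_nonneg_entries hM.nonneg k i l) (hv l))
      ⟨j, Finset.mem_univ j, mul_pos hpos hj⟩
  have hpos : ∀ i, 0 < v i := by
    intro i
    obtain ⟨k, -, hk⟩ := key i
    rcases (hv i).eq_or_lt with h0 | h0
    · rw [← h0, mul_zero] at hk; exact absurd hk (lt_irrefl _)
    · exact h0
  refine ⟨?_, hpos⟩
  have hr : 0 ≤ r := by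
    have h1 := congrFun h j
    have h2 := mulVec_mono_of_nonneg hM.nonneg hv j
    rw [h1, Pi.smul_apply, smul_eq_mul] at h2
    exact nonneg_of_mul_nonneg_left h2 hj
  obtain ⟨k, hk, hk'⟩ := key j
  rcases hr.eq_or_lt with h0 | h0
  · rw [← h0, zero_pow hk.ne', zero_mul] at hk'; exact absurd hk' (lt_irrefl _)
  · exact h0

/-- An irreducible matrix may be periodic, with no positive power; a sum of sufficiently many powers
is positive all the same, and it commutes with `M`. -/
lemma exists_pos_commute {M : Matrix E E ℝ} (hM : M.IsIrreducible) :
    ∃ B : Matrix E E ℝ, Commute B M ∧ ∀ i j, 0 < B i j := by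
  choose k _ hk using (isIrreducible_iff_exists_pow_pos hM.nonneg).1 hM
  let N := ∑ i, ∑ j, k i j
  have hkN : ∀ i j, k i j < N + 1 := fun i j => Nat.lt_succ_of_le <|
    (Finset.single_le_sum (f := fun j => k i j) (fun _ _ => Nat.zero_le _) (Finset.mem_univ j)).trans
    (Finset.single_le_sum (f := fun i => ∑ j, k i j) (fun _ _ => Nat.zero_le _) (Finset.mem_univ i))
  refine ⟨∑ n ∈ Finset.range (N + 1), M ^ n, ?_, fun i j => ?_⟩
  · exact Commute.sum_left _ _ _ fun n _ => (Commute.refl M).pow_left n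
  · rw [Matrix.sum_apply]
    exact Finset.sum_pos' (fun n _ => pow_nonneg_entries hM.nonneg n i j)
      ⟨k i j, Finset.mem_range.2 (hkN i j), hk i j⟩

/-- Existence of a nonnegative eigenvector, by maximizing the Collatz–Wielandt quotient. -/
lemma exists_perron [Nonempty E] {M : Matrix E E ℝ} (hM : M.IsIrreducible) :
    ∃ v ∈ stdSimplex ℝ E, ∃ r : ℝ, M *ᵥ v = r • v := by
  let R := ∑ i, ∑ j, M i j
  -- Pairs of a candidate `r` and a vector `v` of the simplex with `r v ≤ M v`; `K` is compact, so a
  -- largest `r` is attained.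
  let K : Set (ℝ × (E → ℝ)) :=
    (Icc 0 R ×ˢ stdSimplex ℝ E) ∩ {z | ∀ i, z.1 * z.2 i ≤ (M *ᵥ z.2) i}
  have hKc : IsCompact K := by
    refine (isCompact_Icc.prod (isCompact_stdSimplex ℝ E)).inter_right ?_
    simp only [ofPred_forall]
    refine isClosed_iInter fun i => isClosed_le (by fun_prop) ?_
    simp only [Matrix.mulVec, dotProduct]
    fun_prop
  have hbound : ∀ (r : ℝ) (v : E → ℝ), v ∈ stdSimplex ℝ E → (∀ i, r * v i ≤ (M *ᵥ v) i) →
      r ≤ R := by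
    intro r v hv h
    calc r = ∑ i, r * v i := by rw [← Finset.mul_sum, hv.2, mul_one]
      _ ≤ ∑ i, (M *ᵥ v) i := Finset.sum_le_sum fun i _ => h i
      _ ≤ R := Finset.sum_le_sum fun i _ => Finset.sum_le_sum fun j _ =>
        mul_le_of_le_one_right (hM.nonneg i j) (mem_Icc_of_mem_stdSimplex hv j).2
  have hKn : K.Nonempty := by
    obtain ⟨i⟩ := ‹Nonempty E›
    have hs := single_mem_stdSimplex ℝ i
    refine ⟨(0, Pi.single i 1), ⟨⟨le_rfl, ?_⟩, hs⟩, ?_⟩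
    · exact Finset.sum_nonneg fun i _ => Finset.sum_nonneg fun j _ => hM.nonneg i j
    · intro j; rw [zero_mul]; exact mulVec_mono_of_nonneg hM.nonneg hs.1 j
  obtain ⟨⟨r, v⟩, ⟨⟨hr, hv⟩, hrv⟩, hmax⟩ := hKc.exists_isMaxOn hKn continuous_fst.continuousOn
  refine ⟨v, hv, r, ?_⟩
  by_contra hne
  -- If `w = M v - r v` were not zero, `u = B v` would satisfy `M u = r u + B w` with `B w`
  -- positive, so that `u`, normalized, would allow the larger value `r + ε`.
  obtain ⟨B, hBM, hB⟩ := exists_pos_commute hM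
  set w := M *ᵥ v - r • v with hw
  have hw0 : w ≠ 0 := fun h => hne (sub_eq_zero.1 h)
  have hwn : ∀ i, 0 ≤ w i := fun i => sub_nonneg.2 (hrv i)
  have hBw := mulVec_pos_of_pos hB hwn hw0
  have hBv := mulVec_pos_of_pos hB hv.1 (ne_zero_of_mem_stdSimplex hv)
  set u := B *ᵥ v with hu
  have hMu : M *ᵥ u = r • u + B *ᵥ w := by
    rw [hw, Matrix.mulVec_sub, Matrix.mulVec_smul, hu, Matrix.mulVec_mulVec, Matrix.mulVec_mulVec,
      hBM.eq]
    abel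
  obtain ⟨i₀, hi₀⟩ := Finite.exists_min fun i => (B *ᵥ w) i / u i
  set ε := (B *ᵥ w) i₀ / u i₀
  have hε : 0 < ε := div_pos (hBw i₀) (hBv i₀)
  have hs : 0 < ∑ i, u i := Finset.sum_pos (fun i _ => hBv i) Finset.univ_nonempty
  have hu' : (∑ i, u i)⁻¹ • u ∈ stdSimplex ℝ E := by
    refine ⟨fun i => mul_nonneg (inv_nonneg.2 hs.le) (hBv i).le, ?_⟩
    simp only [Pi.smul_apply, smul_eq_mul, ← Finset.mul_sum]
    exact inv_mul_cancel₀ hs.ne'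
  have hle : ∀ i, (r + ε) * ((∑ i, u i)⁻¹ • u) i ≤ (M *ᵥ ((∑ i, u i)⁻¹ • u)) i := by
    intro i
    rw [Matrix.mulVec_smul, hMu]
    simp only [Pi.smul_apply, smul_eq_mul, Pi.add_apply]
    have : ε * u i ≤ (B *ᵥ w) i := (le_div_iff₀ (hBv i)).1 (hi₀ i)
    have h2 : 0 ≤ (∑ i, u i)⁻¹ := inv_nonneg.2 hs.le
    nlinarith [mul_le_mul_of_nonneg_left this h2]
  have hmem : (r + ε, (∑ i, u i)⁻¹ • u) ∈ K :=
    ⟨⟨⟨add_nonneg hr.1 hε.le, hbound _ _ hu' hle⟩, hu'⟩, hle⟩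
  have := hmax hmem
  simp only [mem_ofPred_eq] at this
  linarith

/-- Two nonnegative eigenvectors in the simplex coincide. -/
lemma perron_unique {M : Matrix E E ℝ} (hM : M.IsIrreducible) {u v : E → ℝ} {r s : ℝ}
    (hu : u ∈ stdSimplex ℝ E) (hv : v ∈ stdSimplex ℝ E) (hMu : M *ᵥ u = r • u)
    (hMv : M *ᵥ v = s • v) : u = v ∧ r = s := by
  have hne : Nonempty E := by
    by_contra h
    rw [not_nonempty_iff] at h
    have := hu.2
    simp at this
  obtain ⟨-, hup⟩ := eigen_pos hM hu.1 (ne_zero_of_mem_stdSimplex hu) hMu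
  obtain ⟨-, hvp⟩ := eigen_pos hM hv.1 (ne_zero_of_mem_stdSimplex hv) hMv
  -- Pairing with a positive left eigenvector forces every positive right eigenvector to have the
  -- same eigenvalue `t`.
  obtain ⟨l, hl, t, hlt⟩ := exists_perron hM.transpose
  obtain ⟨-, hlp⟩ := eigen_pos hM.transpose hl.1 (ne_zero_of_mem_stdSimplex hl) hlt
  have eq_t : ∀ {w : E → ℝ} {q : ℝ}, (∀ i, 0 < w i) → M *ᵥ w = q • w → q = t := by
    intro w q hw hq
    have h1 : l ⬝ᵥ (M *ᵥ w) = t * (l ⬝ᵥ w) := by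
      rw [Matrix.dotProduct_mulVec, ← Matrix.mulVec_transpose, hlt, smul_dotProduct, smul_eq_mul]
    rw [hq, dotProduct_smul, smul_eq_mul] at h1
    have h2 : 0 < l ⬝ᵥ w := Finset.sum_pos (fun i _ => mul_pos (hlp i) (hw i)) Finset.univ_nonempty
    exact mul_right_cancel₀ h2.ne' h1
  have hrt := eq_t hup hMu
  have hst := eq_t hvp hMv
  refine ⟨?_, hrt.trans hst.symm⟩
  -- The largest `c` with `u - c v ≥ 0`. The difference is a nonnegative eigenvector with a zero
  -- coordinate, hence zero by `eigen_pos`.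
  obtain ⟨i₀, hi₀⟩ := Finite.exists_min fun i => u i / v i
  set c := u i₀ / v i₀ with hc
  have hwn : ∀ i, 0 ≤ (u - c • v) i := fun i => by
    have : c * v i ≤ u i := (le_div_iff₀ (hvp i)).1 (hi₀ i)
    simpa using this
  have hw0 : (u - c • v) i₀ = 0 := by
    simp [hc, (hvp i₀).ne']
  have hMw : M *ᵥ (u - c • v) = t • (u - c • v) := by
    rw [Matrix.mulVec_sub, Matrix.mulVec_smul, hMu, hMv, hrt, hst, smul_sub, smul_comm]
  have hw : u - c • v = 0 := by
    by_contra h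
    exact ((eigen_pos hM hwn h hMw).2 i₀).ne' hw0
  have huv : u = c • v := sub_eq_zero.1 hw
  have hc1 : c = 1 := by
    have := hu.2
    rw [huv] at this
    simpa [← Finset.mul_sum, hv.2] using this
  rw [huv, hc1, one_smul]

/-- The Perron eigenvector and eigenvalue of a continuous family of irreducible matrices are
continuous. -/
lemma exists_continuous_perron [Nonempty E] {Z : Type*} [TopologicalSpace Z]
    {M : Z → Matrix E E ℝ} (hM : ∀ z, (M z).IsIrreducible)
    (hc : ∀ i j, Continuous fun z => M z i j) :
    ∃ (h : Z → E → ℝ) (r : Z → ℝ), Continuous h ∧ Continuous r ∧ (∀ z, 0 < r z) ∧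
      (∀ z i, 0 < h z i) ∧ ∀ z, h z ∈ stdSimplex ℝ E ∧ M z *ᵥ h z = r z • h z := by
  choose h hs r hr using fun z => exists_perron (hM z)
  have hreq : ∀ z, r z = ∑ i, ∑ j, M z i j * h z j := by
    intro z
    have : ∑ i, (M z *ᵥ h z) i = r z := by
      rw [hr z]; simp [← Finset.mul_sum, (hs z).2]
    exact this.symm
  have hcont : Continuous h := by
    rw [continuous_iff_continuousAt]
    intro z
    -- Compactness and uniqueness give continuity: along an ultrafilter tending to `z` the
    -- eigenvectors converge in the simplex, and the limit is an eigenvector of `M z`, hence `h z`.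
    refine tendsto_iff_ultrafilter _ _ _ |>.2 fun U hU => ?_
    obtain ⟨v, hv, hUv⟩ := (isCompact_stdSimplex ℝ E).ultrafilter_le_nhds (U.map h)
      (le_principal_iff.2 (Filter.mem_map.2 (univ_mem' hs)))
    have hUv : Tendsto h U (𝓝 v) := hUv
    have hMt : ∀ i j, Tendsto (fun z => M z i j) U (𝓝 (M z i j)) := fun i j =>
      ((hc i j).tendsto z).mono_left hU
    have hht : ∀ j, Tendsto (fun z => h z j) U (𝓝 (v j)) := fun j => (tendsto_pi_nhds.1 hUv) j
    have hrt : Tendsto r U (𝓝 (∑ i, ∑ j, M z i j * v j)) := by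
      rw [show r = fun z => ∑ i, ∑ j, M z i j * h z j from funext hreq]
      exact tendsto_finsetSum _ fun i _ => tendsto_finsetSum _ fun j _ => (hMt i j).mul (hht j)
    have hv' : M z *ᵥ v = (∑ i, ∑ j, M z i j * v j) • v := by
      funext i
      have h1 : Tendsto (fun z => ∑ j, M z i j * h z j) U (𝓝 (∑ j, M z i j * v j)) :=
        tendsto_finsetSum _ fun j _ => (hMt i j).mul (hht j)
      have h2 : Tendsto (fun z => r z * h z i) U (𝓝 ((∑ i, ∑ j, M z i j * v j) * v i)) :=
        hrt.mul (hht i)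
      refine tendsto_nhds_unique h1 (h2.congr fun z => ?_)
      exact (congrFun (hr z) i).symm
    rw [(perron_unique (hM z) (hs z) hv (hr z) hv').1]
    exact hUv
  refine ⟨h, r, hcont, ?_, fun z => ?_, fun z => ?_, fun z => ⟨hs z, hr z⟩⟩
  · rw [show r = fun z => ∑ i, ∑ j, M z i j * h z j from funext hreq]
    exact continuous_finsetSum _ fun i _ => continuous_finsetSum _ fun j _ =>
      (hc i j).mul ((continuous_apply j).comp hcont)
  · exact (eigen_pos (hM z) (hs z).1 (ne_zero_of_mem_stdSimplex (hs z)) (hr z)).1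
  · exact (eigen_pos (hM z) (hs z).1 (ne_zero_of_mem_stdSimplex (hs z)) (hr z)).2

end Perron

/-! ### The Hamiltonian -/

/-- The properties of the Hamiltonian `H` with `∇_α H(x, 0) = b(x)` that are used below. -/
structure IsRegularHamiltonian {d : ℕ} (H : Space d → Space d → ℝ) (b : Space d → Space d) :
    Prop where
  continuous : Continuous fun z : Space d × Space d => H z.1 z.2
  continuous_grad : Continuous fun z : Space d × Space d => gradAlpha H z.1 z.2
  subgradient : ∀ x α β, H x α + inner ℝ (gradAlpha H x α) (β - α) ≤ H x β
  map_zero : ∀ x, H x 0 = 0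
  grad_zero : ∀ x, gradAlpha H x 0 = b x
  norm_grad_le : ∀ x α, ‖gradAlpha H x α‖ ≤ 1
  coercive : ∃ C : ℝ, ∀ x ∈ cube d, ∀ α (s : Step d), inner ℝ α (stepVec s) - C ≤ H x α

lemma norm_stepVec {d : ℕ} (s : Step d) : ‖stepVec s‖ = 1 := by
  unfold stepVec
  simp only [PiLp.norm_single]
  split_ifs <;> simp

lemma isCompact_cube (d : ℕ) : IsCompact (cube d) := by
  have h : cube d = (WithLp.toLp 2 : (Fin d → ℝ) → Space d) '' (Set.pi univ fun _ => Icc 0 1) := by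
    ext x
    constructor
    · intro hx
      exact ⟨WithLp.ofLp x, fun j _ => hx j, rfl⟩
    · rintro ⟨y, hy, rfl⟩ j
      exact hy j (mem_univ j)
  rw [h]
  exact (isCompact_univ_pi fun _ => isCompact_Icc).image (PiLp.continuous_toLp 2 _)

/-- The subgradient inequalities at `α` and at `β` place the first-order remainder between `0` and
`⟨g β - g α, β - α⟩`, which is `o(‖β - α‖)` by continuity of `g`. -/
lemma hasGradientAt_of_subgradient {F : Type*} [NormedAddCommGroup F] [InnerProductSpace ℝ F]
    [CompleteSpace F] {f : F → ℝ} {g : F → F} (hg : Continuous g)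
    (h : ∀ α β, f α + inner ℝ (g α) (β - α) ≤ f β) (α : F) : HasGradientAt f (g α) α := by
  rw [hasGradientAt_iff_isLittleO, Asymptotics.isLittleO_iff]
  intro c hc
  filter_upwards [Metric.continuousAt_iff'.1 hg.continuousAt c hc] with β hβ
  have h1 := h α β
  have h2 := h β α
  have h3 : inner ℝ (g β) (β - α) - inner ℝ (g α) (β - α) ≤ c * ‖β - α‖ := by
    rw [← inner_sub_left]
    refine (real_inner_le_norm _ _).trans ?_
    rw [dist_eq_norm] at hβ
    exact mul_le_mul_of_nonneg_right hβ.le (norm_nonneg _)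
  have h4 : inner ℝ (g β) (α - β) = - inner ℝ (g β) (β - α) := by
    rw [← inner_neg_right, neg_sub]
  rw [Real.norm_eq_abs, abs_le]
  constructor
  · have := mul_nonneg hc.le (norm_nonneg (β - α)); linarith
  · linarith

section Hamiltonian

open Matrix

variable {d : ℕ} {E : Type*}

lemma nonempty_step {p : Space d → E → Step d → ℝ} (hp : IsStepLaw p) (i : E) :
    Nonempty (Step d) := by
  by_contra h
  rw [not_nonempty_iff] at h
  have := (hp 0 i).2
  simp at this

lemma stepMGF_pos {p : Space d → E → Step d → ℝ} (hp : IsStepLaw p) (hA2 : EllipticSteps p)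
    (x α : Space d) (i : E) : 0 < stepMGF p x α i := by
  have := nonempty_step hp i
  exact Finset.sum_pos (fun s _ => mul_pos (Real.exp_pos _) (hA2 x i s)) Finset.univ_nonempty

lemma continuous_step {p : Space d → E → Step d → ℝ} (hA1 : LipschitzSteps p) (i : E)
    (s : Step d) : Continuous fun x => p x i s := by
  obtain ⟨K, hK⟩ := hA1
  have : LipschitzWith K.toNNReal fun x => p x i s := by
    refine LipschitzWith.of_dist_le_mul fun x y => ?_
    rw [Real.dist_eq, dist_eq_norm]
    exact (hK x y i s).trans (mul_le_mul_of_nonneg_right (Real.le_coe_toNNReal K) (norm_nonneg _))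
  exact this.continuous

lemma continuous_stepMGF {p : Space d → E → Step d → ℝ} (hA1 : LipschitzSteps p) (i : E) :
    Continuous fun z : Space d × Space d => stepMGF p z.1 z.2 i := by
  unfold stepMGF
  have := fun s => continuous_step hA1 i s
  fun_prop

/-- The weights `exp⟨α, v⟩ p(x, j, v)` averaged against the steps. -/
def tiltedStep (p : Space d → E → Step d → ℝ) (x α : Space d) (j : E) : Space d :=
  (stepMGF p x α j)⁻¹ • ∑ s, (Real.exp (inner ℝ α (stepVec s)) * p x j s) • stepVec s

lemma norm_tiltedStep_le {p : Space d → E → Step d → ℝ} (hp : IsStepLaw p)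
    (hA2 : EllipticSteps p) (x α : Space d) (j : E) : ‖tiltedStep p x α j‖ ≤ 1 := by
  have hm := stepMGF_pos hp hA2 x α j
  unfold tiltedStep
  rw [norm_smul, norm_inv, Real.norm_of_nonneg hm.le]
  rw [inv_mul_le_iff₀ hm, mul_one]
  refine (norm_sum_le _ _).trans (Finset.sum_le_sum fun s _ => ?_)
  rw [norm_smul, norm_stepVec, mul_one,
    Real.norm_of_nonneg (mul_nonneg (Real.exp_pos _).le (hA2 x j s).le)]

/-- Jensen's inequality for `exp` under the tilted step law `q`: the ratio of the two moment
generating functions is the `q`-mean of `exp⟨v, β - α⟩`. -/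
lemma inner_tiltedStep_le {p : Space d → E → Step d → ℝ} (hp : IsStepLaw p)
    (hA2 : EllipticSteps p) (x α β : Space d) (j : E) :
    inner ℝ (tiltedStep p x α j) (β - α) ≤
      Real.log (stepMGF p x β j) - Real.log (stepMGF p x α j) := by
  have hm := stepMGF_pos hp hA2 x α j
  have hm' := stepMGF_pos hp hA2 x β j
  set q : Step d → ℝ := fun s =>
    (stepMGF p x α j)⁻¹ * (Real.exp (inner ℝ α (stepVec s)) * p x j s) with hq
  have hq0 : ∀ s ∈ Finset.univ, 0 ≤ q s := fun s _ =>
    mul_nonneg (inv_nonneg.2 hm.le) (mul_nonneg (Real.exp_pos _).le (hA2 x j s).le)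
  have hq1 : ∑ s, q s = 1 := by
    rw [hq, ← Finset.mul_sum]
    exact inv_mul_cancel₀ hm.ne'
  have hJ := convexOn_exp.map_sum_le (t := Finset.univ) (w := q)
    (p := fun s => inner ℝ (stepVec s) (β - α)) hq0 hq1 (fun _ _ => mem_univ _)
  have hin : inner ℝ (tiltedStep p x α j) (β - α) = ∑ s, q s • inner ℝ (stepVec s) (β - α) := by
    rw [tiltedStep, real_inner_smul_left, sum_inner, Finset.mul_sum]
    refine Finset.sum_congr rfl fun s _ => ?_
    rw [real_inner_smul_left, hq, smul_eq_mul]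
    ring
  have hex : ∑ s, q s • Real.exp (inner ℝ (stepVec s) (β - α)) =
      stepMGF p x β j / stepMGF p x α j := by
    rw [div_eq_inv_mul]
    conv_rhs => arg 2; rw [stepMGF]
    rw [Finset.mul_sum]
    refine Finset.sum_congr rfl fun s _ => ?_
    rw [hq, smul_eq_mul, inner_sub_right, real_inner_comm, real_inner_comm α, Real.exp_sub]
    field_simp
  rw [← Real.log_div hm'.ne' hm.ne', ← hex, hin]
  rw [Real.le_log_iff_exp_le]
  · exact hJ
  · rw [hex]; exact div_pos hm' hm

lemma continuous_tiltedStep {p : Space d → E → Step d → ℝ} (hp : IsStepLaw p)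
    (hA1 : LipschitzSteps p) (hA2 : EllipticSteps p) (j : E) :
    Continuous fun z : Space d × Space d => tiltedStep p z.1 z.2 j := by
  unfold tiltedStep
  have h1 := continuous_stepMGF hA1 j
  have h2 := fun s => continuous_step hA1 j s
  refine (h1.inv₀ fun z => (stepMGF_pos hp hA2 z.1 z.2 j).ne').smul ?_
  fun_prop

variable [Fintype E]

/-- The matrix `P(i, j) ∑_v exp⟨α, v⟩ p(x, j, v)`, whose Perron eigenvalue is `exp H(x, α)`. -/
def tilted (P : Matrix E E ℝ) (p : Space d → E → Step d → ℝ) (x α : Space d) : Matrix E E ℝ :=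
  Matrix.of fun i j => P i j * stepMGF p x α j

lemma expMoment_zero (P : Matrix E E ℝ) (p : Space d → E → Step d → ℝ) (x α : Space d) (i : E) :
    expMoment P p x α i 0 = 1 := by
  simp [expMoment]

/-- Markov property at the first transition: the moments are the iterates of the tilted matrix
applied to the constant `1`. -/
lemma expMoment_succ (P : Matrix E E ℝ) (p : Space d → E → Step d → ℝ) (x α : Space d) (i : E)
    (n : ℕ) : expMoment P p x α i (n + 1) =
      ∑ j, P i j * stepMGF p x α j * expMoment P p x α j n := by
  unfold expMoment
  rw [← (Fin.consEquiv fun _ : Fin (n + 1) => E).sum_comp, Fintype.sum_prod_type]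
  refine Finset.sum_congr rfl fun j _ => ?_
  rw [Finset.mul_sum]
  refine Finset.sum_congr rfl fun ξ _ => ?_
  simp only [Fin.consEquiv_apply, Fin.prod_univ_succ, Fin.castSucc_zero, Fin.cons_zero,
    Fin.cons_succ, ← Fin.succ_castSucc]
  ring

/-- The drift of the tilted walk, with environment law proportional to `w`. -/
def tiltedDrift (p : Space d → E → Step d → ℝ) (x α : Space d) (w : E → ℝ) : Space d :=
  (∑ j, w j)⁻¹ • ∑ j, w j • tiltedStep p x α j

lemma norm_tiltedDrift_le {p : Space d → E → Step d → ℝ} (hp : IsStepLaw p)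
    (hA2 : EllipticSteps p) (x α : Space d) {w : E → ℝ} (hw : ∀ j, 0 < w j) (i : E) :
    ‖tiltedDrift p x α w‖ ≤ 1 := by
  have : Nonempty E := ⟨i⟩
  have hs : 0 < ∑ j, w j := Finset.sum_pos (fun j _ => hw j) Finset.univ_nonempty
  unfold tiltedDrift
  rw [norm_smul, norm_inv, Real.norm_of_nonneg hs.le, inv_mul_le_iff₀ hs, mul_one]
  refine (norm_sum_le _ _).trans (Finset.sum_le_sum fun j _ => ?_)
  rw [norm_smul, Real.norm_of_nonneg (hw j).le]
  exact mul_le_of_le_one_right (hw j).le (norm_tiltedStep_le hp hA2 x α j)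

/-- The Hamiltonian is the logarithm of the Perron eigenvalue. -/
lemma hamiltonian_eq_log {P : Matrix E E ℝ} {p : Space d → E → Step d → ℝ} {x α : Space d}
    (hn : ∀ i j, 0 ≤ tilted P p x α i j) {h : E → ℝ} {r : ℝ} (hh : ∀ i, 0 < h i) (hr : 0 < r)
    (he : tilted P p x α *ᵥ h = r • h) (i : E) : hamiltonian P p i x α = Real.log r := by
  have : Nonempty E := ⟨i⟩
  obtain ⟨a, ha⟩ := Finite.exists_min h
  obtain ⟨b, hb⟩ := Finite.exists_max h
  have he' : ∀ i, ∑ j, P i j * stepMGF p x α j * h j = r * h i := fun i => congrFun he i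
  -- Since `h / max h ≤ 1 ≤ h / min h`, iterating the tilted matrix keeps the moment between `r ^ n
  -- h / max h` and `r ^ n h / min h`; the constants disappear in the logarithmic limit.
  have hup : ∀ (n : ℕ) (i : E), expMoment P p x α i n ≤ r ^ n * h i / h a := by
    intro n
    induction n with
    | zero =>
      intro i
      rw [expMoment_zero, pow_zero, one_mul, le_div_iff₀ (hh a), one_mul]
      exact ha i
    | succ n ih =>
      intro i
      rw [expMoment_succ]
      calc _ ≤ ∑ j, P i j * stepMGF p x α j * (r ^ n * h j / h a) :=
            Finset.sum_le_sum fun j _ => mul_le_mul_of_nonneg_left (ih j) (hn i j)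
        _ = r ^ n / h a * ∑ j, P i j * stepMGF p x α j * h j := by
            rw [Finset.mul_sum]; refine Finset.sum_congr rfl fun j _ => by ring
        _ = _ := by rw [he']; ring
  have hlo : ∀ (n : ℕ) (i : E), r ^ n * h i / h b ≤ expMoment P p x α i n := by
    intro n
    induction n with
    | zero =>
      intro i
      rw [expMoment_zero, pow_zero, one_mul, div_le_iff₀ (hh b), one_mul]
      exact hb i
    | succ n ih =>
      intro i
      rw [expMoment_succ]
      calc _ = r ^ n / h b * ∑ j, P i j * stepMGF p x α j * h j := by rw [he']; ring
        _ = ∑ j, P i j * stepMGF p x α j * (r ^ n * h j / h b) := by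
            rw [Finset.mul_sum]; refine Finset.sum_congr rfl fun j _ => by ring
        _ ≤ _ := Finset.sum_le_sum fun j _ => mul_le_mul_of_nonneg_left (ih j) (hn i j)
  have hlim : ∀ c : ℝ, 0 < c → Tendsto (fun n : ℕ => (n : ℝ)⁻¹ * Real.log (r ^ n * h i / c)) atTop
      (𝓝 (Real.log r)) := by
    intro c hc
    have h1 : Tendsto (fun n : ℕ => Real.log r + (n : ℝ)⁻¹ * Real.log (h i / c)) atTop
        (𝓝 (Real.log r + 0 * Real.log (h i / c))) :=
      tendsto_const_nhds.add (tendsto_inv_atTop_nhds_zero_nat.mul_const _)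
    rw [zero_mul, add_zero] at h1
    refine h1.congr' ?_
    filter_upwards [eventually_gt_atTop 0] with n hn0
    rw [mul_div_assoc, Real.log_mul (pow_pos hr n).ne' (div_pos (hh i) hc).ne', Real.log_pow]
    have : (n : ℝ) ≠ 0 := Nat.cast_ne_zero.2 hn0.ne'
    field_simp
  refine Tendsto.limUnder_eq (tendsto_of_tendsto_of_tendsto_of_le_of_le (hlim _ (hh b))
    (hlim _ (hh a)) (fun n => ?_) fun n => ?_)
  · exact mul_le_mul_of_nonneg_left (Real.log_le_log
      (div_pos (mul_pos (pow_pos hr n) (hh i)) (hh b)) (hlo n i)) (by positivity)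
  · exact mul_le_mul_of_nonneg_left (Real.log_le_log
      ((div_pos (mul_pos (pow_pos hr n) (hh i)) (hh b)).trans_le (hlo n i)) (hup n i))
      (by positivity)

/-- The tilted drift is a subgradient of the logarithm of the Perron eigenvalue. -/
lemma log_perron_subgradient {P : Matrix E E ℝ} (hP : ∀ i j, 0 ≤ P i j)
    {p : Space d → E → Step d → ℝ} (hp : IsStepLaw p) (hA2 : EllipticSteps p) {x α β : Space d}
    {h h' l : E → ℝ} {r r' : ℝ} (hh : ∀ i, 0 < h i) (hh' : ∀ i, 0 < h' i) (hl : ∀ i, 0 < l i)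
    (hr : 0 < r) (hr' : 0 < r') (he : tilted P p x α *ᵥ h = r • h)
    (he' : tilted P p x β *ᵥ h' = r' • h') (hel : (tilted P p x α)ᵀ *ᵥ l = r • l) (i₀ : E) :
    Real.log r + inner ℝ (tiltedDrift p x α fun j => l j * h j) (β - α) ≤ Real.log r' := by
  have : Nonempty E := ⟨i₀⟩
  set m := stepMGF p x α with hmdef
  set m' := stepMGF p x β with hmdef'
  have hm : ∀ j, 0 < m j := stepMGF_pos hp hA2 x α
  have hm' : ∀ j, 0 < m' j := stepMGF_pos hp hA2 x β
  have he₁ : ∀ i, ∑ j, P i j * m j * h j = r * h i := fun i => congrFun he i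
  have he₂ : ∀ i, ∑ j, P i j * m' j * h' j = r' * h' i := fun i => congrFun he' i
  have he₃ : ∀ j, ∑ i, P i j * m j * l i = r * l j := fun j => congrFun hel j
  -- Doob transform of the tilted matrix by its eigenvector: a stochastic matrix, with invariant
  -- measure `w = l h`.
  set Q : E → E → ℝ := fun i j => P i j * m j * h j / (r * h i) with hQ
  have hQ0 : ∀ i j, 0 ≤ Q i j := fun i j => div_nonneg
    (mul_nonneg (mul_nonneg (hP i j) (hm j).le) (hh j).le) (mul_pos hr (hh i)).le
  have hQ1 : ∀ i, ∑ j, Q i j = 1 := fun i => by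
    rw [hQ, ← Finset.sum_div, he₁, div_self (mul_pos hr (hh i)).ne']
  -- Jensen's inequality for `log` under `Q i`; the values `y j` are chosen to have `Q i`-mean `r'
  -- h' i`.
  have hJ : ∀ i, ∑ j, Q i j * (Real.log r + Real.log (h i) + (Real.log (m' j) - Real.log (m j)) +
      Real.log (h' j) - Real.log (h j)) ≤ Real.log r' + Real.log (h' i) := by
    intro i
    set y : E → ℝ := fun j => r * h i * m' j * h' j / (m j * h j) with hy
    have hy0 : ∀ j, 0 < y j := fun j =>
      div_pos (mul_pos (mul_pos (mul_pos hr (hh i)) (hm' j)) (hh' j)) (mul_pos (hm j) (hh j))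
    have h1 := strictConcaveOn_log_Ioi.concaveOn.le_map_sum (t := Finset.univ) (w := Q i) (p := y)
      (fun j _ => hQ0 i j) (hQ1 i) (fun j _ => hy0 j)
    have h2 : ∑ j, Q i j • y j = r' * h' i := by
      rw [← he₂]
      refine Finset.sum_congr rfl fun j _ => ?_
      have := (hm j).ne'; have := (hh j).ne'; have := (hh i).ne'
      rw [hQ, hy, smul_eq_mul]
      field_simp
    rw [h2, Real.log_mul hr'.ne' (hh' i).ne'] at h1
    refine le_trans (le_of_eq (Finset.sum_congr rfl fun j _ => ?_)) h1
    rw [hy, smul_eq_mul, Real.log_div (mul_pos (mul_pos (mul_pos hr (hh i)) (hm' j)) (hh' j)).ne'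
      (mul_pos (hm j) (hh j)).ne', Real.log_mul (mul_pos (mul_pos hr (hh i)) (hm' j)).ne'
      (hh' j).ne', Real.log_mul (mul_pos hr (hh i)).ne' (hm' j).ne', Real.log_mul hr.ne'
      (hh i).ne', Real.log_mul (hm j).ne' (hh j).ne']
    ring
  set w : E → ℝ := fun j => l j * h j with hw
  have hw0 : ∀ j, 0 < w j := fun j => mul_pos (hl j) (hh j)
  have hwQ : ∀ j, ∑ i, w i * Q i j = w j := by
    intro j
    have : ∀ i, w i * Q i j = h j / r * (P i j * m j * l i) := by
      intro i
      have := (hh i).ne'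
      rw [hw, hQ]; field_simp
    simp only [this]
    rw [← Finset.mul_sum, he₃, hw]; field_simp
  have hS : 0 < ∑ j, w j := Finset.sum_pos (fun j _ => hw0 j) Finset.univ_nonempty
  -- Integrate `hJ` against `w`: by invariance all terms in `log h` and `log h'` cancel.
  have hsum : ∑ j, w j * (Real.log (m' j) - Real.log (m j)) ≤
      (∑ j, w j) * (Real.log r' - Real.log r) := by
    have h1 := Finset.sum_le_sum fun i (_ : i ∈ Finset.univ) =>
      mul_le_mul_of_nonneg_left (hJ i) (hw0 i).le
    have h2 : ∑ i, w i * ∑ j, Q i j * (Real.log r + Real.log (h i) +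
        (Real.log (m' j) - Real.log (m j)) + Real.log (h' j) - Real.log (h j)) =
        ∑ i, w i * (Real.log r + Real.log (h i)) +
        ∑ j, w j * ((Real.log (m' j) - Real.log (m j)) + Real.log (h' j) - Real.log (h j)) := by
      have e1 : ∀ i, ∑ j, Q i j * (Real.log r + Real.log (h i) +
          (Real.log (m' j) - Real.log (m j)) + Real.log (h' j) - Real.log (h j)) =
          (Real.log r + Real.log (h i)) + ∑ j, Q i j *
          ((Real.log (m' j) - Real.log (m j)) + Real.log (h' j) - Real.log (h j)) := by
        intro i
        have e2 : Real.log r + Real.log (h i) =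
            ∑ j, Q i j * (Real.log r + Real.log (h i)) := by
          rw [← Finset.sum_mul, hQ1 i, one_mul]
        conv_rhs => rw [e2, ← Finset.sum_add_distrib]
        refine Finset.sum_congr rfl fun j _ => by ring
      simp only [e1, mul_add (w _), Finset.sum_add_distrib, Finset.mul_sum]
      congr 1
      rw [Finset.sum_comm]
      refine Finset.sum_congr rfl fun j _ => ?_
      rw [← hwQ j, Finset.sum_mul]
      refine Finset.sum_congr rfl fun i _ => ?_
      ring
    rw [h2] at h1
    have h3 : ∀ f g : E → ℝ, ∑ j, w j * (f j + g j) = ∑ j, w j * f j + ∑ j, w j * g j := by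
      intro f g; simp only [mul_add, Finset.sum_add_distrib]
    have h4 : ∀ f g : E → ℝ, ∑ j, w j * (f j - g j) = ∑ j, w j * f j - ∑ j, w j * g j := by
      intro f g; simp only [mul_sub, Finset.sum_sub_distrib]
    simp only [h3, h4, ← Finset.sum_mul] at h1 ⊢
    linarith
  have hfin : inner ℝ (tiltedDrift p x α w) (β - α) ≤ Real.log r' - Real.log r := by
    rw [tiltedDrift, real_inner_smul_left, inv_mul_le_iff₀ hS]
    refine le_trans ?_ hsum
    rw [sum_inner]
    refine Finset.sum_le_sum fun j _ => ?_
    rw [real_inner_smul_left]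
    exact mul_le_mul_of_nonneg_left (inner_tiltedStep_le hp hA2 x α β j) (hw0 j).le
  linarith

lemma exists_step_lower_bound {p : Space d → E → Step d → ℝ} (hA1 : LipschitzSteps p)
    (hA2 : EllipticSteps p) : ∃ ε > 0, ∀ x ∈ cube d, ∀ i s, ε ≤ p x i s := by
  have h1 : ∀ q : E × Step d, ∃ ε > 0, ∀ x ∈ cube d, ε ≤ p x q.1 q.2 := by
    intro q
    have hne : (cube d).Nonempty := ⟨0, fun j => by simp⟩
    obtain ⟨y, -, hy⟩ := (isCompact_cube d).exists_isMinOn hne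
      (continuous_step hA1 q.1 q.2).continuousOn
    exact ⟨_, hA2 y q.1 q.2, fun x hx => hy hx⟩
  choose ε hε hle using h1
  rcases isEmpty_or_nonempty (E × Step d) with h | h
  · exact ⟨1, one_pos, fun x _ i s => (h.false (i, s)).elim⟩
  · obtain ⟨q, hq⟩ := Finite.exists_min ε
    exact ⟨ε q, hε q, fun x hx i s => (hq (i, s)).trans (hle (i, s) x hx)⟩

variable [DecidableEq E]

/-- With `c` the smallest of the positive weights `stepMGF p x α j`, powers of the tilted matrix
dominate `c ^ k P ^ k` entrywise. -/
lemma tilted_isIrreducible {P : Matrix E E ℝ} (hP : P.IsIrreducible)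
    {p : Space d → E → Step d → ℝ} (hp : IsStepLaw p) (hA2 : EllipticSteps p) (x α : Space d) :
    (tilted P p x α).IsIrreducible := by
  have hm := stepMGF_pos hp hA2 x α
  have hn : ∀ i j, 0 ≤ tilted P p x α i j := fun i j => mul_nonneg (hP.nonneg i j) (hm j).le
  rw [isIrreducible_iff_exists_pow_pos hn]
  intro i j
  have : Nonempty E := ⟨i⟩
  obtain ⟨l, hl⟩ := Finite.exists_min (stepMGF p x α)
  set c := stepMGF p x α l
  have key : ∀ (k : ℕ) (i j : E), c ^ k * (P ^ k) i j ≤ (tilted P p x α ^ k) i j := by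
    intro k
    induction k with
    | zero => intro i j; simp
    | succ k ih =>
      intro i j
      rw [pow_succ, pow_succ, Matrix.mul_apply, pow_succ, Matrix.mul_apply, Finset.mul_sum]
      refine Finset.sum_le_sum fun a _ => ?_
      calc c ^ k * c * ((P ^ k) i a * P a j) = (c ^ k * (P ^ k) i a) * (P a j * c) := by ring
        _ ≤ (tilted P p x α ^ k) i a * (P a j * stepMGF p x α j) := by
          refine mul_le_mul (ih i a) (mul_le_mul_of_nonneg_left (hl j) (hP.nonneg a j))
            (mul_nonneg (hP.nonneg a j) (hm l).le) (pow_nonneg_entries hn k i a)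
  obtain ⟨k, hk, hpos⟩ := (isIrreducible_iff_exists_pow_pos hP.nonneg).1 hP i j
  exact ⟨k, hk, (mul_pos (pow_pos (hm l) k) hpos).trans_le (key k i j)⟩

/-- Source of the coercivity of `H`: read at a minimum of `h`, the eigenvalue equation shows that
`r` is at least the smallest step weight, because the rows of `P` sum to one. -/
lemma inner_sub_log_le_hamiltonian {P : Matrix E E ℝ} (hP : P ∈ Matrix.rowStochastic ℝ E)
    {p : Space d → E → Step d → ℝ} {x α : Space d} {ε : ℝ} (hε : 0 < ε)
    (hpε : ∀ i s, ε ≤ p x i s) {h : E → ℝ} {r : ℝ} (hh : ∀ i, 0 < h i)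
    (he : tilted P p x α *ᵥ h = r • h) (i₀ : E) (s : Step d) :
    inner ℝ α (stepVec s) + Real.log ε ≤ Real.log r := by
  have : Nonempty E := ⟨i₀⟩
  set c := Real.exp (inner ℝ α (stepVec s)) * ε with hc
  have hc0 : 0 < c := mul_pos (Real.exp_pos _) hε
  have hm : ∀ j, c ≤ stepMGF p x α j := fun j => by
    refine le_trans (mul_le_mul_of_nonneg_left (hpε j s) (Real.exp_pos _).le) ?_
    exact Finset.single_le_sum (f := fun s => Real.exp (inner ℝ α (stepVec s)) * p x j s)
      (fun s _ => mul_nonneg (Real.exp_pos _).le (hε.le.trans (hpε j s))) (Finset.mem_univ s)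
  obtain ⟨a, ha⟩ := Finite.exists_min h
  have hP0 := (mem_rowStochastic_iff_sum.1 hP).1
  have hP1 := (mem_rowStochastic_iff_sum.1 hP).2
  have h1 : ∑ j, P a j * stepMGF p x α j * h j = r * h a := congrFun he a
  have h2 : c * h a ≤ r * h a := by
    rw [← h1]
    calc c * h a = ∑ j, P a j * c * h a := by
          rw [← Finset.sum_mul, ← Finset.sum_mul, hP1, one_mul]
      _ ≤ _ := Finset.sum_le_sum fun j _ => mul_le_mul
          (mul_le_mul_of_nonneg_left (hm j) (hP0 a j)) (ha j) (hh a).le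
          (mul_nonneg (hP0 a j) (hc0.le.trans (hm j)))
  have h3 : c ≤ r := le_of_mul_le_mul_right h2 (hh a)
  have h4 := Real.log_le_log hc0 h3
  rwa [hc, Real.log_mul (Real.exp_pos _).ne' hε.ne', Real.log_exp] at h4

/-- The Hamiltonian of the walk in the Markovian environment is regular. -/
theorem isRegularHamiltonian {P : Matrix E E ℝ} (hP : P ∈ Matrix.rowStochastic ℝ E)
    {p : Space d → E → Step d → ℝ} (hp : IsStepLaw p) (hA1 : LipschitzSteps p)
    (hA2 : EllipticSteps p) (hA3 : P.IsIrreducible) {μ : E → ℝ}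
    (hμ : IsInvariantProbability P μ) (i₀ : E) :
    IsRegularHamiltonian (hamiltonian P p i₀) (avgDrift p μ) := by
  have : Nonempty E := ⟨i₀⟩
  have hirr : ∀ z : Space d × Space d, (tilted P p z.1 z.2).IsIrreducible := fun z =>
    tilted_isIrreducible hA3 hp hA2 z.1 z.2
  have hcont : ∀ i j, Continuous fun z : Space d × Space d => tilted P p z.1 z.2 i j :=
    fun i j => continuous_const.mul (continuous_stepMGF hA1 j)
  obtain ⟨h, r, hhc, hrc, hr0, hh0, hhr⟩ := exists_continuous_perron hirr hcont
  obtain ⟨l, t, hlc, -, ht0, hl0, hlt⟩ := exists_continuous_perron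
    (M := fun z : Space d × Space d => (tilted P p z.1 z.2)ᵀ) (fun z => (hirr z).transpose)
    (fun i j => hcont j i)
  -- The left and right eigenvalues agree, by pairing the two positive eigenvectors.
  have hrt : ∀ z, t z = r z := by
    intro z
    have h1 : l z ⬝ᵥ (tilted P p z.1 z.2 *ᵥ h z) = t z * (l z ⬝ᵥ h z) := by
      rw [Matrix.dotProduct_mulVec, ← Matrix.mulVec_transpose, (hlt z).2, smul_dotProduct,
        smul_eq_mul]
    rw [(hhr z).2, dotProduct_smul, smul_eq_mul] at h1
    have h2 : 0 < l z ⬝ᵥ h z :=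
      Finset.sum_pos (fun i _ => mul_pos (hl0 z i) (hh0 z i)) Finset.univ_nonempty
    exact (mul_right_cancel₀ h2.ne' h1).symm
  have hH : ∀ x α, hamiltonian P p i₀ x α = Real.log (r (x, α)) := fun x α =>
    hamiltonian_eq_log (hirr (x, α)).nonneg (hh0 (x, α)) (hr0 (x, α)) (hhr (x, α)).2 i₀
  set g : Space d → Space d → Space d := fun x α =>
    tiltedDrift p x α fun j => l (x, α) j * h (x, α) j with hg
  have hsub : ∀ x α β, hamiltonian P p i₀ x α + inner ℝ (g x α) (β - α) ≤
      hamiltonian P p i₀ x β := by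
    intro x α β
    rw [hH, hH]
    refine log_perron_subgradient hA3.nonneg hp hA2 (hh0 _) (hh0 _) (hl0 _) (hr0 _) (hr0 _)
      (hhr (x, α)).2 (hhr (x, β)).2 ?_ i₀
    rw [← hrt]
    exact (hlt (x, α)).2
  have hlj : ∀ j, Continuous fun z => l z j := fun j => (continuous_apply j).comp hlc
  have hhj : ∀ j, Continuous fun z => h z j := fun j => (continuous_apply j).comp hhc
  have hgc : Continuous fun z : Space d × Space d => g z.1 z.2 := by
    have hs := fun j => continuous_tiltedStep hp hA1 hA2 j
    simp only [hg, tiltedDrift]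
    have hw : Continuous fun z : Space d × Space d => ∑ j, l z j * h z j :=
      continuous_finsetSum _ fun j _ => (hlj j).mul (hhj j)
    refine Continuous.smul (hw.inv₀ fun z => ?_) ?_
    · exact (Finset.sum_pos (fun j _ => mul_pos (hl0 z j) (hh0 z j)) Finset.univ_nonempty).ne'
    · exact continuous_finsetSum _ fun j _ => ((hlj j).mul (hhj j)).smul (hs j)
  have hgrad : ∀ x α, gradAlpha (hamiltonian P p i₀) x α = g x α := fun x α =>
    (hasGradientAt_of_subgradient (g := g x) (by fun_prop) (hsub x) α).gradient
  have hm0 : ∀ x j, stepMGF p x 0 j = 1 := by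
    intro x j
    simp only [stepMGF, inner_zero_left, Real.exp_zero, one_mul]
    exact (hp x j).2
  -- At `α = 0` the tilted matrix is `P`: the right eigenvector is uniform and the left one is `μ`,
  -- so the tilted drift is the averaged drift.
  have hzero : ∀ x, (h (x, 0) = fun _ => (Fintype.card E : ℝ)⁻¹) ∧ r (x, 0) = 1 := by
    intro x
    refine perron_unique (hirr (x, 0)) (hhr _).1 ⟨fun _ => by positivity, ?_⟩ (hhr _).2 ?_
    · simp
    · funext i
      simp only [tilted, Matrix.mulVec, dotProduct, Matrix.of_apply, hm0, mul_one,
        ← Finset.sum_mul, (mem_rowStochastic_iff_sum.1 hP).2 i, Pi.smul_apply, smul_eq_mul]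
  have hlzero : ∀ x, l (x, 0) = μ := by
    intro x
    refine (perron_unique (hirr (x, 0)).transpose (hlt _).1 hμ.1 (hlt _).2 (s := 1) ?_).1
    have : tilted P p x 0 = P := by ext i j; simp [tilted, hm0]
    rw [this, Matrix.mulVec_transpose, hμ.2, one_smul]
  refine ⟨?_, ?_, ?_, ?_, ?_, ?_, ?_⟩
  · simp only [hH]
    exact Continuous.log (f := fun z : Space d × Space d => r z) hrc fun z => (hr0 z).ne'
  · simp only [hgrad]; exact hgc
  · intro x α β; rw [hgrad]; exact hsub x α β
  · intro x; rw [hH, (hzero x).2, Real.log_one]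
  · intro x
    have hcard : (Fintype.card E : ℝ) ≠ 0 := Nat.cast_ne_zero.2 Fintype.card_ne_zero
    rw [hgrad, hg]
    simp only [tiltedDrift, (hzero x).1, hlzero, tiltedStep, hm0, inner_zero_left, Real.exp_zero,
      one_mul, inv_one, one_smul, ← Finset.sum_mul, hμ.1.2, inv_inv]
    rw [avgDrift, Finset.smul_sum]
    simp only [Finset.smul_sum, smul_smul, Finset.sum_smul]
    rw [Finset.sum_comm]
    refine Finset.sum_congr rfl fun s _ => Finset.sum_congr rfl fun j _ => ?_
    congr 1
    field_simp
  · intro x α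
    rw [hgrad]
    exact norm_tiltedDrift_le hp hA2 x α (fun j => mul_pos (hl0 _ j) (hh0 _ j)) i₀
  · obtain ⟨ε, hε, hle⟩ := exists_step_lower_bound hA1 hA2
    refine ⟨- Real.log ε, fun x hx α s => ?_⟩
    rw [sub_neg_eq_add, hH]
    exact inner_sub_log_le_hamiltonian hP hε (hle x hx) (hh0 (x, α)) (hhr (x, α)).2 i₀ s

end Hamiltonian

/-! ### The hypercube, its normal cones and the modified gradient -/

section Cube

variable {d : ℕ}

lemma inner_eq_sum (x y : Space d) : inner ℝ x y = ∑ j, x j * y j := by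
  simp [PiLp.inner_apply, mul_comm]

lemma inner_single_right (x : Space d) (j : Fin d) (c : ℝ) :
    inner ℝ x (EuclideanSpace.single j c) = c * x j := by
  simp [EuclideanSpace.inner_single_right]

lemma continuous_coord (j : Fin d) : Continuous fun x : Space d => x j :=
  (EuclideanSpace.proj j : Space d →L[ℝ] ℝ).continuous

lemma abs_coord_le_norm (x : Space d) (j : Fin d) : |x j| ≤ ‖x‖ := by
  simpa using PiLp.norm_apply_le x j

lemma zero_mem_cube : (0 : Space d) ∈ cube d := fun j => by simp

lemma convex_cube : Convex ℝ (cube d) := by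
  intro x hx y hy a b ha hb hab j
  have h1 := hx j
  have h2 := hy j
  simp only [PiLp.add_apply, PiLp.smul_apply, smul_eq_mul]
  constructor
  · exact add_nonneg (mul_nonneg ha h1.1) (mul_nonneg hb h2.1)
  · calc a * x j + b * y j ≤ a * 1 + b * 1 := add_le_add (mul_le_mul_of_nonneg_left h1.2 ha)
          (mul_le_mul_of_nonneg_left h2.2 hb)
      _ = 1 := by rw [mul_one, mul_one, hab]

lemma isOpen_openCube : IsOpen (openCube d) := by
  have : openCube d = ⋂ j : Fin d, ((fun x : Space d => x j) ⁻¹' Ioo 0 1) := by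
    ext x; simp [openCube]
  rw [this]
  exact isOpen_iInter_of_finite fun j => isOpen_Ioo.preimage (continuous_coord j)

lemma openCube_subset_cube : openCube d ⊆ cube d := fun _ hx j => ⟨(hx j).1.le, (hx j).2.le⟩

lemma uniqueDiffOn_cube : UniqueDiffOn ℝ (cube d) := by
  refine uniqueDiffOn_convex convex_cube ⟨WithLp.toLp 2 fun _ => (1 / 2 : ℝ), ?_⟩
  refine interior_maximal openCube_subset_cube isOpen_openCube fun j => ?_
  norm_num

lemma mem_openCube_or_cubeBoundary {x : Space d} (hx : x ∈ cube d) :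
    x ∈ openCube d ∨ x ∈ cubeBoundary d := by
  by_cases h : x ∈ openCube d
  · exact Or.inl h
  · exact Or.inr ⟨hx, h⟩

lemma normals_nonempty_iff {x : Space d} (hx : x ∈ cube d) :
    (normals x).Nonempty ↔ x ∈ cubeBoundary d := by
  constructor
  · rintro ⟨n, hn, h⟩
    refine ⟨hx, fun ho => ?_⟩
    have : n = 0 := by
      ext j; exact (h j).1 (ho j).1 (ho j).2
    rw [this, norm_zero] at hn
    exact zero_ne_one hn
  · rintro ⟨-, ho⟩
    have : ∃ j, x j = 0 ∨ x j = 1 := by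
      by_contra hcon
      push Not at hcon
      exact ho fun j => ⟨lt_of_le_of_ne (hx j).1 (Ne.symm (hcon j).1),
        lt_of_le_of_ne (hx j).2 (hcon j).2⟩
    obtain ⟨j, hj⟩ := this
    refine ⟨stepVec (j, decide (x j = 1)), norm_stepVec _, fun i => ?_⟩
    unfold stepVec
    by_cases hij : i = j
    · subst hij
      rcases hj with hj | hj <;> simp [hj]
    · simp [hij]

/-- Coordinatewise description, free of unit vectors and uniform over interior and boundary: at a
coordinate in `(0, 1)` both sign conditions apply and force `v j = 0`. -/
lemma mem_normalCone_iff {x : Space d} (hx : x ∈ cube d) (v : Space d) :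
    v ∈ normalCone x ↔ ∀ j, (x j < 1 → v j ≤ 0) ∧ (0 < x j → 0 ≤ v j) := by
  constructor
  · rintro (rfl | ⟨β, hβ, n, hn, rfl⟩) j
    · simp
    · have h := hn.2 j
      simp only [PiLp.smul_apply, smul_eq_mul]
      constructor
      · intro h1
        rcases (hx j).1.eq_or_lt with h0 | h0
        · exact mul_nonpos_of_nonneg_of_nonpos hβ (h.2.1 h0.symm)
        · rw [h.1 h0 h1, mul_zero]
      · intro h0
        rcases (hx j).2.eq_or_lt with h1 | h1
        · exact mul_nonneg hβ (h.2.2 h1)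
        · rw [h.1 h0 h1, mul_zero]
  · intro h
    by_cases hv : v = 0
    · exact Or.inl hv
    · have hv' : 0 < ‖v‖ := norm_pos_iff.2 hv
      refine Or.inr ⟨‖v‖, norm_nonneg v, ‖v‖⁻¹ • v, ⟨?_, fun j => ?_⟩, ?_⟩
      · rw [norm_smul, norm_inv, norm_norm, inv_mul_cancel₀ hv'.ne']
      · simp only [PiLp.smul_apply, smul_eq_mul]
        refine ⟨fun h0 h1 => ?_, fun h0 => ?_, fun h1 => ?_⟩
        · rw [le_antisymm ((h j).1 h1) ((h j).2 h0), mul_zero]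
        · exact mul_nonpos_of_nonneg_of_nonpos (inv_nonneg.2 hv'.le)
            ((h j).1 (by rw [h0]; exact one_pos))
        · exact mul_nonneg (inv_nonneg.2 hv'.le) ((h j).2 (by rw [h1]; exact one_pos))
      · rw [smul_smul, mul_inv_cancel₀ hv'.ne', one_smul]

lemma gradPlus_apply (W : Space d → ℝ) (x : Space d) (j : Fin d) :
    gradPlus W x j = if x j = 0 then min (grad W x j) 0
      else if x j = 1 then max (grad W x j) 0 else grad W x j := rfl

lemma gradPlus_eq_grad (W : Space d → ℝ) {x : Space d} (hx : x ∈ openCube d) :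
    gradPlus W x = grad W x := by
  ext j
  rw [gradPlus_apply, if_neg (hx j).1.ne', if_neg (hx j).2.ne]

/-- `∇₊W` and `∇W` differ only in the coordinates that sit on a face, and tangential vectors vanish
there. This exchanges the two gradients along paths. -/
lemma inner_gradPlus_of_tangent (W : Space d → ℝ) {x v : Space d}
    (h : ∀ j, x j = 0 ∨ x j = 1 → v j = 0) :
    inner ℝ (gradPlus W x) v = inner ℝ (grad W x) v := by
  rw [inner_eq_sum, inner_eq_sum]
  refine Finset.sum_congr rfl fun j _ => ?_
  rw [gradPlus_apply]
  split_ifs with h0 h1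
  · rw [h j (Or.inl h0), mul_zero, mul_zero]
  · rw [h j (Or.inr h1), mul_zero, mul_zero]
  · rfl

/-- The truncation in `∇₊W` keeps exactly the outward part of the normal components. Consequently a
push can be dropped in lower bounds for the action. -/
lemma inner_gradPlus_normalCone_nonneg (W : Space d → ℝ) {x v : Space d} (hx : x ∈ cube d)
    (hv : v ∈ normalCone x) : 0 ≤ inner ℝ (gradPlus W x) v := by
  rw [mem_normalCone_iff hx] at hv
  rw [inner_eq_sum]
  refine Finset.sum_nonneg fun j _ => ?_
  rw [gradPlus_apply]
  split_ifs with h0 h1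
  · exact mul_nonneg_of_nonpos_of_nonpos (min_le_right _ _)
      ((hv j).1 (by rw [h0]; exact one_pos))
  · exact mul_nonneg (le_max_right _ _) ((hv j).2 (by rw [h1]; exact one_pos))
  · have h0' : 0 < x j := lt_of_le_of_ne (hx j).1 (Ne.symm h0)
    have h1' : x j < 1 := lt_of_le_of_ne (hx j).2 h1
    rw [le_antisymm ((hv j).1 h1') ((hv j).2 h0'), mul_zero]

/-- Faces `x j = 0` contribute nothing and on faces `x j = 1` the cone points to positive
coordinates. Hence subtracting a push from a velocity can only lower the growth rate of `‖x‖²`. -/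
lemma inner_self_normalCone_nonneg {x v : Space d} (hx : x ∈ cube d) (hv : v ∈ normalCone x) :
    0 ≤ inner ℝ x v := by
  rw [mem_normalCone_iff hx] at hv
  rw [inner_eq_sum]
  refine Finset.sum_nonneg fun j _ => ?_
  rcases (hx j).1.eq_or_lt with h | h
  · rw [← h, zero_mul]
  · exact mul_nonneg h.le ((hv j).2 h)

end Cube

/-! ### Gradients of functions that are continuously differentiable away from the origin -/

section Grad

variable {d : ℕ} {F : Space d → ℝ}

lemma contDiffWithinAt_cube (hF : ContDiffOn ℝ 1 F (cube d \ {0})) {x : Space d}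
    (hx : x ∈ cube d) (hx0 : x ≠ 0) : ContDiffWithinAt ℝ 1 F (cube d) x := by
  refine (hF x ⟨hx, hx0⟩).mono_of_mem_nhdsWithin ?_
  exact inter_mem self_mem_nhdsWithin (mem_nhdsWithin_of_mem_nhds (isOpen_ne.mem_nhds hx0))

lemma hasFDerivWithinAt_cube (hF : ContDiffOn ℝ 1 F (cube d \ {0})) {x : Space d}
    (hx : x ∈ cube d) (hx0 : x ≠ 0) :
    HasFDerivWithinAt F (fderivWithin ℝ F (cube d) x) (cube d) x :=
  ((contDiffWithinAt_cube hF hx hx0).differentiableWithinAt one_ne_zero).hasFDerivWithinAt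

lemma continuousOn_grad (hF : ContDiffOn ℝ 1 F (cube d \ {0})) :
    ContinuousOn (grad F) (cube d \ {0}) := by
  have h1 : ContinuousOn (fderivWithin ℝ F (cube d \ {0})) (cube d \ {0}) :=
    hF.continuousOn_fderivWithin (uniqueDiffOn_cube.inter isOpen_ne) le_rfl
  have h2 : ContinuousOn (fderivWithin ℝ F (cube d)) (cube d \ {0}) := by
    refine h1.congr fun x hx => ?_
    exact (fderivWithin_inter (s := cube d) (t := {0}ᶜ) (isOpen_ne.mem_nhds hx.2)).symm
  exact (LinearIsometryEquiv.continuous _).comp_continuousOn h2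

/-- The one-sided derivative of `F` on the cube suffices, since the path stays in the cube on both
sides of time `t`. -/
lemma hasDerivAt_comp_path (hF : ContDiffOn ℝ 1 F (cube d \ {0})) {φ : ℝ → Space d} {t : ℝ}
    {v : Space d} (hφ : HasDerivAt φ v t) (hc : ∀ᶠ s in 𝓝 t, φ s ∈ cube d) (h0 : φ t ≠ 0) :
    HasDerivAt (fun s => F (φ s)) (inner ℝ (grad F (φ t)) v) t := by
  have h1 := hasFDerivWithinAt_cube hF hc.self_of_nhds h0
  have h2 := HasFDerivWithinAt.comp_hasDerivWithinAt (f := φ) (s := {s | φ s ∈ cube d}) t h1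
    hφ.hasDerivWithinAt (fun s hs => hs)
  rw [grad, inner_gradientWithin_left]
  exact h2.hasDerivAt hc

end Grad

/-! ### Absolutely continuous paths -/

section AC

variable {d : ℕ}

lemma AbsolutelyContinuousOnInterval.lipschitz_comp {X Y : Type*} [PseudoMetricSpace X]
    [PseudoMetricSpace Y] {f : ℝ → X} {a b : ℝ} (hf : AbsolutelyContinuousOnInterval f a b)
    {g : X → Y} {K : NNReal} (hg : LipschitzOnWith K g (f '' uIcc a b)) :
    AbsolutelyContinuousOnInterval (fun t => g (f t)) a b := by
  rw [absolutelyContinuousOnInterval_iff] at hf ⊢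
  intro ε hε
  obtain ⟨δ, hδ, h⟩ := hf (ε / (K + 1)) (by positivity)
  refine ⟨δ, hδ, fun I hI hlt => ?_⟩
  have h1 := h I hI hlt
  rw [lt_div_iff₀ (by positivity)] at h1
  refine lt_of_le_of_lt ?_ h1
  rw [Finset.sum_mul]
  refine Finset.sum_le_sum fun i hi => ?_
  have h2 := hg.dist_le_mul _ (mem_image_of_mem f (hI.1 i hi).1) _
    (mem_image_of_mem f (hI.1 i hi).2)
  have h3 : 0 ≤ dist (f (I.2 i).1) (f (I.2 i).2) := dist_nonneg
  nlinarith

lemma lipschitzWith_coord (j : Fin d) : LipschitzWith 1 fun x : Space d => x j := by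
  refine LipschitzWith.of_dist_le_mul fun x y => ?_
  rw [NNReal.coe_one, one_mul, dist_eq_norm, dist_eq_norm]
  exact abs_coord_le_norm (x - y) j

lemma ac_coord {φ : ℝ → Space d} {a b : ℝ} (h : AbsolutelyContinuousOnInterval φ a b)
    (j : Fin d) : AbsolutelyContinuousOnInterval (fun t => φ t j) a b :=
  AbsolutelyContinuousOnInterval.lipschitz_comp h (lipschitzWith_coord j).lipschitzOnWith

lemma norm_le_sum_abs (x : Space d) : ‖x‖ ≤ ∑ j, |x j| := by
  have h : x = ∑ j, x j • EuclideanSpace.single j (1 : ℝ) := by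
    ext i
    simp [Finset.sum_apply, Pi.single_apply]
  calc ‖x‖ = ‖∑ j, x j • EuclideanSpace.single j (1 : ℝ)‖ := by rw [← h]
    _ ≤ ∑ j, ‖x j • EuclideanSpace.single j (1 : ℝ)‖ := norm_sum_le _ _
    _ = ∑ j, |x j| := by simp [norm_smul]

lemma ac_of_coord {φ : ℝ → Space d} {a b : ℝ}
    (h : ∀ j, AbsolutelyContinuousOnInterval (fun t => φ t j) a b) :
    AbsolutelyContinuousOnInterval φ a b := by
  have h1 := tendsto_finsetSum Finset.univ fun j (_ : j ∈ Finset.univ) => h j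
  rw [Finset.sum_const_zero] at h1
  refine squeeze_zero (fun _ => Finset.sum_nonneg fun _ _ => dist_nonneg) (fun I => ?_) h1
  rw [Finset.sum_comm]
  refine Finset.sum_le_sum fun i _ => ?_
  rw [dist_eq_norm]
  exact norm_le_sum_abs _

/-- `F` is locally Lipschitz on the cube away from the origin, hence Lipschitz on the compact image
of the path. -/
lemma ac_comp_path {F : Space d → ℝ} (hF : ContDiffOn ℝ 1 F (cube d \ {0})) {φ : ℝ → Space d}
    {a b : ℝ} (hab : a ≤ b) (hφ : AbsolutelyContinuousOnInterval φ a b)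
    (hc : ∀ t ∈ Icc a b, φ t ∈ cube d ∧ φ t ≠ 0) :
    AbsolutelyContinuousOnInterval (fun t => F (φ t)) a b := by
  have hcomp : IsCompact (φ '' uIcc a b) := isCompact_uIcc.image_of_continuousOn hφ.continuousOn
  have hsub : φ '' uIcc a b ⊆ cube d := by
    rintro _ ⟨t, ht, rfl⟩
    rw [uIcc_of_le hab] at ht
    exact (hc t ht).1
  have hloc : LocallyLipschitzOn (φ '' uIcc a b) F := by
    rintro _ ⟨t, ht, rfl⟩
    rw [uIcc_of_le hab] at ht
    obtain ⟨K, u, hu, hK⟩ := (contDiffWithinAt_cube hF (hc t ht).1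
      (hc t ht).2).exists_lipschitzOnWith convex_cube
    exact ⟨K, u, nhdsWithin_mono _ hsub hu, hK⟩
  obtain ⟨K, hK⟩ := hloc.exists_lipschitzOnWith_of_compact hcomp
  exact AbsolutelyContinuousOnInterval.lipschitz_comp hφ hK

lemma ae_differentiableAt_of_ac {φ : ℝ → Space d} {a b : ℝ}
    (hφ : AbsolutelyContinuousOnInterval φ a b) :
    ∀ᵐ t, t ∈ uIcc a b → DifferentiableAt ℝ φ t :=
  hφ.boundedVariationOn.ae_differentiableAt_of_mem_uIcc

lemma hasDerivAt_coord {φ : ℝ → Space d} {v : Space d} {t : ℝ} (h : HasDerivAt φ v t)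
    (j : Fin d) : HasDerivAt (fun s => φ s j) (v j) t :=
  ((EuclideanSpace.proj j : Space d →L[ℝ] ℝ).hasFDerivAt.comp_hasDerivAt t h)

/-- A path in the hypercube has zero normal velocity when it touches a face. -/
lemma deriv_coord_eq_zero {φ : ℝ → Space d} {v : Space d} {t : ℝ} (h : HasDerivAt φ v t)
    (hc : ∀ᶠ s in 𝓝 t, φ s ∈ cube d) {j : Fin d} (hj : φ t j = 0 ∨ φ t j = 1) : v j = 0 := by
  rcases hj with hj | hj
  · refine IsLocalMin.hasDerivAt_eq_zero ?_ (hasDerivAt_coord h j)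
    filter_upwards [hc] with s hs
    rw [hj]; exact (hs j).1
  · refine IsLocalMax.hasDerivAt_eq_zero ?_ (hasDerivAt_coord h j)
    filter_upwards [hc] with s hs
    rw [hj]; exact (hs j).2

lemma eventually_mem_of_mem_Ioo {φ : ℝ → Space d} {a b t : ℝ} {S : Set (Space d)}
    (hc : ∀ t ∈ Icc a b, φ t ∈ S) (ht : t ∈ Ioo a b) : ∀ᶠ s in 𝓝 t, φ s ∈ S := by
  filter_upwards [isOpen_Ioo.mem_nhds ht] with s hs
  exact hc s (Ioo_subset_Icc_self hs)

end AC

/-! ### The Skorokhod problem with absolutely continuous driver -/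

section Skorokhod

variable {d : ℕ} {T : ℝ} {w x k : ℝ → Space d}

/-- Reduction to one coordinate: the push in direction `j` has a density that can be positive only
on the face `x j = 1` and negative only on the face `x j = 0`. -/
lemma IsSkorokhodSolution.push_sub (h : IsSkorokhodSolution T w x k) (j : Fin d) :
    ∃ (ν : Measure ℝ) (n : ℝ → ℝ), (∀ᵐ s ∂(ν.restrict (Ioc 0 T)),
        (x s j < 1 → n s ≤ 0) ∧ (0 < x s j → 0 ≤ n s)) ∧
      ∀ s t, 0 ≤ s → s ≤ t → t ≤ T → k t j - k s j = ∫ u in Ioc s t, n u ∂ν := by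
  obtain ⟨ν, n, hν, hn, hae, hk⟩ := h.push
  have hint : IntegrableOn n (Ioc 0 T) ν := by
    refine Measure.integrableOn_of_bounded (M := 1) (measure_ne_top ν _)
      hn.aestronglyMeasurable ?_
    filter_upwards [hae] with s hs
    exact hs.2.1.le
  have hnj : IntegrableOn (fun s => n s j) (Ioc 0 T) ν :=
    (EuclideanSpace.proj j : Space d →L[ℝ] ℝ).integrable_comp hint
  refine ⟨ν, fun s => n s j, ?_, fun s t hs hst htT => ?_⟩
  · filter_upwards [hae] with s hs
    have hc := hs.1.1
    have h1 := (mem_normalCone_iff hc (n s)).1 (Or.inr ⟨1, zero_le_one, n s, hs.2, by simp⟩)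
    exact h1 j
  · have hkj : ∀ t ∈ Icc 0 T, k t j = ∫ u in Ioc 0 t, n u j ∂ν := by
      intro t ht
      rw [hk t ht]
      exact ((EuclideanSpace.proj j : Space d →L[ℝ] ℝ).integral_comp_comm
        (hint.mono_set (Ioc_subset_Ioc_right ht.2))).symm
    rw [hkj t ⟨hs.trans hst, htT⟩, hkj s ⟨hs, hst.trans htT⟩, ← Ioc_union_Ioc_eq_Ioc hs hst,
      setIntegral_union (Ioc_disjoint_Ioc_of_le le_rfl) measurableSet_Ioc
        (hnj.mono_set (Ioc_subset_Ioc_right (hst.trans htT)))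
        (hnj.mono_set (Ioc_subset_Ioc hs htT)), add_sub_cancel_left]

lemma IsSkorokhodSolution.push_antitone (h : IsSkorokhodSolution T w x k) {j : Fin d} {s t : ℝ}
    (hs : 0 ≤ s) (hst : s ≤ t) (htT : t ≤ T) (hx : ∀ u ∈ Ioc s t, x u j < 1) :
    k t j ≤ k s j := by
  obtain ⟨ν, n, hae, hk⟩ := h.push_sub j
  have : ∫ u in Ioc s t, n u ∂ν ≤ 0 := by
    refine setIntegral_nonpos_of_ae_restrict ?_
    filter_upwards [ae_restrict_of_ae_restrict_of_subset (Ioc_subset_Ioc hs htT) hae,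
      ae_restrict_mem measurableSet_Ioc] with u hu hu'
    exact hu.1 (hx u hu')
  rw [← hk s t hs hst htT] at this
  linarith

lemma IsSkorokhodSolution.push_monotone (h : IsSkorokhodSolution T w x k) {j : Fin d} {s t : ℝ}
    (hs : 0 ≤ s) (hst : s ≤ t) (htT : t ≤ T) (hx : ∀ u ∈ Ioc s t, 0 < x u j) :
    k s j ≤ k t j := by
  obtain ⟨ν, n, hae, hk⟩ := h.push_sub j
  have : 0 ≤ ∫ u in Ioc s t, n u ∂ν := by
    refine setIntegral_nonneg_of_ae_restrict ?_
    filter_upwards [ae_restrict_of_ae_restrict_of_subset (Ioc_subset_Ioc hs htT) hae,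
      ae_restrict_mem measurableSet_Ioc] with u hu hu'
    exact hu.2 (hx u hu')
  rw [← hk s t hs hst htT] at this
  linarith

/-- If `k j` has grown, the upper face was visited. Let `u` be the last time with `x u j = 1`: after
`u` the push no longer grows, and up to `u` the coordinate of `x` did not decrease, so the growth of
`k j` is at most that of `w j` on `[s, u]`. The lower face is symmetric. -/
lemma IsSkorokhodSolution.abs_push_sub_le (h : IsSkorokhodSolution T w x k) (j : Fin d)
    {s t : ℝ} (hs : 0 ≤ s) (hst : s ≤ t) (htT : t ≤ T) :
    ∃ u ∈ Icc s t, |k t j - k s j| ≤ |w u j - w s j| := by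
  have hsub : Icc s t ⊆ Icc 0 T := Icc_subset_Icc hs htT
  have hxj : ContinuousOn (fun u => x u j) (Icc s t) :=
    (continuous_coord j).comp_continuousOn (h.continuousOn_path.mono hsub)
  have hw : ∀ u ∈ Icc s t, w u j - w s j = (x u j - x s j) + (k u j - k s j) := by
    intro u hu
    rw [h.eq_add u (hsub hu), h.eq_add s (hsub ⟨le_rfl, hst⟩)]
    simp only [PiLp.add_apply]; ring
  have last : ∀ c : ℝ, (∃ u ∈ Icc s t, x u j = c) →
      ∃ u ∈ Icc s t, x u j = c ∧ ∀ v ∈ Ioc u t, x v j ≠ c := by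
    rintro c ⟨u₀, hu₀, hc₀⟩
    have hcomp : IsCompact (Icc s t ∩ (fun u => x u j) ⁻¹' {c}) :=
      isCompact_Icc.of_isClosed_subset (hxj.preimage_isClosed_of_isClosed isClosed_Icc
        isClosed_singleton) inter_subset_left
    obtain ⟨u, hu, hmax⟩ := hcomp.exists_isGreatest ⟨u₀, hu₀, hc₀⟩
    exact ⟨u, hu.1, hu.2, fun v hv hvc =>
      absurd (hmax ⟨⟨hu.1.1.trans hv.1.le, hv.2⟩, hvc⟩) (not_le.2 hv.1)⟩
  have hx01 : ∀ u ∈ Icc s t, 0 ≤ x u j ∧ x u j ≤ 1 := fun u hu => h.mem_cube u (hsub hu) j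
  rcases le_total (k s j) (k t j) with hk | hk
  · by_cases hex : ∃ u ∈ Icc s t, x u j = 1
    · obtain ⟨u, hu, hu1, hlast⟩ := last 1 hex
      refine ⟨u, hu, ?_⟩
      have h1 : k t j ≤ k u j := h.push_antitone (hs.trans hu.1) hu.2 htT fun v hv =>
        lt_of_le_of_ne (hx01 v ⟨hu.1.trans hv.1.le, hv.2⟩).2 (hlast v hv)
      rw [abs_of_nonneg (sub_nonneg.2 hk), hw u hu, hu1]
      refine le_trans ?_ (le_abs_self _)
      have := (hx01 s ⟨le_rfl, hst⟩).2
      linarith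
    · push Not at hex
      have h1 : k t j ≤ k s j := h.push_antitone hs hst htT fun v hv =>
        lt_of_le_of_ne (hx01 v ⟨hv.1.le, hv.2⟩).2 (hex v ⟨hv.1.le, hv.2⟩)
      exact ⟨s, ⟨le_rfl, hst⟩, by rw [le_antisymm h1 hk]; simp⟩
  · by_cases hex : ∃ u ∈ Icc s t, x u j = 0
    · obtain ⟨u, hu, hu1, hlast⟩ := last 0 hex
      refine ⟨u, hu, ?_⟩
      have h1 : k u j ≤ k t j := h.push_monotone (hs.trans hu.1) hu.2 htT fun v hv =>
        lt_of_le_of_ne (hx01 v ⟨hu.1.trans hv.1.le, hv.2⟩).1 (Ne.symm (hlast v hv))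
      rw [abs_of_nonpos (sub_nonpos.2 hk), hw u hu, hu1]
      refine le_trans ?_ (neg_le_abs _)
      have := (hx01 s ⟨le_rfl, hst⟩).1
      linarith
    · push Not at hex
      have h1 : k s j ≤ k t j := h.push_monotone hs hst htT fun v hv =>
        lt_of_le_of_ne (hx01 v ⟨hv.1.le, hv.2⟩).1 (Ne.symm (hex v ⟨hv.1.le, hv.2⟩))
      exact ⟨s, ⟨le_rfl, hst⟩, by rw [le_antisymm h1 hk]; simp⟩

/-- The pushing process is absolutely continuous if the driving path is. -/
lemma IsSkorokhodSolution.push_ac (h : IsSkorokhodSolution T w x k) (hT : 0 ≤ T)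
    (hw : AbsolutelyContinuousOnInterval w 0 T) : AbsolutelyContinuousOnInterval k 0 T := by
  refine ac_of_coord fun j => ?_
  have hwj := ac_coord hw j
  rw [absolutelyContinuousOnInterval_iff] at hwj ⊢
  intro ε hε
  obtain ⟨δ, hδ, hδ'⟩ := hwj ε hε
  refine ⟨δ, hδ, fun I hI hlt => ?_⟩
  -- Each interval is shortened to the one between its left end and the time `u` of
  -- `abs_push_sub_le`. The short intervals are still disjoint, with smaller total length, so the
  -- absolute continuity of `w` applies to them.
  have hu : ∀ i, ∃ u, i ∈ Finset.range I.1 → u ∈ uIcc (I.2 i).1 (I.2 i).2 ∧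
      dist (k (I.2 i).1 j) (k (I.2 i).2 j) ≤
        dist (w (min (I.2 i).1 (I.2 i).2) j) (w u j) := by
    intro i
    by_cases hi : i ∈ Finset.range I.1
    · have h1 := (hI.1 i hi).1
      have h2 := (hI.1 i hi).2
      rw [uIcc_of_le hT] at h1 h2
      obtain ⟨u, hu, hle⟩ := h.abs_push_sub_le j (s := min (I.2 i).1 (I.2 i).2)
        (t := max (I.2 i).1 (I.2 i).2) (le_min h1.1 h2.1) min_le_max (max_le h1.2 h2.2)
      refine ⟨u, fun _ => ⟨hu, ?_⟩⟩
      rw [dist_comm (w _ j), Real.dist_eq (w u j)]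
      refine le_trans (le_of_eq ?_) hle
      rcases le_total (I.2 i).1 (I.2 i).2 with h3 | h3
      · rw [max_eq_right h3, min_eq_left h3, dist_comm, Real.dist_eq]
      · rw [max_eq_left h3, min_eq_right h3, Real.dist_eq]
    · exact ⟨0, fun hi' => absurd hi' hi⟩
  choose u hu using hu
  set I' : ℕ × (ℕ → ℝ × ℝ) := (I.1, fun i => (min (I.2 i).1 (I.2 i).2, u i)) with hI'
  have hI'mem : I' ∈ AbsolutelyContinuousOnInterval.disjWithin 0 T := by
    refine ⟨fun i hi => ⟨?_, ?_⟩, fun i hi l hl hil => ?_⟩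
    · have h1 := (hI.1 i hi).1
      have h2 := (hI.1 i hi).2
      simp only [hI']
      rcases le_total (I.2 i).1 (I.2 i).2 with h3 | h3
      · rwa [min_eq_left h3]
      · rwa [min_eq_right h3]
    · exact uIcc_subset_uIcc (hI.1 i hi).1 (hI.1 i hi).2 (hu i hi).1
    · have hsub : ∀ i ∈ Finset.range I.1,
          uIoc (I'.2 i).1 (I'.2 i).2 ⊆ uIoc (I.2 i).1 (I.2 i).2 := by
        intro i hi
        have h1 := (hu i hi).1
        simp only [hI']
        rw [uIoc_of_le h1.1]
        exact Ioc_subset_Ioc_right h1.2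
      exact (hI.2 hi hl hil).mono (hsub i hi) (hsub l hl)
  have hlt' : ∑ i ∈ Finset.range I'.1, dist (I'.2 i).1 (I'.2 i).2 < δ := by
    refine lt_of_le_of_lt (Finset.sum_le_sum fun i hi => ?_) hlt
    have h1 := (hu i hi).1
    simp only [hI']
    rw [Real.dist_eq, Real.dist_eq, abs_sub_comm, abs_of_nonneg (sub_nonneg.2 h1.1),
      abs_sub_comm, ← max_sub_min_eq_abs]
    exact sub_le_sub_right h1.2 _
  exact lt_of_le_of_lt (Finset.sum_le_sum fun i hi => (hu i hi).2) (hδ' I' hI'mem hlt')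

lemma deriv_nonneg_of_right {f : ℝ → ℝ} {v t : ℝ} (h : HasDerivAt f v t)
    (hf : ∀ᶠ s in 𝓝[>] t, f t ≤ f s) : 0 ≤ v := by
  have h1 := (hasDerivAt_iff_tendsto_slope.1 h).mono_left
    (nhdsWithin_mono t (fun s (hs : s ∈ Ioi t) => (ne_of_gt hs : s ≠ t)))
  refine ge_of_tendsto h1 ?_
  filter_upwards [hf, self_mem_nhdsWithin] with s hs hst
  rw [slope_def_field]
  exact div_nonneg (sub_nonneg.2 hs) (sub_nonneg.2 (le_of_lt hst))

/-- By continuity a coordinate off a face remains off it for a short time to the right, during which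
the push in that direction is monotone; this gives the sign of its derivative. -/
lemma IsSkorokhodSolution.deriv_push_mem (h : IsSkorokhodSolution T w x k) {t : ℝ}
    (ht : t ∈ Ioo 0 T) {v : Space d} (hk : HasDerivAt k v t) : v ∈ normalCone (x t) := by
  rw [mem_normalCone_iff (h.mem_cube t (Ioo_subset_Icc_self ht))]
  intro j
  have hxc : ContinuousAt (fun u => x u j) t :=
    (continuous_coord j).continuousAt.comp
      (h.continuousOn_path.continuousAt (Icc_mem_nhds ht.1 ht.2))
  have hright : ∀ {S : Set ℝ}, IsOpen S → x t j ∈ S →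
      ∀ᶠ s in 𝓝[>] t, (∀ u ∈ Ioc t s, x u j ∈ S) ∧ s ∈ Ioo t T := by
    intro S hS hxS
    obtain ⟨r, hr, hball⟩ := Metric.mem_nhds_iff.1 (hxc (hS.mem_nhds hxS))
    have h1 : Ioo t (min (t + r) T) ∈ 𝓝[>] t :=
      Ioo_mem_nhdsGT (lt_min (by linarith) ht.2)
    filter_upwards [h1] with s hs
    refine ⟨fun u hu => hball ?_, hs.1, hs.2.trans_le (min_le_right _ _)⟩
    rw [Metric.mem_ball, Real.dist_eq, abs_of_nonneg (by linarith [hu.1])]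
    have := hs.2.trans_le (min_le_left _ _)
    linarith [hu.2]
  constructor
  · intro h1
    have h2 := deriv_nonneg_of_right (hasDerivAt_coord hk j).neg (by
      filter_upwards [hright isOpen_Iio h1] with s hs
      exact neg_le_neg (h.push_antitone ht.1.le hs.2.1.le hs.2.2.le hs.1))
    linarith
  · intro h0
    refine deriv_nonneg_of_right (hasDerivAt_coord hk j) ?_
    filter_upwards [hright isOpen_Ioi h0] with s hs
    exact h.push_monotone ht.1.le hs.2.1.le hs.2.2.le hs.1

end Skorokhod

/-! ### Lower bounds for the actions -/

section Lagrangian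

variable {d : ℕ} {H : Space d → Space d → ℝ} {b : Space d → Space d} {W : Space d → ℝ}

lemma le_lagrangian (H : Space d → Space d → ℝ) (x α v : Space d) :
    ((inner ℝ α v - H x α : ℝ) : EReal) ≤ lagrangian H x v :=
  le_iSup (fun α : Space d => ((inner ℝ α v - H x α : ℝ) : EReal)) α

/-- Equality case of Fenchel's inequality: the subgradient inequality says that `α` attains the
supremum. -/
lemma lagrangian_grad (hH : IsRegularHamiltonian H b) (x α : Space d) :
    lagrangian H x (gradAlpha H x α) =
      ((inner ℝ α (gradAlpha H x α) - H x α : ℝ) : EReal) := by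
  refine le_antisymm (iSup_le fun β => ?_) (le_lagrangian H x α _)
  rw [EReal.coe_le_coe_iff]
  have := hH.subgradient x α β
  rw [inner_sub_right, real_inner_comm, real_inner_comm α] at this
  linarith

lemma lagrangian_nonneg (hH : IsRegularHamiltonian H b) (x v : Space d) :
    0 ≤ lagrangian H x v := by
  have := le_lagrangian H x 0 v
  rwa [inner_zero_left, hH.map_zero, sub_zero, EReal.coe_zero] at this

lemma IsClassicalSolution.eq_zero (hW : IsClassicalSolution H W) {x : Space d} (hx : x ∈ cube d)
    (hx0 : x ≠ 0) : H x (gradPlus W x) = 0 := by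
  rcases mem_openCube_or_cubeBoundary hx with h | h
  · rw [gradPlus_eq_grad W h]; exact hW.interior_eq x h
  · exact hW.boundary_eq x h hx0

lemma IsClassicalSolution.inner_le_lagrangian (hW : IsClassicalSolution H W) {x : Space d}
    (hx : x ∈ cube d) (hx0 : x ≠ 0) (v : Space d) :
    ((inner ℝ (gradPlus W x) v : ℝ) : EReal) ≤ lagrangian H x v := by
  have := le_lagrangian H x (gradPlus W x) v
  rwa [hW.eq_zero hx hx0, sub_zero] at this

/-- The pointwise inequality behind both lower bounds: test the supremum at `∇₊W`, where `H`
vanishes, and discard the nonnegative contribution of the push. -/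
lemma IsClassicalSolution.inner_le_lagrangian_add (hW : IsClassicalSolution H W) {x : Space d}
    (hx : x ∈ cube d) (hx0 : x ≠ 0) (v : Space d) {κ : Space d} (hκ : κ ∈ normalCone x) :
    ((inner ℝ (gradPlus W x) v : ℝ) : EReal) ≤ lagrangian H x (v + κ) := by
  refine le_trans ?_ (hW.inner_le_lagrangian hx hx0 (v + κ))
  rw [EReal.coe_le_coe_iff, inner_add_right]
  linarith [inner_gradPlus_normalCone_nonneg W hx hκ]

lemma IsClassicalSolution.inner_le_reflectedLagrangian (hW : IsClassicalSolution H W)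
    {x : Space d} (hx : x ∈ cube d) (hx0 : x ≠ 0) (v : Space d) :
    ((inner ℝ (gradPlus W x) v : ℝ) : EReal) ≤ reflectedLagrangian H x v := by
  unfold reflectedLagrangian
  split_ifs
  · exact hW.inner_le_lagrangian hx hx0 v
  · exact le_top
  · exact hW.inner_le_lagrangian hx hx0 v
  · refine le_iInf fun β => le_iInf fun hβ => le_iInf fun n => le_iInf fun hn => le_iInf fun _ => ?_
    exact hW.inner_le_lagrangian_add hx hx0 v (Or.inr ⟨β, hβ, n, hn, rfl⟩)

end Lagrangian

/-! ### Integral inequalities for absolutely continuous functions -/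

section FTC

lemma ac_congr {X : Type*} [PseudoMetricSpace X] {f g : ℝ → X} {a b : ℝ}
    (hf : AbsolutelyContinuousOnInterval f a b) (h : EqOn f g (uIcc a b)) :
    AbsolutelyContinuousOnInterval g a b := by
  rw [absolutelyContinuousOnInterval_iff] at hf ⊢
  intro ε hε
  obtain ⟨δ, hδ, h'⟩ := hf ε hε
  refine ⟨δ, hδ, fun I hI hlt => ?_⟩
  refine lt_of_eq_of_lt (Finset.sum_congr rfl fun i hi => ?_) (h' I hI hlt)
  rw [h (hI.1 i hi).1, h (hI.1 i hi).2]

/-- No measurability of `f` is required: `f` will be a Lagrangian along a path, and monotonicity of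
the lower integral is enough. -/
lemma ofReal_sub_le_lintegral {g : ℝ → ℝ} {a b : ℝ} (hab : a ≤ b)
    (hg : AbsolutelyContinuousOnInterval g a b) {f : ℝ → ℝ≥0∞}
    (h : ∀ᵐ t, t ∈ Ioo a b → ENNReal.ofReal (deriv g t) ≤ f t) :
    ENNReal.ofReal (g b - g a) ≤ ∫⁻ t in Icc a b, f t := by
  have hint := hg.intervalIntegrable_deriv
  rw [intervalIntegrable_iff_integrableOn_Ioc_of_le hab] at hint
  rw [← hg.integral_deriv_eq_sub, intervalIntegral.integral_of_le hab,
    integral_eq_lintegral_pos_part_sub_lintegral_neg_part hint]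
  calc ENNReal.ofReal _ ≤ ENNReal.ofReal
        (∫⁻ t in Ioc a b, ENNReal.ofReal (deriv g t)).toReal :=
        ENNReal.ofReal_le_ofReal (sub_le_self _ ENNReal.toReal_nonneg)
    _ ≤ ∫⁻ t in Ioc a b, ENNReal.ofReal (deriv g t) := ENNReal.ofReal_toReal_le
    _ = ∫⁻ t in Ioo a b, ENNReal.ofReal (deriv g t) := by
        rw [restrict_Ioo_eq_restrict_Ioc]
    _ ≤ ∫⁻ t in Ioo a b, f t := lintegral_mono_ae <| by
        rw [ae_restrict_iff' measurableSet_Ioo]; exact h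
    _ ≤ ∫⁻ t in Icc a b, f t := lintegral_mono_set Ioo_subset_Icc_self

lemma lintegral_le_ofReal_sub {g : ℝ → ℝ} {a b : ℝ} (hab : a ≤ b)
    (hg : AbsolutelyContinuousOnInterval g a b) {f : ℝ → ℝ≥0∞}
    (h : ∀ᵐ t, t ∈ Ioo a b → 0 ≤ deriv g t ∧ f t ≤ ENNReal.ofReal (deriv g t)) :
    ∫⁻ t in Icc a b, f t ≤ ENNReal.ofReal (g b - g a) := by
  have hint := hg.intervalIntegrable_deriv
  rw [intervalIntegrable_iff_integrableOn_Ioo_of_le hab] at hint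
  rw [← hg.integral_deriv_eq_sub, intervalIntegral.integral_of_le hab, ← restrict_Ioo_eq_restrict_Ioc,
    ofReal_integral_eq_lintegral_ofReal hint, ← restrict_Ioo_eq_restrict_Icc]
  · refine lintegral_mono_ae ?_
    rw [ae_restrict_iff' measurableSet_Ioo]
    filter_upwards [h] with t ht hmem using (ht hmem).2
  · change ∀ᵐ t ∂_, _
    rw [ae_restrict_iff' measurableSet_Ioo]
    filter_upwards [h] with t ht hmem using (ht hmem).1

lemma sub_le_of_deriv_le {g : ℝ → ℝ} {a b c : ℝ} (hab : a ≤ b)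
    (hg : AbsolutelyContinuousOnInterval g a b) (h : ∀ᵐ t, t ∈ Ioo a b → deriv g t ≤ c) :
    g b - g a ≤ c * (b - a) := by
  rw [← hg.integral_deriv_eq_sub]
  have h1 : ∫ t in a..b, deriv g t ≤ ∫ _ in a..b, c := by
    refine intervalIntegral.integral_mono_ae_restrict hab hg.intervalIntegrable_deriv
      intervalIntegrable_const ?_
    rw [← restrict_Ioo_eq_restrict_Icc]
    change ∀ᵐ t ∂_, _
    rw [ae_restrict_iff' measurableSet_Ioo]
    exact h
  rw [intervalIntegral.integral_const, smul_eq_mul] at h1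
  linarith

end FTC

/-! ### `W` bounds the quasi-potential and the backward action from below -/

section LowerBound

variable {d : ℕ} {H : Space d → Space d → ℝ} {b : Space d → Space d} {W : Space d → ℝ}

/-- Along an absolutely continuous path away from the origin, `W` has the expected derivative,
and the gradient may be replaced by the modified gradient. -/
lemma ae_deriv_comp_path {F : Space d → ℝ} (hF : ContDiffOn ℝ 1 F (cube d \ {0}))
    {φ : ℝ → Space d} {s t : ℝ} (hst : s ≤ t) (hφ : AbsolutelyContinuousOnInterval φ s t)
    (hc : ∀ u ∈ Icc s t, φ u ∈ cube d ∧ φ u ≠ 0) :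
    ∀ᵐ u, u ∈ Ioo s t → DifferentiableAt ℝ φ u ∧
      (∀ j, φ u j = 0 ∨ φ u j = 1 → deriv φ u j = 0) ∧
      deriv (fun u => F (φ u)) u = inner ℝ (grad F (φ u)) (deriv φ u) := by
  filter_upwards [ae_differentiableAt_of_ac hφ] with u hu humem
  rw [uIcc_of_le hst] at hu
  have hd := hu (Ioo_subset_Icc_self humem)
  have hev := eventually_mem_of_mem_Ioo (fun u hu => (hc u hu).1) humem
  exact ⟨hd, fun j hj => deriv_coord_eq_zero hd.hasDerivAt hev hj,
    (hasDerivAt_comp_path hF hd.hasDerivAt hev (hc u (Ioo_subset_Icc_self humem)).2).deriv⟩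

lemma IsClassicalSolution.ofReal_sub_le (hW : IsClassicalSolution H W) {φ : ℝ → Space d}
    {s t : ℝ} (hst : s ≤ t) (hφ : AbsolutelyContinuousOnInterval φ s t)
    (hc : ∀ u ∈ Icc s t, φ u ∈ cube d ∧ φ u ≠ 0) {f : ℝ → ℝ≥0∞}
    (hf : ∀ᵐ u, u ∈ Ioo s t →
      ENNReal.ofReal (inner ℝ (gradPlus W (φ u)) (deriv φ u)) ≤ f u) :
    ENNReal.ofReal (W (φ t) - W (φ s)) ≤ ∫⁻ u in Icc s t, f u := by
  refine ofReal_sub_le_lintegral hst (ac_comp_path hW.contDiffOn hst hφ hc) ?_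
  filter_upwards [hf, ae_deriv_comp_path hW.contDiffOn hst hφ hc] with u h1 h2 hu
  rw [(h2 hu).2.2, ← inner_gradPlus_of_tangent W (h2 hu).2.1]
  exact h1 hu

/-- The cost of reaching a point from the origin is at least `W`. -/
lemma IsClassicalSolution.ofReal_le_of_start_zero (hW : IsClassicalSolution H W) (hW0 : W 0 = 0)
    {φ : ℝ → Space d} {a c : ℝ} (hac : a ≤ c) (hφ : AbsolutelyContinuousOnInterval φ a c)
    (hc : ∀ u ∈ Icc a c, φ u ∈ cube d) (h0 : φ a = 0) {f : ℝ → ℝ≥0∞}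
    (hf : ∀ᵐ u, u ∈ Ioo a c → φ u ≠ 0 →
      ENNReal.ofReal (inner ℝ (gradPlus W (φ u)) (deriv φ u)) ≤ f u) :
    ENNReal.ofReal (W (φ c)) ≤ ∫⁻ u in Icc a c, f u := by
  have hcont : ContinuousOn φ (Icc a c) := by
    have := hφ.continuousOn; rwa [uIcc_of_le hac] at this
  have hcomp : IsCompact (Icc a c ∩ φ ⁻¹' {0}) :=
    isCompact_Icc.of_isClosed_subset (hcont.preimage_isClosed_of_isClosed isClosed_Icc
      isClosed_singleton) inter_subset_left
  -- `W` need not be differentiable at the origin. The estimate is applied on `[s, c]` with `s`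
  -- after the last zero `τ`, then `s ↓ τ`, using only continuity of `W` at the origin.
  obtain ⟨τ, ⟨hτ, hτ0⟩, hmax⟩ := hcomp.exists_isGreatest ⟨a, ⟨le_rfl, hac⟩, h0⟩
  have hτ0 : φ τ = 0 := hτ0
  rcases hτ.2.eq_or_lt with heq | hlt
  · rw [← heq, hτ0, hW0]; simp
  have hlim : Tendsto (fun s => ENNReal.ofReal (W (φ c) - W (φ s))) (𝓝[>] τ)
      (𝓝 (ENNReal.ofReal (W (φ c)))) := by
    have h1 : Tendsto φ (𝓝[>] τ) (𝓝[cube d] (φ τ)) := by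
      refine tendsto_nhdsWithin_iff.2 ⟨?_, ?_⟩
      · have h2 : Tendsto φ (𝓝[Icc a c] τ) (𝓝 (φ τ)) := hcont τ hτ
        refine h2.mono_left ?_
        rw [← nhdsWithin_Ioo_eq_nhdsGT hlt]
        exact nhdsWithin_mono _ fun u hu => ⟨hτ.1.trans hu.1.le, hu.2.le⟩
      · filter_upwards [Ioo_mem_nhdsGT hlt] with u hu
        exact hc u ⟨hτ.1.trans hu.1.le, hu.2.le⟩
    have h2 : Tendsto (fun s => W (φ s)) (𝓝[>] τ) (𝓝 (W (φ τ))) :=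
      (hW.continuousOn (φ τ) (hc τ hτ)).tendsto.comp h1
    rw [hτ0, hW0] at h2
    have h3 := (tendsto_const_nhds (x := W (φ c))).sub h2
    rw [sub_zero] at h3
    exact ENNReal.tendsto_ofReal h3
  refine le_of_tendsto hlim ?_
  filter_upwards [Ioo_mem_nhdsGT hlt] with s hs
  have hsub : Icc s c ⊆ Icc a c := Icc_subset_Icc (hτ.1.trans hs.1.le) le_rfl
  have hne : ∀ u ∈ Icc s c, φ u ≠ 0 := fun u hu hu0 =>
    absurd (hmax ⟨hsub hu, hu0⟩) (not_le.2 (hs.1.trans_le hu.1))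
  refine (hW.ofReal_sub_le hs.2.le (hφ.mono ?_) (fun u hu => ⟨hc u (hsub hu), hne u hu⟩)
    ?_).trans (lintegral_mono_set hsub)
  · rwa [uIcc_of_le hs.2.le, uIcc_of_le hac]
  · filter_upwards [hf] with u hu hu'
    exact hu ⟨(hτ.1.trans hs.1.le).trans_lt hu'.1, hu'.2⟩ (hne u (Ioo_subset_Icc_self hu'))

/-- The push inherits absolute continuity from the driver, so `ψ' = φ' + k'` with `k'` in the normal
cone almost everywhere, and the pointwise inequality `inner_le_lagrangian_add` integrates. -/
theorem IsClassicalSolution.le_quasiPotential (hW : IsClassicalSolution H W) (hW0 : W 0 = 0)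
    (x : Space d) : ENNReal.ofReal (W x) ≤ quasiPotential H 0 x := by
  refine le_iInf fun T => le_iInf fun hT => le_iInf fun φ => le_iInf fun h0 => le_iInf fun hx =>
    le_iInf fun ψ => le_iInf fun hψ => ?_
  obtain ⟨hψac, k, hk⟩ := hψ
  have hkac := hk.push_ac hT.le hψac
  have hφac : AbsolutelyContinuousOnInterval φ 0 T := by
    refine ac_congr (hψac.sub hkac) fun t ht => ?_
    rw [uIcc_of_le hT.le] at ht
    rw [Pi.sub_apply, hk.eq_add t ht, add_sub_cancel_right]
  rw [← hx]
  refine hW.ofReal_le_of_start_zero hW0 hT.le hφac hk.mem_cube h0 ?_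
  filter_upwards [ae_differentiableAt_of_ac hφac, ae_differentiableAt_of_ac hkac] with t h1 h2 ht hne
  rw [uIcc_of_le hT.le] at h1 h2
  have htI := Ioo_subset_Icc_self ht
  have hderiv : deriv ψ t = deriv φ t + deriv k t := by
    refine HasDerivAt.deriv (((h1 htI).hasDerivAt.add (h2 htI).hasDerivAt).congr_of_eventuallyEq ?_)
    filter_upwards [Icc_mem_nhds ht.1 ht.2] with s hs
    exact hk.eq_add s hs
  have hcone := hk.deriv_push_mem ht (h2 htI).hasDerivAt
  rw [hderiv, ← EReal.real_coe_toENNReal]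
  exact EReal.toENNReal_le_toENNReal
    (hW.inner_le_lagrangian_add (hk.mem_cube t htI) hne _ hcone)

/-- Either the path visits the origin at a finite time and the bound starts there, or it never does
and the bound on `[s, 0]` passes to the limit `s → -∞`, as `W(ψ_s) → 0`. -/
theorem IsClassicalSolution.le_backwardAction (hW : IsClassicalSolution H W) (hW0 : W 0 = 0)
    {x : Space d} {ψ : ℝ → Space d} (hψ : ψ ∈ backwardPaths x) :
    ENNReal.ofReal (W x) ≤ backwardAction H ψ := by
  obtain ⟨hcont, hcube, hlim, hx⟩ := hψ
  unfold backwardAction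
  split_ifs with hac
  · have hf : ∀ u ≤ (0 : ℝ), ψ u ≠ 0 →
        ENNReal.ofReal (inner ℝ (gradPlus W (ψ u)) (deriv ψ u)) ≤
        (reflectedLagrangian H (ψ u) (deriv ψ u)).toENNReal := by
      intro u hu hne
      rw [← EReal.real_coe_toENNReal]
      exact EReal.toENNReal_le_toENNReal
        (hW.inner_le_reflectedLagrangian (hcube u hu) hne _)
    by_cases hzero : ∃ a ≤ 0, ψ a = 0
    · obtain ⟨a, ha, ha0⟩ := hzero
      rw [← hx]
      refine (hW.ofReal_le_of_start_zero hW0 ha (hac a ha) (fun u hu => hcube u hu.2) ha0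
        (Eventually.of_forall fun u hu hne => hf u hu.2.le hne)).trans
        (lintegral_mono_set Icc_subset_Iic_self)
    · push Not at hzero
      have h1 : Tendsto (fun s => W (ψ s)) atBot (𝓝 (W 0)) := by
        refine (hW.continuousOn 0 zero_mem_cube).tendsto.comp (tendsto_nhdsWithin_iff.2 ⟨hlim, ?_⟩)
        filter_upwards [eventually_le_atBot 0] with s hs using hcube s hs
      have h2 := ENNReal.tendsto_ofReal ((tendsto_const_nhds (x := W x)).sub h1)
      rw [hW0, sub_zero] at h2
      refine le_of_tendsto h2 ?_
      filter_upwards [eventually_le_atBot 0] with s hs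
      rw [← hx]
      exact (hW.ofReal_sub_le hs (hac s hs) (fun u hu => ⟨hcube u hu.2, hzero u hu.2⟩)
        (Eventually.of_forall fun u hu => hf u hu.2.le (hzero u hu.2.le))).trans
        (lintegral_mono_set Icc_subset_Iic_self)
  · exact le_top

end LowerBound

/-! ### Backward reflected paths -/

section Backward

variable {d : ℕ} {H : Space d → Space d → ℝ} {b : Space d → Space d} {W : Space d → ℝ}

/-- The velocity `∇_α H(x, ∇₊W(x))` of the optimal paths. -/
def optDrift (H : Space d → Space d → ℝ) (W : Space d → ℝ) (x : Space d) : Space d :=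
  gradAlpha H x (gradPlus W x)

lemma inner_eq_zero_of_tangent {y v n : Space d} (hy : y ∈ cube d)
    (hv : ∀ j, y j = 0 ∨ y j = 1 → v j = 0) (hn : n ∈ normals y) : inner ℝ v n = 0 := by
  rw [inner_eq_sum]
  refine Finset.sum_eq_zero fun j _ => ?_
  by_cases h : y j = 0 ∨ y j = 1
  · rw [hv j h, zero_mul]
  · push Not at h
    rw [(hn.2 j).1 (lt_of_le_of_ne (hy j).1 (Ne.symm h.1)) (lt_of_le_of_ne (hy j).2 h.2), mul_zero]

/-- At a tangential velocity the reflected Lagrangian is optimal over all pushes. -/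
lemma reflectedLagrangian_le {y v κ : Space d} (hy : y ∈ cube d)
    (hv : ∀ j, y j = 0 ∨ y j = 1 → v j = 0) (hκ : κ ∈ normalCone y) :
    reflectedLagrangian H y v ≤ lagrangian H y (v + κ) := by
  have hin : ∀ n ∈ normals y, inner ℝ v n = 0 := fun n hn => inner_eq_zero_of_tangent hy hv hn
  unfold reflectedLagrangian
  split_ifs with h1 h2 h3
  · have : κ = 0 := by
      ext j
      have := (mem_normalCone_iff hy κ).1 hκ j
      exact le_antisymm (this.1 (h1 j).2) (this.2 (h1 j).1)
    rw [this, add_zero]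
  -- A tangential velocity is orthogonal to every normal; as a boundary point has at least one
  -- normal, only the last branch of the definition can occur on the boundary.
  · obtain ⟨n, hn, hpos⟩ := h2
    exact absurd (hin n hn) hpos.ne'
  · obtain ⟨n, hn⟩ := (normals_nonempty_iff hy).2 ⟨hy, h1⟩
    exact absurd (hin n hn) (h3 n hn).ne
  · have key : ∀ (β : ℝ) (n : Space d), 0 ≤ β → n ∈ normals y → κ = β • n →
        (⨅ (β : ℝ) (_ : 0 ≤ β) (n : Space d) (_ : n ∈ normals y) (_ : inner ℝ n v = 0),
          lagrangian H y (v + β • n)) ≤ lagrangian H y (v + κ) := by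
      intro β n hβ hn hκ
      rw [hκ]
      refine (iInf_le _ β).trans ((iInf_le _ hβ).trans ((iInf_le _ n).trans
        ((iInf_le _ hn).trans (iInf_le _ ?_))))
      rw [real_inner_comm]; exact hin n hn
    rcases hκ with rfl | ⟨β, hβ, n, hn, rfl⟩
    · obtain ⟨n, hn⟩ := (normals_nonempty_iff hy).2 ⟨hy, h1⟩
      exact key 0 n le_rfl hn (zero_smul ℝ n).symm
    · exact key β n hβ hn rfl

/-- Equality in the pointwise lower bound: this is the calibration property of the optimal drift. -/
lemma IsClassicalSolution.lagrangian_optDrift (hW : IsClassicalSolution H W)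
    (hH : IsRegularHamiltonian H b) {y : Space d} (hy : y ∈ cube d) (hy0 : y ≠ 0) :
    lagrangian H y (optDrift H W y) =
      ((inner ℝ (gradPlus W y) (optDrift H W y) : ℝ) : EReal) := by
  rw [optDrift, lagrangian_grad hH, hW.eq_zero hy hy0, sub_zero]

lemma IsClassicalSolution.inner_optDrift_nonneg (hW : IsClassicalSolution H W)
    (hH : IsRegularHamiltonian H b) {y : Space d} (hy : y ∈ cube d) (hy0 : y ≠ 0) :
    0 ≤ inner ℝ (gradPlus W y) (optDrift H W y) := by
  have := lagrangian_nonneg hH y (optDrift H W y)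
  rw [hW.lagrangian_optDrift hH hy hy0] at this
  exact_mod_cast this

variable {x : Space d} {φ k : ℝ → Space d} {i : EReal}

lemma IsBackwardReflectedPath.ac (h : IsBackwardReflectedPath H W x φ k i) {s t : ℝ}
    (hst : s ≤ t) (ht : t ≤ 0) : AbsolutelyContinuousOnInterval φ s t := by
  refine (h.path_ac s (hst.trans ht)).mono ?_
  rw [uIcc_of_le hst, uIcc_of_le (hst.trans ht)]
  exact Icc_subset_Icc le_rfl ht

lemma IsBackwardReflectedPath.mem_ne (h : IsBackwardReflectedPath H W x φ k i) {s t : ℝ}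
    (hs : -i < (s : EReal)) (ht : t ≤ 0) : ∀ u ∈ Icc s t, φ u ∈ cube d ∧ φ u ≠ 0 :=
  fun u hu => ⟨h.mem_cube u (hu.2.trans ht), h.ne_zero u (hu.2.trans ht)
    (hs.trans_le (EReal.coe_le_coe_iff.2 hu.1))⟩

lemma IsBackwardReflectedPath.ae_velocity (h : IsBackwardReflectedPath H W x φ k i) {s t : ℝ}
    (hs : -i < (s : EReal)) (hst : s ≤ t) (ht : t ≤ 0) :
    ∀ᵐ u, u ∈ Ioo s t → DifferentiableAt ℝ φ u ∧
      (∀ j, φ u j = 0 ∨ φ u j = 1 → deriv φ u j = 0) ∧ deriv k u ∈ normalCone (φ u) ∧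
      inner ℝ (gradPlus W (φ u)) (deriv k u) = 0 ∧
      deriv φ u + deriv k u = optDrift H W (φ u) := by
  have h1 := (ae_restrict_iff' measurableSet_Iic).1 h.equation
  have h2 := (ae_restrict_iff' measurableSet_Iic).1 h.push_mem
  have h3 := (ae_restrict_iff' measurableSet_Iic).1 h.compatible
  filter_upwards [h1, h2, h3, ae_differentiableAt_of_ac (h.ac hst ht)] with u h1 h2 h3 h4 hu
  have hu0 : u ∈ Iic (0 : ℝ) := hu.2.le.trans ht
  have hui : -i < (u : EReal) := hs.trans (EReal.coe_lt_coe_iff.2 hu.1)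
  rw [uIcc_of_le hst] at h4
  have hd := h4 (Ioo_subset_Icc_self hu)
  have hev := eventually_mem_of_mem_Ioo (fun v hv => (h.mem_ne hs ht v hv).1) hu
  refine ⟨hd, fun j hj => deriv_coord_eq_zero hd.hasDerivAt hev hj, h2 hu0 hui, ?_, ?_⟩
  · rw [real_inner_comm]; exact h3 hu0 hui
  · rw [h1 hu0 hui, sub_add_cancel]; rfl

/-- Along a backward reflected path, `W` increases at a rate equal to the reflected Lagrangian. -/
lemma IsBackwardReflectedPath.ae_deriv (h : IsBackwardReflectedPath H W x φ k i)
    (hW : IsClassicalSolution H W) (hH : IsRegularHamiltonian H b) {s t : ℝ}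
    (hs : -i < (s : EReal)) (hst : s ≤ t) (ht : t ≤ 0) :
    ∀ᵐ u, u ∈ Ioo s t → HasDerivAt (fun u => W (φ u))
        (inner ℝ (gradPlus W (φ u)) (optDrift H W (φ u))) u ∧
      0 ≤ inner ℝ (gradPlus W (φ u)) (optDrift H W (φ u)) ∧
      (reflectedLagrangian H (φ u) (deriv φ u)).toENNReal ≤
        ENNReal.ofReal (inner ℝ (gradPlus W (φ u)) (optDrift H W (φ u))) := by
  filter_upwards [h.ae_velocity hs hst ht] with u hu humem
  obtain ⟨hd, htan, hcone, horth, heq⟩ := hu humem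
  obtain ⟨hc, hne⟩ := h.mem_ne hs ht u (Ioo_subset_Icc_self humem)
  have hev := eventually_mem_of_mem_Ioo (fun v hv => (h.mem_ne hs ht v hv).1) humem
  refine ⟨?_, hW.inner_optDrift_nonneg hH hc hne, ?_⟩
  -- As `⟨∇₊W, k'⟩ = 0`, the velocity may be replaced by `φ' + k'`, which is the optimal drift.
  · have := hasDerivAt_comp_path hW.contDiffOn hd.hasDerivAt hev hne
    rwa [← inner_gradPlus_of_tangent W htan, ← add_zero (inner ℝ (gradPlus W (φ u)) _), ← horth,
      ← inner_add_right, heq] at this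
  · rw [← EReal.real_coe_toENNReal, ← hW.lagrangian_optDrift hH hc hne, ← heq]
    exact EReal.toENNReal_le_toENNReal (reflectedLagrangian_le hc htan hcone)

lemma IsBackwardReflectedPath.lintegral_le (h : IsBackwardReflectedPath H W x φ k i)
    (hW : IsClassicalSolution H W) (hH : IsRegularHamiltonian H b) {s t : ℝ}
    (hs : -i < (s : EReal)) (hst : s ≤ t) (ht : t ≤ 0) :
    ∫⁻ u in Icc s t, (reflectedLagrangian H (φ u) (deriv φ u)).toENNReal ≤
      ENNReal.ofReal (W (φ t) - W (φ s)) := by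
  refine lintegral_le_ofReal_sub hst
    (ac_comp_path hW.contDiffOn hst (h.ac hst ht) (h.mem_ne hs ht)) ?_
  filter_upwards [h.ae_deriv hW hH hs hst ht] with u hu humem
  rw [(hu humem).1.deriv]
  exact (hu humem).2

lemma IsBackwardReflectedPath.le_of_le (h : IsBackwardReflectedPath H W x φ k i)
    (hW : IsClassicalSolution H W) (hH : IsRegularHamiltonian H b) {s t : ℝ}
    (hs : -i < (s : EReal)) (hst : s ≤ t) (ht : t ≤ 0) : W (φ s) ≤ W (φ t) := by
  have := sub_le_of_deriv_le (c := 0) hst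
    (ac_comp_path hW.contDiffOn hst (h.ac hst ht) (h.mem_ne hs ht)).neg (by
      filter_upwards [h.ae_deriv hW hH hs hst ht] with u hu humem
      have h1 := (hu humem).1.neg.deriv
      rw [h1]
      linarith [(hu humem).2.1])
  simp only [Pi.neg_apply] at this
  linarith

/-- The Lagrangian controls the distance to the averaged drift. -/
lemma exists_delta_lagrangian (hH : IsRegularHamiltonian H b) {ε : ℝ} (hε : 0 < ε) :
    ∃ δ > 0, ∀ y ∈ cube d, ∀ α, δ * (‖gradAlpha H y α - b y‖ - ε) ≤
      inner ℝ α (gradAlpha H y α) - H y α := by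
  have hcont : Continuous fun z : Space d × Space d =>
      ‖gradAlpha H z.2 z.1 - gradAlpha H z.2 0‖ := by
    have h1 := hH.continuous_grad
    have h2 : Continuous fun z : Space d × Space d => gradAlpha H z.2 z.1 :=
      h1.comp continuous_swap
    have h3 : Continuous fun z : Space d × Space d => gradAlpha H z.2 0 :=
      h1.comp (by fun_prop : Continuous fun z : Space d × Space d => (z.2, (0 : Space d)))
    exact (h2.sub h3).norm
  -- For small `β` the gradient is within `ε` of the averaged drift, uniformly on the compact cube.
  have hev : ∀ᶠ β in 𝓝 (0 : Space d), ∀ y ∈ cube d, ‖gradAlpha H y β - gradAlpha H y 0‖ < ε := by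
    refine (isCompact_cube d).eventually_forall_of_forall_eventually fun y _ => ?_
    refine (hcont.tendsto (0, y)).eventually_lt_const ?_
    simpa using hε
  obtain ⟨δ, hδ, hball⟩ := Metric.nhds_basis_closedBall.eventually_iff.1 hev
  refine ⟨δ, hδ, fun y hy α => ?_⟩
  set v := gradAlpha H y α with hv
  rw [← hH.grad_zero]
  set b₀ := gradAlpha H y 0
  have hle : ∀ β, inner ℝ β v - H y β ≤ inner ℝ α v - H y α := by
    intro β
    have := hH.subgradient y α β
    rw [inner_sub_right, ← hv, real_inner_comm, real_inner_comm α] at this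
    linarith
  by_cases hvb : v = b₀
  · have h0 := hle 0
    rw [inner_zero_left, hH.map_zero] at h0
    rw [hvb, sub_self, norm_zero] at *
    nlinarith
  · have hpos : 0 < ‖v - b₀‖ := norm_pos_iff.2 (sub_ne_zero.2 hvb)
    -- Test vector of length `δ` in the direction of the deviation. Convexity gives `H(y, β) ≤ ⟨∇_α
    -- H(y, β), β⟩ ≤ ⟨b₀, β⟩ + ε δ`, hence `⟨β, v⟩ - H(y, β) ≥ δ (‖v - b₀‖ - ε)`.
    set β := (δ * ‖v - b₀‖⁻¹) • (v - b₀) with hβ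
    have hβn : ‖β‖ = δ := by
      rw [hβ, norm_smul, norm_mul, norm_inv, norm_norm, Real.norm_of_nonneg hδ.le,
        inv_mul_cancel_right₀ hpos.ne']
    have h1 := hball (x := β) (by rw [Metric.mem_closedBall, dist_zero_right, hβn]) y hy
    have h2 := hH.subgradient y β 0
    rw [hH.map_zero, zero_sub, inner_neg_right] at h2
    have h3 : inner ℝ (gradAlpha H y β) β ≤ inner ℝ b₀ β + ε * δ := by
      have := real_inner_le_norm (gradAlpha H y β - b₀) β
      rw [inner_sub_left, hβn] at this
      have h4 := mul_le_mul_of_nonneg_right h1.le hδ.le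
      linarith
    have h5 : inner ℝ β v - inner ℝ b₀ β = δ * ‖v - b₀‖ := by
      rw [real_inner_comm β b₀, ← inner_sub_right, hβ, real_inner_smul_left,
        real_inner_self_eq_norm_sq]
      field_simp
    have h6 := hle β
    nlinarith

lemma exists_norm_bound_cube (d : ℕ) : ∃ R > 0, ∀ y ∈ cube d, ‖y‖ ≤ R := by
  obtain ⟨R, hR⟩ := (isCompact_cube d).isBounded.exists_norm_le
  exact ⟨max R 1, lt_max_of_lt_right one_pos, fun y hy => (hR y hy).trans (le_max_left _ _)⟩

/-- A Lyapunov function for backward reflected paths, away from the origin. -/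
lemma exists_lyapunov (hW : IsClassicalSolution H W) (hH : IsRegularHamiltonian H b)
    (hdrift : ∀ x ∈ cube d, x ≠ 0 → inner ℝ x (b x) < 0) {r : ℝ} (hr : 0 < r) :
    ∃ C > 0, ∃ η > 0, ∀ (x : Space d) (φ k : ℝ → Space d) (i : EReal) (s t : ℝ),
      IsBackwardReflectedPath H W x φ k i → -i < (s : EReal) → s ≤ t → t ≤ 0 →
      (∀ u ∈ Ioo s t, r ≤ ‖φ u‖) →
      (‖φ t‖ ^ 2 - C * W (φ t)) - (‖φ s‖ ^ 2 - C * W (φ s)) ≤ -η * (t - s) := by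
  obtain ⟨R, hR, hRb⟩ := exists_norm_bound_cube d
  have hbc : Continuous b := by
    rw [show b = fun y => gradAlpha H y 0 from funext fun y => (hH.grad_zero y).symm]
    exact hH.continuous_grad.comp (by fun_prop : Continuous fun y : Space d => (y, (0 : Space d)))
  have hη : ∃ η > 0, ∀ y ∈ cube d, r ≤ ‖y‖ → inner ℝ y (b y) ≤ -η := by
    have hcomp : IsCompact (cube d ∩ {y | r ≤ ‖y‖}) :=
      (isCompact_cube d).inter_right (isClosed_le continuous_const continuous_norm)
    rcases (cube d ∩ {y | r ≤ ‖y‖}).eq_empty_or_nonempty with he | hne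
    · refine ⟨1, one_pos, fun y hy hy' => ?_⟩
      have : y ∈ cube d ∩ {y | r ≤ ‖y‖} := ⟨hy, hy'⟩
      rw [he] at this
      exact this.elim
    · obtain ⟨z, hz, hmax⟩ := hcomp.exists_isMaxOn hne
        (f := fun y => inner ℝ y (b y)) (continuous_id.inner hbc).continuousOn
      refine ⟨-inner ℝ z (b z), ?_, fun y hy hy' => ?_⟩
      · have hz0 : z ≠ 0 := by
          rintro rfl
          have : r ≤ ‖(0 : Space d)‖ := hz.2
          rw [norm_zero] at this
          linarith
        have := hdrift z hz.1 hz0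
        linarith
      · rw [neg_neg]; exact hmax ⟨hy, hy'⟩
  obtain ⟨η, hη, hηb⟩ := hη
  -- This `ε` lets the error `R ε` consume half of the decay `η`. Then `(‖φ‖²)' ≤ -η + (2 R / δ) ℓ`
  -- with `ℓ = (W(φ))'`, and `C = 2 R / δ` cancels the last term.
  obtain ⟨δ, hδ, hδb⟩ := exists_delta_lagrangian hH (ε := η / (2 * R)) (by positivity)
  refine ⟨2 * R / δ, by positivity, η, hη, fun x φ k i s t h hs hst ht hru => ?_⟩
  have hsq : ContDiffOn ℝ 1 (fun y : Space d => ‖y‖ ^ 2) (cube d \ {0}) :=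
    (contDiff_norm_sq ℝ).contDiffOn
  refine sub_le_of_deriv_le (g := fun t => ‖φ t‖ ^ 2 - 2 * R / δ * W (φ t)) hst
    ((ac_comp_path hsq hst (h.ac hst ht) (h.mem_ne hs ht)).sub
      ((ac_comp_path hW.contDiffOn hst (h.ac hst ht) (h.mem_ne hs ht)).const_mul _)) ?_
  filter_upwards [h.ae_velocity hs hst ht, h.ae_deriv hW hH hs hst ht] with u hu hu' humem
  obtain ⟨hd, -, hcone, -, heq⟩ := hu humem
  obtain ⟨hWd, -, -⟩ := hu' humem
  obtain ⟨hc, hne⟩ := h.mem_ne hs ht u (Ioo_subset_Icc_self humem)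
  rw [(HasDerivAt.fun_sub hd.hasDerivAt.norm_sq (hWd.const_mul (2 * R / δ))).deriv]
  have h1 := hδb (φ u) hc (gradPlus W (φ u))
  rw [hW.eq_zero hc hne, sub_zero] at h1
  change δ * (‖optDrift H W (φ u) - b (φ u)‖ - η / (2 * R)) ≤
    inner ℝ (gradPlus W (φ u)) (optDrift H W (φ u)) at h1
  set v := optDrift H W (φ u)
  set ℓ := inner ℝ (gradPlus W (φ u)) v
  have h2 : inner ℝ (φ u) (deriv φ u) ≤ inner ℝ (φ u) v := by
    rw [← heq, inner_add_right]
    linarith [inner_self_normalCone_nonneg hc hcone]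
  have h3 : inner ℝ (φ u) v ≤ -η + R * ‖v - b (φ u)‖ := by
    have e1 := hηb (φ u) hc (hru u humem)
    have e2 := real_inner_le_norm (φ u) (v - b (φ u))
    rw [inner_sub_right] at e2
    have e3 := mul_le_mul_of_nonneg_right (hRb (φ u) hc) (norm_nonneg (v - b (φ u)))
    linarith
  have h4 : ‖v - b (φ u)‖ ≤ η / (2 * R) + ℓ / δ := by
    have : ‖v - b (φ u)‖ - η / (2 * R) ≤ ℓ / δ := by
      rw [le_div_iff₀ hδ, mul_comm]; exact h1
    linarith
  have h5 : R * ‖v - b (φ u)‖ ≤ η / 2 + R / δ * ℓ := by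
    calc R * ‖v - b (φ u)‖ ≤ R * (η / (2 * R) + ℓ / δ) := mul_le_mul_of_nonneg_left h4 hR.le
      _ = η / 2 + R / δ * ℓ := by field_simp
  have h6 : 2 * R / δ * ℓ = 2 * (R / δ * ℓ) := by ring
  linarith

/-- Backward reflected paths come from the origin. -/
lemma IsBackwardReflectedPath.tendsto_zero (h : IsBackwardReflectedPath H W x φ k i)
    (hW : IsClassicalSolution H W) (hH : IsRegularHamiltonian H b)
    (hdrift : ∀ x ∈ cube d, x ≠ 0 → inner ℝ x (b x) < 0) : Tendsto φ atBot (𝓝 0) := by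
  by_cases hi : i = ⊤
  swap
  · have hev : ∀ᶠ t : ℝ in atBot, φ t = 0 := by
      filter_upwards [eventually_le_atBot 0, eventually_le_atBot (-i.toReal)] with t h1 h2
      refine h.eq_zero t h1 ?_
      rw [← EReal.coe_toReal hi (h.life_pos.trans' (EReal.bot_lt_zero)).ne', ← EReal.coe_neg]
      exact EReal.coe_le_coe_iff.2 h2
    exact tendsto_const_nhds.congr' (hev.mono fun t ht => ht.symm)
  have hall : ∀ s : ℝ, -i < (s : EReal) := fun s => by
    rw [hi, EReal.neg_top]; exact EReal.bot_lt_coe s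
  obtain ⟨B, hB⟩ : ∃ B, ∀ y ∈ cube d, |W y| ≤ B :=
    (isCompact_cube d).exists_bound_of_continuousOn hW.continuousOn
  obtain ⟨R, hR, hRb⟩ := exists_norm_bound_cube d
  have hmono : Monotone fun t : ℝ => W (φ (min t 0)) := fun s t hst =>
    h.le_of_le hW hH (hall _) (min_le_min_right 0 hst) (min_le_right _ _)
  -- `W(φ)` is monotone and bounded, so it converges in the past; sufficiently early, its total
  -- earlier variation times `C` is at most `r ^ 2`.
  have hbdd : BddBelow (range fun t : ℝ => W (φ (min t 0))) := by
    refine ⟨-B, ?_⟩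
    rintro _ ⟨t, rfl⟩
    exact (abs_le.1 (hB _ (h.mem_cube _ (min_le_right _ _)))).1
  have hlim := tendsto_atBot_ciInf hmono hbdd
  set c := ⨅ t : ℝ, W (φ (min t 0))
  have hcle : ∀ t ≤ 0, c ≤ W (φ t) := fun t ht => by
    have := ciInf_le hbdd t
    rwa [min_eq_left ht] at this
  rw [Metric.tendsto_nhds]
  intro ρ hρ
  by_contra hcon
  set r := ρ / 2 with hrdef
  have hr : 0 < r := by positivity
  obtain ⟨C, hC, η, hη, hlyap⟩ := exists_lyapunov hW hH hdrift hr
  have hsmall : ∀ᶠ t : ℝ in atBot, W (φ (min t 0)) < c + r ^ 2 / C :=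
    hlim.eventually_lt_const (by have : 0 < r ^ 2 / C := by positivity
                                 linarith)
  obtain ⟨t, hbig, hsm, ht0⟩ := ((Filter.not_eventually.1 hcon).and_eventually
    (hsmall.and (eventually_le_atBot 0))).exists
  rw [min_eq_left ht0] at hsm
  rw [dist_zero_right, not_lt] at hbig
  have hWdiff : ∀ s ≤ t, C * (W (φ t) - W (φ s)) ≤ r ^ 2 := by
    intro s hs
    have h1 : W (φ t) - W (φ s) ≤ r ^ 2 / C := by linarith [hcle s (hs.trans ht0)]
    calc C * (W (φ t) - W (φ s)) ≤ C * (r ^ 2 / C) := mul_le_mul_of_nonneg_left h1 hC.le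
      _ = r ^ 2 := by field_simp
  have hbig2 : 4 * r ^ 2 ≤ ‖φ t‖ ^ 2 := by
    have : 2 * r ≤ ‖φ t‖ := by rw [hrdef]; linarith
    nlinarith
  -- From the last earlier time in the ball of radius `r` up to `t`, the Lyapunov inequality would
  -- let `‖φ‖²` grow by at most `r ^ 2`, whereas it grows by at least `3 r ^ 2`.
  have hstay : ∀ s ≤ t, r < ‖φ s‖ := by
    intro s hs
    by_contra hle
    rw [not_lt] at hle
    have hcont : ContinuousOn φ (Icc s t) := by
      have := (h.ac hs ht0).continuousOn
      rwa [uIcc_of_le hs] at this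
    have hcomp : IsCompact (Icc s t ∩ φ ⁻¹' {y | ‖y‖ ≤ r}) :=
      isCompact_Icc.of_isClosed_subset (hcont.preimage_isClosed_of_isClosed isClosed_Icc
        (isClosed_le continuous_norm continuous_const)) inter_subset_left
    obtain ⟨s', ⟨hs', hs'r⟩, hmax⟩ := hcomp.exists_isGreatest ⟨s, ⟨le_rfl, hs⟩, hle⟩
    have hs'r : ‖φ s'‖ ≤ r := hs'r
    have h1 := hlyap x φ k i s' t h (hall s') hs'.2 ht0 (fun u hu => by
      by_contra hlt
      rw [not_le] at hlt
      exact absurd (hmax ⟨⟨hs'.1.trans hu.1.le, hu.2.le⟩, hlt.le⟩) (not_le.2 hu.1))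
    have h2 := hWdiff s' hs'.2
    have h3 : ‖φ s'‖ ^ 2 ≤ r ^ 2 := pow_le_pow_left₀ (norm_nonneg _) hs'r 2
    have h4 : 0 ≤ η * (t - s') := mul_nonneg hη.le (sub_nonneg.2 hs'.2)
    nlinarith [pow_pos hr 2]
  -- Over this length the decay `R ^ 2 + r ^ 2` would give `‖φ t‖ ^ 2 ≤ 0`.
  set s := t - (R ^ 2 + r ^ 2) / η with hs
  have hst : s ≤ t := by
    have : 0 ≤ (R ^ 2 + r ^ 2) / η := by positivity
    linarith
  have h1 := hlyap x φ k i s t h (hall s) hst ht0 (fun u hu => (hstay u hu.2.le).le)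
  have h2 := hWdiff s hst
  have h3 : ‖φ s‖ ^ 2 ≤ R ^ 2 :=
    pow_le_pow_left₀ (norm_nonneg _) (hRb _ (h.mem_cube s (hst.trans ht0))) 2
  have h4 : η * (t - s) = R ^ 2 + r ^ 2 := by rw [hs]; field_simp; ring
  nlinarith [pow_pos hr 2]

lemma IsBackwardReflectedPath.continuousOn (h : IsBackwardReflectedPath H W x φ k i) :
    ContinuousOn φ (Iic 0) := by
  intro t ht
  have h1 := (h.path_ac (t - 1) (by linarith [mem_Iic.1 ht])).continuousOn
  rw [uIcc_of_le (by linarith [mem_Iic.1 ht])] at h1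
  refine (h1 t ⟨by linarith, ht⟩).mono_of_mem_nhdsWithin ?_
  filter_upwards [self_mem_nhdsWithin, mem_nhdsWithin_of_mem_nhds (Ioi_mem_nhds (by linarith :
    t - 1 < t))] with s hs hs'
  exact ⟨le_of_lt hs', hs⟩

lemma IsBackwardReflectedPath.mem_backwardPaths (h : IsBackwardReflectedPath H W x φ k i)
    (hW : IsClassicalSolution H W) (hH : IsRegularHamiltonian H b)
    (hdrift : ∀ x ∈ cube d, x ≠ 0 → inner ℝ x (b x) < 0) : φ ∈ backwardPaths x :=
  ⟨h.continuousOn, h.mem_cube, h.tendsto_zero hW hH hdrift, h.terminal⟩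

/-- The value of `W` tends to zero along a backward reflected path at the beginning of its life. -/
lemma IsBackwardReflectedPath.exists_small (h : IsBackwardReflectedPath H W x φ k i)
    (hW : IsClassicalSolution H W) (hW0 : W 0 = 0) (hH : IsRegularHamiltonian H b)
    (hdrift : ∀ x ∈ cube d, x ≠ 0 → inner ℝ x (b x) < 0) {a : ℝ} (ha : -i < (a : EReal))
    (ha0 : a ≤ 0) {ε : ℝ} (hε : 0 < ε) :
    ∃ t ≤ a, -i < (t : EReal) ∧ ‖φ t‖ < ε ∧ |W (φ t)| < ε := by
  have hWc : ∀ᶠ y in 𝓝[cube d] (0 : Space d), ‖y‖ < ε ∧ |W y| < ε := by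
    refine Eventually.and (mem_nhdsWithin_of_mem_nhds ?_) ?_
    · have := Metric.ball_mem_nhds (0 : Space d) hε
      filter_upwards [this] with y hy
      simpa using hy
    · have h1 : Tendsto (fun y => |W y|) (𝓝[cube d] 0) (𝓝 |W 0|) :=
        (hW.continuousOn 0 zero_mem_cube).tendsto.abs
      rw [hW0, abs_zero] at h1
      exact h1.eventually_lt_const hε
  by_cases hi : i = ⊤
  · have h1 : Tendsto φ atBot (𝓝[cube d] 0) := by
      refine tendsto_nhdsWithin_iff.2 ⟨h.tendsto_zero hW hH hdrift, ?_⟩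
      filter_upwards [eventually_le_atBot 0] with t ht using h.mem_cube t ht
    obtain ⟨t, ht, hta⟩ := ((h1.eventually hWc).and (eventually_le_atBot a)).exists
    exact ⟨t, hta, by rw [hi, EReal.neg_top]; exact EReal.bot_lt_coe t, ht⟩
  · lift i to ℝ using ⟨hi, (h.life_pos.trans' (EReal.bot_lt_zero)).ne'⟩
    rw [← EReal.coe_neg, EReal.coe_lt_coe_iff] at ha
    have hi0 : -i ≤ 0 := ha.le.trans ha0
    have hz : φ (-i) = 0 := h.eq_zero (-i) hi0 (by rw [EReal.coe_neg])
    have h1 : Tendsto φ (𝓝[>] (-i)) (𝓝[cube d] 0) := by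
      refine tendsto_nhdsWithin_iff.2 ⟨?_, ?_⟩
      · have h2 : Tendsto φ (𝓝[Iic 0] (-i)) (𝓝 (φ (-i))) := h.continuousOn (-i) hi0
        rw [hz] at h2
        refine h2.mono_left ?_
        rw [← nhdsWithin_Ioo_eq_nhdsGT ha]
        exact nhdsWithin_mono _ fun u hu => hu.2.le.trans ha0
      · filter_upwards [Ioo_mem_nhdsGT ha] with t ht using h.mem_cube t (ht.2.le.trans ha0)
    obtain ⟨t, ht, hta⟩ := ((h1.eventually hWc).and (Ioo_mem_nhdsGT ha)).exists
    exact ⟨t, hta.2.le, by rw [← EReal.coe_neg, EReal.coe_lt_coe_iff]; exact hta.1, ht⟩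

/-- `W(φ)` is nondecreasing and starts from the value zero at the beginning of the life of the path.
-/
lemma IsBackwardReflectedPath.nonneg (h : IsBackwardReflectedPath H W x φ k i)
    (hW : IsClassicalSolution H W) (hW0 : W 0 = 0) (hH : IsRegularHamiltonian H b)
    (hdrift : ∀ x ∈ cube d, x ≠ 0 → inner ℝ x (b x) < 0) {a : ℝ} (ha : -i < (a : EReal))
    (ha0 : a ≤ 0) : 0 ≤ W (φ a) := by
  refine le_of_forall_pos_le_add fun ε hε => ?_
  obtain ⟨t, hta, hti, -, hWt⟩ := h.exists_small hW hW0 hH hdrift ha ha0 hε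
  have h1 := h.le_of_le hW hH hti hta ha0
  have h2 := (abs_lt.1 hWt).1
  linarith

/-- Resting at the origin is free: the averaged drift there lies in the normal cone, so it can serve
as the push, and following the averaged drift costs nothing. -/
lemma reflectedLagrangian_zero_le (hH : IsRegularHamiltonian H b) (hb0 : ∀ j, b 0 j ≤ 0) :
    reflectedLagrangian H (0 : Space d) 0 ≤ 0 := by
  have hcone : b 0 ∈ normalCone (0 : Space d) := by
    rw [mem_normalCone_iff zero_mem_cube]
    exact fun j => ⟨fun _ => hb0 j, fun h => absurd h (by simp)⟩
  refine (reflectedLagrangian_le zero_mem_cube (fun j _ => rfl) hcone).trans (le_of_eq ?_)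
  rw [zero_add, ← hH.grad_zero, lagrangian_grad hH, hH.map_zero, inner_zero_left, sub_zero,
    EReal.coe_zero]

/-- During its life the path pays the increase of `W`, at most `W x`; before its life it rests at
the origin at no cost. -/
theorem IsBackwardReflectedPath.backwardAction_le (h : IsBackwardReflectedPath H W x φ k i)
    (hW : IsClassicalSolution H W) (hW0 : W 0 = 0) (hH : IsRegularHamiltonian H b)
    (hdrift : ∀ x ∈ cube d, x ≠ 0 → inner ℝ x (b x) < 0) (hb0 : ∀ j, b 0 j ≤ 0) :
    backwardAction H φ ≤ ENNReal.ofReal (W x) := by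
  unfold backwardAction
  rw [if_pos h.path_ac]
  set f : ℝ → ℝ≥0∞ := fun t => (reflectedLagrangian H (φ t) (deriv φ t)).toENNReal with hf
  -- Rational starting times make the exhaustion of the life a countable directed union, along which
  -- the integral is a supremum without measurability of `f`.
  let ι := {q : ℚ // ((q : ℝ) ≤ 0) ∧ -i < ((q : ℝ) : EReal)}
  let S : Set ℝ := ⋃ q : ι, Icc (q.1 : ℝ) 0
  have hdir : Directed (· ⊆ ·) fun q : ι => Icc (q.1 : ℝ) 0 := by
    intro p q
    rcases le_total (p.1 : ℝ) q.1 with hpq | hpq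
    · exact ⟨p, subset_rfl, Icc_subset_Icc hpq le_rfl⟩
    · exact ⟨q, Icc_subset_Icc hpq le_rfl, subset_rfl⟩
  have hS : ∫⁻ t in S, f t ≤ ENNReal.ofReal (W x) := by
    rw [setLIntegral_iUnion_of_directed f hdir]
    refine iSup_le fun q => (h.lintegral_le hW hH q.2.2 q.2.1 le_rfl).trans
      (ENNReal.ofReal_le_ofReal ?_)
    rw [h.terminal]
    linarith [h.nonneg hW hW0 hH hdrift q.2.2 q.2.1]
  have hsub : Iic (0 : ℝ) ⊆ S ∪ {t : ℝ | t ≤ 0 ∧ (t : EReal) ≤ -i} := by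
    intro t ht
    by_cases hti : (t : EReal) ≤ -i
    · exact Or.inr ⟨ht, hti⟩
    · rw [not_le] at hti
      obtain ⟨q, hq1, hq2⟩ := EReal.exists_rat_btwn_of_lt hti
      have hqt : (q : ℝ) < t := by exact_mod_cast hq2
      exact Or.inl (mem_iUnion.2 ⟨⟨q, hqt.le.trans ht, hq1⟩, hqt.le, ht⟩)
  have hrest : ∫⁻ t in {t : ℝ | t ≤ 0 ∧ (t : EReal) ≤ -i}, f t = 0 := by
    have hmeas : MeasurableSet {t : ℝ | t ≤ 0 ∧ (t : EReal) ≤ -i} :=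
      measurableSet_Iic.inter (measurable_coe_real_ereal measurableSet_Iic)
    refine lintegral_eq_zero_of_ae_eq_zero ?_
    change ∀ᵐ t ∂_, _
    rw [ae_restrict_iff' hmeas]
    -- At `-i` and at `0` the path is not known to be zero on both sides, so its derivative is not
    -- controlled there.
    filter_upwards [(countable_singleton (-i.toReal)).ae_notMem volume,
      (countable_singleton (0 : ℝ)).ae_notMem volume] with t ht1 ht2 ht
    have htop : i ≠ ⊤ := by
      rintro rfl
      have := ht.2
      rw [EReal.neg_top, le_bot_iff] at this
      exact EReal.coe_ne_bot t this
    have hle : ∀ s : ℝ, s ≤ -i.toReal → (s : EReal) ≤ -i := by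
      intro s hs
      rw [← EReal.coe_toReal htop (h.life_pos.trans' (EReal.bot_lt_zero)).ne', ← EReal.coe_neg]
      exact EReal.coe_le_coe_iff.2 hs
    have hlt : t < -i.toReal := by
      refine lt_of_le_of_ne ?_ ht1
      have := ht.2
      rw [← EReal.coe_toReal htop (h.life_pos.trans' (EReal.bot_lt_zero)).ne', ← EReal.coe_neg]
        at this
      exact EReal.coe_le_coe_iff.1 this
    have hev : φ =ᶠ[𝓝 t] fun _ => 0 := by
      filter_upwards [Iio_mem_nhds hlt, Iio_mem_nhds (lt_of_le_of_ne ht.1 ht2)] with s hs hs'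
      exact h.eq_zero s (le_of_lt hs') (hle s (le_of_lt hs))
    have h1 : deriv φ t = 0 := by rw [hev.deriv_eq, deriv_const]
    simp only [hf, Pi.zero_apply]
    rw [h1, hev.self_of_nhds]
    exact EReal.toENNReal_of_nonpos (reflectedLagrangian_zero_le hH hb0)
  calc ∫⁻ t in Iic 0, f t ≤ ∫⁻ t in S ∪ {t : ℝ | t ≤ 0 ∧ (t : EReal) ≤ -i}, f t :=
        lintegral_mono_set hsub
    _ ≤ (∫⁻ t in S, f t) + ∫⁻ t in {t : ℝ | t ≤ 0 ∧ (t : EReal) ≤ -i}, f t :=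
        lintegral_union_le _ _ _
    _ ≤ ENNReal.ofReal (W x) := by rw [hrest, add_zero]; exact hS

/-- The constant path at the origin forces `k 1 = b 0`, and a path that stays off the upper faces is
pushed only towards negative coordinates. -/
lemma drift_zero_nonpos_of_equilibrium
    (h : IsRDESolution b (0 : Space d) fun _ => 0) (j : Fin d) : b 0 j ≤ 0 := by
  obtain ⟨k, hk⟩ := h 1 one_pos
  have h1 := hk.push_antitone (j := j) (s := 0) (t := 1) le_rfl zero_le_one le_rfl
    (fun u _ => by simp)
  have h2 := hk.eq_add 1 (by simp)
  have h3 := hk.eq_add 0 (by simp)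
  simp only [intervalIntegral.integral_const, sub_zero, one_smul, zero_add, sub_self,
    zero_smul] at h2 h3
  rw [h2, ← zero_add (k 1 j)]
  rw [← h3] at h1
  simpa using h1

end Backward

/-! ### Peano's existence theorem -/

section Peano

variable {V : Type*} [NormedAddCommGroup V] [NormedSpace ℝ V]

/-- The Euler scheme with step `h` for the vector field `F`. -/
def eulerScheme (F : V → V) (h : ℝ) (x : V) : ℕ → V
  | 0 => x
  | n + 1 => eulerScheme F h x n + h • F (eulerScheme F h x n)

variable {F : V → V} {h : ℝ} {x : V}

lemma norm_eulerScheme_sub_le (hF : ∀ z, ‖F z‖ ≤ 1) (hh : 0 ≤ h) (m l : ℕ) :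
    ‖eulerScheme F h x (m + l) - eulerScheme F h x m‖ ≤ l * h := by
  induction l with
  | zero => simp
  | succ l ih =>
    rw [← add_assoc, eulerScheme, add_sub_right_comm]
    refine (norm_add_le _ _).trans ?_
    rw [norm_smul, Real.norm_of_nonneg hh]
    have := mul_le_mul_of_nonneg_left (hF (eulerScheme F h x (m + l))) hh
    push_cast
    linarith

/-- As long as `l h ≤ δ` the scheme has moved by at most `δ`, so each increment differs from `h F`
at the start by at most `ε h`. -/
lemma norm_eulerScheme_sub_sub_le (hF : ∀ z, ‖F z‖ ≤ 1) (hh : 0 ≤ h) {ε δ : ℝ}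
    (hε : ∀ y z, ‖y - z‖ ≤ δ → ‖F y - F z‖ ≤ ε) (m l : ℕ) (hl : l * h ≤ δ) :
    ‖eulerScheme F h x (m + l) - eulerScheme F h x m - (l * h) • F (eulerScheme F h x m)‖ ≤
      ε * (l * h) := by
  induction l with
  | zero => simp
  | succ l ih =>
    have hl' : (l : ℝ) * h ≤ δ := by push_cast at hl; linarith
    have h1 := ih hl'
    have h2 := hε _ _ ((norm_eulerScheme_sub_le (x := x) hF hh m l).trans hl')
    set y := eulerScheme F h x m
    set z := eulerScheme F h x (m + l) with hz
    have h3 : eulerScheme F h x (m + (l + 1)) - y - (((l + 1 : ℕ) : ℝ) * h) • F y =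
        (z - y - ((l : ℝ) * h) • F y) + h • (F z - F y) := by
      rw [← add_assoc, eulerScheme, ← hz]
      push_cast
      module
    rw [h3]
    refine (norm_add_le _ _).trans ?_
    rw [norm_smul, Real.norm_of_nonneg hh]
    have := mul_le_mul_of_nonneg_left h2 hh
    push_cast
    linarith

lemma floor_mul_sub_floor_mul_bounds {n : ℕ} (hn : 0 < n) {s t : ℝ} (hs : 0 ≤ s) (hst : s ≤ t) :
    ∃ l : ℕ, ⌊(n : ℝ) * t⌋₊ = ⌊(n : ℝ) * s⌋₊ + l ∧ |l * (n : ℝ)⁻¹ - (t - s)| ≤ (n : ℝ)⁻¹ := by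
  have hn' : (0 : ℝ) < n := Nat.cast_pos.2 hn
  have hle : ⌊(n : ℝ) * s⌋₊ ≤ ⌊(n : ℝ) * t⌋₊ :=
    Nat.floor_le_floor (mul_le_mul_of_nonneg_left hst hn'.le)
  refine ⟨⌊(n : ℝ) * t⌋₊ - ⌊(n : ℝ) * s⌋₊, (Nat.add_sub_cancel' hle).symm, ?_⟩
  rw [Nat.cast_sub hle]
  have h1 := Nat.floor_le (mul_nonneg hn'.le hs)
  have h2 := Nat.lt_floor_add_one ((n : ℝ) * s)
  have h3 := Nat.floor_le (mul_nonneg hn'.le (hs.trans hst))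
  have h4 := Nat.lt_floor_add_one ((n : ℝ) * t)
  have h5 : ((⌊(n : ℝ) * t⌋₊ : ℝ) - ⌊(n : ℝ) * s⌋₊) * (n : ℝ)⁻¹ - (t - s) =
      (n : ℝ)⁻¹ * ((⌊(n : ℝ) * t⌋₊ : ℝ) - ⌊(n : ℝ) * s⌋₊ - (n * t - n * s)) := by
    field_simp
  rw [h5, abs_mul, abs_of_pos (inv_pos.2 hn')]
  refine mul_le_of_le_one_right (inv_pos.2 hn').le ?_
  rw [abs_le]
  constructor <;> linarith

/-- **Peano's theorem** for a bounded uniformly continuous vector field: a solution is obtained as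
a limit of Euler schemes along an ultrafilter. -/
theorem exists_peano [ProperSpace V] (hFc : UniformContinuous F) (hF : ∀ z, ‖F z‖ ≤ 1) (x : V) :
    ∃ z : ℝ → V, z 0 = x ∧ (∀ s t, 0 ≤ s → s ≤ t → ‖z t - z s‖ ≤ t - s) ∧
      ∀ t, 0 ≤ t → HasDerivWithinAt z (F (z t)) (Ici t) t := by
  -- An ultrafilter replaces the extraction of a uniformly convergent subsequence: bounded sequences
  -- converge along it at all times at once.
  let U : Ultrafilter ℕ := Ultrafilter.of atTop
  have hU : (U : Filter ℕ) ≤ atTop := Ultrafilter.of_le atTop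
  have hinv : Tendsto (fun n : ℕ => (n : ℝ)⁻¹) U (𝓝 0) :=
    tendsto_inv_atTop_nhds_zero_nat.mono_left hU
  let e : ℕ → ℝ → V := fun n t => eulerScheme F (n : ℝ)⁻¹ x ⌊(n : ℝ) * t⌋₊
  have hpos : ∀ᶠ n : ℕ in U, 0 < n := hU (eventually_gt_atTop 0)
  have hbd : ∀ n : ℕ, 0 < n → ∀ s t, 0 ≤ s → s ≤ t →
      ‖e n t - e n s‖ ≤ (t - s) + (n : ℝ)⁻¹ := by
    intro n hn s t hs hst
    obtain ⟨l, hl, hl'⟩ := floor_mul_sub_floor_mul_bounds hn hs hst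
    simp only [e, hl]
    refine (norm_eulerScheme_sub_le hF (by positivity) _ l).trans ?_
    linarith [(abs_le.1 hl').2]
  have he0 : ∀ n, e n 0 = x := fun n => by simp [e, eulerScheme]
  have hlim : ∀ t : ℝ, ∃ y, 0 ≤ t → Tendsto (fun n => e n t) U (𝓝 y) := by
    intro t
    by_cases ht : 0 ≤ t
    · have hmem : ∀ᶠ n in (U : Filter ℕ), e n t ∈ Metric.closedBall x (t + 1) := by
        filter_upwards [hpos] with n hn
        rw [Metric.mem_closedBall, dist_eq_norm]
        have h1 := hbd n hn 0 t le_rfl ht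
        rw [he0, sub_zero] at h1
        have h2 : (n : ℝ)⁻¹ ≤ 1 := inv_le_one_of_one_le₀ (Nat.one_le_cast.2 hn)
        linarith
      obtain ⟨y, -, hy⟩ := (isCompact_closedBall x (t + 1)).ultrafilter_le_nhds
        (U.map fun n => e n t) (le_principal_iff.2 hmem)
      exact ⟨y, fun _ => hy⟩
    · exact ⟨0, fun h => absurd h ht⟩
  choose z hz using hlim
  refine ⟨z, ?_, fun s t hs hst => ?_, fun t ht => ?_⟩
  · refine tendsto_nhds_unique (hz 0 le_rfl) ?_
    simp only [he0]
    exact tendsto_const_nhds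
  · have h1 := ((hz t (hs.trans hst)).sub (hz s hs)).norm
    have h2 := (tendsto_const_nhds (x := t - s)).add hinv
    rw [add_zero] at h2
    refine le_of_tendsto_of_tendsto h1 h2 ?_
    filter_upwards [hpos] with n hn using hbd n hn s t hs hst
  · rw [hasDerivWithinAt_iff_isLittleO, Asymptotics.isLittleO_iff]
    intro ε hε
    obtain ⟨δ, hδ, hδε⟩ := Metric.uniformContinuous_iff.1 hFc ε hε
    have hδ' : ∀ y z, ‖y - z‖ ≤ δ / 2 → ‖F y - F z‖ ≤ ε := fun y z hyz => by
      rw [← dist_eq_norm] at hyz ⊢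
      exact (hδε (hyz.trans_lt (by linarith))).le
    -- A quarter of `δ` for `s - t` and another for the grid error `1 / n` keep the elapsed grid
    -- time below `δ / 2`.
    have hnear : Ico t (t + δ / 4) ∈ 𝓝[≥] t := Ico_mem_nhdsGE (by linarith)
    filter_upwards [hnear] with s hs
    have hlim1 : Tendsto (fun n => ‖e n s - e n t - (s - t) • F (e n t)‖) U
        (𝓝 ‖z s - z t - (s - t) • F (z t)‖) :=
      (((hz s (ht.trans hs.1)).sub (hz t ht)).sub
        (((hFc.continuous.tendsto _).comp (hz t ht)).const_smul (s - t))).norm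
    have hlim2 : Tendsto (fun n : ℕ => ε * ((s - t) + (n : ℝ)⁻¹) + (n : ℝ)⁻¹) U
        (𝓝 (ε * ((s - t) + 0) + 0)) :=
      ((tendsto_const_nhds.add hinv).const_mul ε).add hinv
    rw [add_zero, add_zero] at hlim2
    rw [Real.norm_of_nonneg (sub_nonneg.2 hs.1)]
    refine le_of_tendsto_of_tendsto hlim1 hlim2 ?_
    filter_upwards [hpos, hinv.eventually_lt_const (by linarith : (0 : ℝ) < δ / 4)] with n hn hnδ
    obtain ⟨l, hl, hl'⟩ := floor_mul_sub_floor_mul_bounds hn ht hs.1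
    have h1 := abs_le.1 hl'
    have h2 := norm_eulerScheme_sub_sub_le (x := x) hF (h := (n : ℝ)⁻¹) (by positivity) hδ'
      ⌊(n : ℝ) * t⌋₊ l (by linarith [h1.2, hs.2])
    simp only [e, hl]
    set y := eulerScheme F (n : ℝ)⁻¹ x ⌊(n : ℝ) * t⌋₊
    set y' := eulerScheme F (n : ℝ)⁻¹ x (⌊(n : ℝ) * t⌋₊ + l)
    have h3 : y' - y - (s - t) • F y =
        (y' - y - (l * (n : ℝ)⁻¹) • F y) + (l * (n : ℝ)⁻¹ - (s - t)) • F y := by module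
    rw [h3]
    refine (norm_add_le _ _).trans (add_le_add (h2.trans ?_) ?_)
    · exact mul_le_mul_of_nonneg_left (by linarith [h1.2]) hε.le
    · rw [norm_smul, Real.norm_eq_abs]
      exact (mul_le_of_le_one_right (abs_nonneg _) (hF y)).trans hl'

end Peano

/-! ### Local solutions of the time-reversed equation -/

section Outward

variable {d : ℕ} {H : Space d → Space d → ℝ} {b : Space d → Space d} {W : Space d → ℝ}

/-- The sign of the outward normal in direction `j` at a point of a face orthogonal to `e_j`. -/
def outward (x : Space d) (j : Fin d) : ℝ := if x j = 0 then -1 else 1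

/-- The coordinate `j` of `x` is an endpoint of `[0,1]`. -/
def IsActive (x : Space d) (j : Fin d) : Prop := x j = 0 ∨ x j = 1

lemma outward_congr {x y : Space d} {j : Fin d} (h : y j = x j) : outward y j = outward x j := by
  unfold outward; rw [h]

lemma isActive_congr {x y : Space d} {j : Fin d} (h : y j = x j) : IsActive y j ↔ IsActive x j := by
  unfold IsActive; rw [h]

lemma outward_mul_self (x : Space d) (j : Fin d) : outward x j * outward x j = 1 := by
  unfold outward; split_ifs <;> norm_num

lemma cubeBoundary_of_isActive {x : Space d} {j : Fin d} (hx : x ∈ cube d) (hj : IsActive x j) :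
    x ∈ cubeBoundary d := by
  refine ⟨hx, fun h => ?_⟩
  rcases hj with h0 | h1
  · exact (h j).1.ne' h0
  · exact (h j).2.ne h1

lemma stepVec_outward {x : Space d} {j : Fin d} (hj : IsActive x j) :
    stepVec (j, decide (x j = 1)) = EuclideanSpace.single j (outward x j) := by
  unfold stepVec outward
  rcases hj with h | h <;> simp [h]

lemma stepVec_mem_normals {x : Space d} {j : Fin d} (hj : IsActive x j) :
    stepVec (j, decide (x j = 1)) ∈ normals x := by
  refine ⟨norm_stepVec _, fun i => ?_⟩
  unfold stepVec
  by_cases hij : i = j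
  · subst hij
    rcases hj with hj | hj <;> simp [hj]
  · simp [hij]

lemma inner_stepVec_outward {x : Space d} {j : Fin d} (hj : IsActive x j) (v : Space d) :
    inner ℝ v (stepVec (j, decide (x j = 1))) = outward x j * v j := by
  rw [stepVec_outward hj, inner_single_right]

/-- Treats lower and upper faces together: the outward component of `∇₊W` is the positive part of
that of `∇W`. -/
lemma outward_mul_gradPlus {x : Space d} {j : Fin d} (hj : IsActive x j) :
    outward x j * gradPlus W x j = max (outward x j * grad W x j) 0 := by
  rw [gradPlus_apply]
  unfold outward
  rcases hj with h | h
  · rw [if_pos h, if_pos h, neg_one_mul, neg_one_mul, ← max_neg_neg, neg_zero]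
  · have h0 : x j ≠ 0 := by rw [h]; exact one_ne_zero
    rw [if_neg h0, if_neg h0, if_pos h, one_mul, one_mul]

lemma gradPlus_eq_zero_of_active {x : Space d} {j : Fin d} (hj : IsActive x j)
    (h : outward x j * grad W x j ≤ 0) : gradPlus W x j = 0 := by
  have h1 := outward_mul_gradPlus (W := W) hj
  rw [max_eq_right h] at h1
  have h2 := outward_mul_self x j
  calc gradPlus W x j = outward x j * (outward x j * gradPlus W x j) := by
        rw [← mul_assoc, h2, one_mul]
    _ = 0 := by rw [h1, mul_zero]

lemma gradPlus_eq_grad_of_active {x : Space d} {j : Fin d} (hj : IsActive x j)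
    (h : 0 ≤ outward x j * grad W x j) : gradPlus W x j = grad W x j := by
  have h1 := outward_mul_gradPlus (W := W) hj
  rw [max_eq_left h] at h1
  have h2 := outward_mul_self x j
  calc gradPlus W x j = outward x j * (outward x j * gradPlus W x j) := by
        rw [← mul_assoc, h2, one_mul]
    _ = grad W x j := by rw [h1, ← mul_assoc, h2, one_mul]

lemma gradPlus_eq_grad_of_not_active {x : Space d} {j : Fin d} (hj : ¬ IsActive x j) :
    gradPlus W x j = grad W x j := by
  unfold IsActive at hj
  push Not at hj
  rw [gradPlus_apply, if_neg hj.1, if_neg hj.2]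

lemma IsClassicalSolution.outward_mul_optDrift_nonneg (hW : IsClassicalSolution H W)
    {x : Space d} (hx : x ∈ cube d) (hx0 : x ≠ 0) {j : Fin d} (hj : IsActive x j) :
    0 ≤ outward x j * optDrift H W x j := by
  have := hW.normal_nonneg x (cubeBoundary_of_isActive hx hj) hx0 _ (stepVec_mem_normals hj)
  rwa [inner_stepVec_outward hj] at this

lemma tendsto_space {ι : Type*} {l : Filter ι} {f : ι → Space d} {v : Space d}
    (h : ∀ j, Tendsto (fun a => f a j) l (𝓝 (v j))) : Tendsto f l (𝓝 v) := by
  have h1 : Tendsto (fun a => (WithLp.ofLp (f a) : Fin d → ℝ)) l (𝓝 (WithLp.ofLp v)) :=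
    tendsto_pi_nhds.2 h
  exact ((PiLp.continuous_toLp 2 (fun _ : Fin d => ℝ)).tendsto _).comp h1

lemma continuousOn_space {S : Set (Space d)} {f : Space d → Space d}
    (h : ∀ j, ContinuousOn (fun a => f a j) S) : ContinuousOn f S :=
  fun a ha => tendsto_space fun j => h j a ha

/-- The equation holds on a face also with the gradient not modified in the normal direction. -/
lemma IsClassicalSolution.eq_zero_update (hW : IsClassicalSolution H W)
    (hH : IsRegularHamiltonian H b) {y : Space d} (hy : y ∈ cube d) (hy0 : y ≠ 0) {j : Fin d}
    (hj : IsActive y j) :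
    H y (WithLp.toLp 2 (Function.update (gradPlus W y) j (grad W y j))) = 0 := by
  -- Move inwards from the face `j` only. Coordinate `j` is then no longer truncated while the
  -- others keep their status, and the equation `H(z, ∇₊W(z)) = 0` passes to the limit.
  set z : ℝ → Space d := fun ε =>
    WithLp.toLp 2 (Function.update y j (y j - outward y j * ε)) with hz
  have hzj : ∀ ε, z ε j = y j - outward y j * ε := fun ε => by simp [hz]
  have hzl : ∀ ε l, l ≠ j → z ε l = y l := fun ε l hl => by simp [hz, hl]
  have hlim : Tendsto z (𝓝[>] 0) (𝓝 y) := by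
    refine tendsto_space fun l => ?_
    by_cases hl : l = j
    · subst hl
      simp only [hzj]
      have : Tendsto (fun ε : ℝ => y l - outward y l * ε) (𝓝 0) (𝓝 (y l - outward y l * 0)) :=
        Continuous.tendsto (by fun_prop) 0
      rw [mul_zero, sub_zero] at this
      exact this.mono_left nhdsWithin_le_nhds
    · simp only [hzl _ l hl]; exact tendsto_const_nhds
  have hIoo : Ioo (0 : ℝ) 1 ∈ 𝓝[>] (0 : ℝ) := Ioo_mem_nhdsGT one_pos
  have hzin : ∀ ε ∈ Ioo (0 : ℝ) 1, 0 < z ε j ∧ z ε j < 1 := by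
    intro ε hε
    rw [hzj]
    unfold outward
    rcases hj with h | h
    · rw [if_pos h, h]; constructor <;> linarith [hε.1, hε.2]
    · rw [if_neg (by rw [h]; exact one_ne_zero), h]; constructor <;> linarith [hε.1, hε.2]
  have hzc : ∀ ε ∈ Ioo (0 : ℝ) 1, z ε ∈ cube d := by
    intro ε hε l
    by_cases hl : l = j
    · subst hl; exact ⟨(hzin ε hε).1.le, (hzin ε hε).2.le⟩
    · rw [hzl ε l hl]; exact hy l
  have hev : ∀ᶠ ε in 𝓝[>] (0 : ℝ), z ε ∈ cube d \ {0} := by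
    filter_upwards [hIoo, hlim (isOpen_ne.mem_nhds hy0)] with ε hε hne
    exact ⟨hzc ε hε, hne⟩
  have hgrad : Tendsto (fun ε => grad W (z ε)) (𝓝[>] 0) (𝓝 (grad W y)) :=
    (continuousOn_grad hW.contDiffOn y ⟨hy, hy0⟩).tendsto.comp
      (tendsto_nhdsWithin_iff.2 ⟨hlim, hev⟩)
  have hgradl : ∀ l, Tendsto (fun ε => grad W (z ε) l) (𝓝[>] 0) (𝓝 (grad W y l)) := fun l =>
    ((continuous_coord l).tendsto _).comp hgrad
  have hplus : Tendsto (fun ε => gradPlus W (z ε)) (𝓝[>] 0)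
      (𝓝 (WithLp.toLp 2 (Function.update (gradPlus W y) j (grad W y j)))) := by
    refine tendsto_space fun l => ?_
    by_cases hl : l = j
    · subst hl
      simp only [Function.update_self]
      refine (hgradl l).congr' ?_
      filter_upwards [hIoo] with ε hε
      rw [gradPlus_apply, if_neg (hzin ε hε).1.ne', if_neg (hzin ε hε).2.ne]
    · simp only [Function.update_of_ne hl, gradPlus_apply, hzl _ l hl]
      split_ifs
      · exact (hgradl l).min tendsto_const_nhds
      · exact (hgradl l).max tendsto_const_nhds
      · exact hgradl l
  have hHlim := (hH.continuous.tendsto (y, _)).comp (hlim.prodMk_nhds hplus)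
  refine tendsto_nhds_unique hHlim (tendsto_const_nhds.congr' ?_)
  filter_upwards [hev] with ε hε
  exact (hW.eq_zero hε.1 hε.2).symm

end Outward

/-! ### Sliding faces and continuity of the modified gradient -/

section Sliding

variable {d : ℕ} {H : Space d → Space d → ℝ} {b : Space d → Space d} {W : Space d → ℝ}

/-- The active coordinates at `x` for which the modified gradient vanishes on the face
near `x`: paths slide along these faces. -/
def sliding (W : Space d → ℝ) (x : Space d) : Set (Fin d) :=
  {j | IsActive x j ∧ ∀ᶠ y in 𝓝 x, y ∈ cube d → y j = x j → outward x j * grad W y j ≤ 0}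

/-- The intersection of the faces on which paths slide near `x`. -/
def slidingFace (W : Space d → ℝ) (x : Space d) : Set (Space d) :=
  {y ∈ cube d | ∀ j ∈ sliding W x, y j = x j}

lemma tendsto_grad_slidingFace (hW : IsClassicalSolution H W) {x : Space d} (hx : x ∈ cube d)
    (hx0 : x ≠ 0) (l : Fin d) :
    Tendsto (fun y => grad W y l) (𝓝[slidingFace W x] x) (𝓝 (grad W x l)) := by
  refine ((continuous_coord l).tendsto _).comp
    ((continuousOn_grad hW.contDiffOn x ⟨hx, hx0⟩).tendsto.comp (tendsto_id.mono_right ?_))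
  refine (nhdsWithin_le_iff).2 ?_
  filter_upwards [self_mem_nhdsWithin, mem_nhdsWithin_of_mem_nhds (isOpen_ne.mem_nhds hx0)]
    with y hy hne using ⟨hy.1, hne⟩

/-- A negative outward component at `x` persists nearby by continuity, and the face would be
sliding. -/
lemma outward_grad_nonneg_of_notMem (hW : IsClassicalSolution H W) {x : Space d}
    (hx : x ∈ cube d) (hx0 : x ≠ 0) {j : Fin d} (hj : IsActive x j) (hjs : j ∉ sliding W x) :
    0 ≤ outward x j * grad W x j := by
  by_contra hneg
  rw [not_le] at hneg
  refine hjs ⟨hj, ?_⟩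
  have h1 : Tendsto (fun y => outward x j * grad W y j) (𝓝[cube d \ {0}] x)
      (𝓝 (outward x j * grad W x j)) :=
    (((continuous_coord j).tendsto _).comp
      (continuousOn_grad hW.contDiffOn x ⟨hx, hx0⟩).tendsto).const_mul _
  have h2 := h1.eventually_lt_const hneg
  rw [eventually_nhdsWithin_iff] at h2
  filter_upwards [h2, isOpen_ne.mem_nhds hx0] with y hy hne hyc _
  exact (hy ⟨hyc, hne⟩).le

lemma eventually_not_active {x : Space d} (hx : x ∈ cube d) {j : Fin d} (hj : ¬ IsActive x j) :
    ∀ᶠ y in 𝓝 x, ¬ IsActive y j := by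
  unfold IsActive at hj
  push Not at hj
  have h1 : Ioo (0 : ℝ) 1 ∈ 𝓝 (x j) := Ioo_mem_nhds (lt_of_le_of_ne (hx j).1 (Ne.symm hj.1))
    (lt_of_le_of_ne (hx j).2 hj.2)
  filter_upwards [(continuous_coord j).tendsto x h1] with y hy hact
  have hy : y j ∈ Ioo (0 : ℝ) 1 := hy
  rcases hact with h | h
  · exact hy.1.ne' h
  · exact hy.2.ne h

/-- Near `x`, an active coordinate is either the one of `x` or in the open interval. -/
lemma eventually_active_eq {x : Space d} (hx : x ∈ cube d) (j : Fin d) :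
    ∀ᶠ y in 𝓝 x, IsActive y j → IsActive x j ∧ y j = x j := by
  by_cases hj : IsActive x j
  · have h1 : Ioo (x j - 1) (x j + 1) ∈ 𝓝 (x j) := Ioo_mem_nhds (by linarith) (by linarith)
    filter_upwards [(continuous_coord j).tendsto x h1] with y hy hact
    have hy : y j ∈ Ioo (x j - 1) (x j + 1) := hy
    refine ⟨hj, ?_⟩
    rcases hact with h | h <;> rcases hj with h' | h' <;> rw [h, h'] at hy ⊢
    · exact absurd hy.1 (by norm_num)
    · exact absurd hy.2 (by norm_num)
  · filter_upwards [eventually_not_active hx hj] with y hy hact using absurd hact hy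

/-- `∇₊W` can jump only when a path leaves a face on which the truncation acts. On the sliding face
those components are held at zero, and in the other active directions the outward component of `∇W`
is nonnegative at `x`, so truncated and untruncated values have the same limit. -/
lemma tendsto_gradPlus_slidingFace (hW : IsClassicalSolution H W) {x : Space d}
    (hx : x ∈ cube d) (hx0 : x ≠ 0) :
    Tendsto (gradPlus W) (𝓝[slidingFace W x] x) (𝓝 (gradPlus W x)) := by
  refine tendsto_space fun l => ?_
  have hg := tendsto_grad_slidingFace hW hx hx0 l
  by_cases hl : l ∈ sliding W x
  · rw [gradPlus_eq_zero_of_active hl.1 (hl.2.self_of_nhds hx rfl)]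
    refine tendsto_const_nhds.congr' ?_
    filter_upwards [mem_nhdsWithin_of_mem_nhds hl.2, self_mem_nhdsWithin] with y hy hyF
    have hyl := hyF.2 l hl
    refine (gradPlus_eq_zero_of_active ((isActive_congr hyl).2 hl.1) ?_).symm
    rw [outward_congr hyl]
    exact hy hyF.1 hyl
  by_cases hact : IsActive x l
  · have h0 := outward_grad_nonneg_of_notMem hW hx hx0 hact hl
    rw [gradPlus_eq_grad_of_active hact h0]
    have h1 : Tendsto (fun y => outward x l * max (outward x l * grad W y l) 0)
        (𝓝[slidingFace W x] x) (𝓝 (grad W x l)) := by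
      have := ((hg.const_mul (outward x l)).max (tendsto_const_nhds (x := (0 : ℝ)))).const_mul
        (outward x l)
      rwa [max_eq_left h0, ← mul_assoc, outward_mul_self, one_mul] at this
    -- The sum of the two errors covers both possibilities, coordinate `l` of `y` being on its face
    -- or not.
    refine squeeze_zero_norm' (a := fun y => |grad W y l - grad W x l| +
      |outward x l * max (outward x l * grad W y l) 0 - grad W x l|) ?_ ?_ |> fun h =>
        tendsto_sub_nhds_zero_iff.1 h
    · filter_upwards [mem_nhdsWithin_of_mem_nhds (eventually_active_eq hx l)] with y hy
      rw [Real.norm_eq_abs]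
      by_cases hay : IsActive y l
      · have hyl := (hy hay).2
        have h2 : gradPlus W y l = outward x l * max (outward x l * grad W y l) 0 := by
          rw [← outward_congr hyl, ← outward_mul_gradPlus hay, ← mul_assoc, outward_mul_self,
            one_mul]
        rw [h2]
        exact le_add_of_nonneg_left (abs_nonneg _)
      · rw [gradPlus_eq_grad_of_not_active hay]
        exact le_add_of_nonneg_right (abs_nonneg _)
    · have h2 := (tendsto_sub_nhds_zero_iff.2 hg).abs.add (tendsto_sub_nhds_zero_iff.2 h1).abs
      simpa using h2
  · rw [gradPlus_eq_grad_of_not_active hact]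
    refine hg.congr' ?_
    filter_upwards [mem_nhdsWithin_of_mem_nhds (eventually_not_active hx hact)] with y hy
    exact (gradPlus_eq_grad_of_not_active hy).symm

/-- On the sliding face near `x`, the gradient points outwards in the other active directions. -/
lemma eventually_outward_grad_nonneg (hW : IsClassicalSolution H W)
    (hH : IsRegularHamiltonian H b) {x : Space d} (hx : x ∈ cube d) (hx0 : x ≠ 0) {j : Fin d}
    (hj : IsActive x j) (hjs : j ∉ sliding W x) :
    ∀ᶠ y in 𝓝[slidingFace W x] x, y j = x j → 0 ≤ outward x j * grad W y j := by
  have hg := (tendsto_grad_slidingFace hW hx hx0 j).const_mul (outward x j)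
  rcases (outward_grad_nonneg_of_notMem hW hx hx0 hj hjs).eq_or_lt with h0 | hpos
  swap
  · filter_upwards [hg.eventually_const_lt hpos] with y hy _ using hy.le
  have hb0 := hW.outward_mul_optDrift_nonneg hx hx0 hj
  -- Only a zero outward component of `∇W` at `x` is left. If the drift is tangential the sign
  -- condition decides; its nonpositive alternative would make the face sliding.
  rcases hb0.eq_or_lt with hb | hb
  · obtain ⟨U, hU, hUs⟩ := hW.sign_const x (cubeBoundary_of_isActive hx hj) hx0 _
      (stepVec_mem_normals hj) (by rw [inner_stepVec_outward hj]; exact hb.symm)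
    have hstep : ∀ y, y j = x j → stepVec (j, decide (x j = 1)) ∈ normals y := fun y hy => by
      rw [← hy]; exact stepVec_mem_normals ((isActive_congr hy).2 hj)
    rcases hUs with hneg | hnonneg
    · refine absurd ⟨hj, ?_⟩ hjs
      filter_upwards [hU] with y hyU hyc hyj
      have := hneg y ⟨hyU, cubeBoundary_of_isActive hyc ((isActive_congr hyj).2 hj)⟩ (hstep y hyj)
      rwa [inner_stepVec_outward hj] at this
    · filter_upwards [mem_nhdsWithin_of_mem_nhds hU, self_mem_nhdsWithin] with y hyU hyF hyj
      have := hnonneg y ⟨hyU, cubeBoundary_of_isActive hyF.1 ((isActive_congr hyj).2 hj)⟩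
        (hstep y hyj)
      rwa [inner_stepVec_outward hj] at this
  · have hgx : grad W x j = 0 := by
      have h1 : outward x j ≠ 0 := fun h => by
        have := outward_mul_self x j
        rw [h, mul_zero] at this
        exact zero_ne_one this
      exact (mul_eq_zero.1 h0.symm).resolve_left h1
    have hplus := tendsto_gradPlus_slidingFace hW hx hx0
    have hβ : Tendsto (fun y => gradPlus W y + EuclideanSpace.single j (grad W y j))
        (𝓝[slidingFace W x] x) (𝓝 (gradPlus W x)) := by
      have h1 : Tendsto (fun y => EuclideanSpace.single j (grad W y j) : Space d → Space d)
          (𝓝[slidingFace W x] x) (𝓝 0) := by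
        rw [tendsto_zero_iff_norm_tendsto_zero]
        simp only [PiLp.norm_single]
        have := (tendsto_grad_slidingFace hW hx hx0 j).norm
        rwa [hgx, norm_zero] at this
      have h2 := hplus.add h1
      rwa [add_zero] at h2
    have hlim : Tendsto (fun y => outward x j * gradAlpha H y
        (gradPlus W y + EuclideanSpace.single j (grad W y j)) j) (𝓝[slidingFace W x] x)
        (𝓝 (outward x j * optDrift H W x j)) := by
      refine Tendsto.const_mul _ (((continuous_coord j).tendsto _).comp ?_)
      exact (hH.continuous_grad.tendsto (x, gradPlus W x)).comp
        ((tendsto_id.mono_left nhdsWithin_le_nhds).prodMk_nhds hβ)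
    filter_upwards [hlim.eventually_const_lt hb, self_mem_nhdsWithin,
      mem_nhdsWithin_of_mem_nhds (isOpen_ne.mem_nhds hx0)] with y hyb hyF hy0 hyj
    -- With a strictly outward drift, a negative outward gradient at `y` would give two zeros of the
    -- convex function `H y`, namely `∇₊W` and `∇₊W` with its `j`-th component restored. The slope
    -- of `H y` at the second, in the direction of the first, is positive: a contradiction.
    by_contra hneg
    rw [not_le] at hneg
    have hact : IsActive y j := (isActive_congr hyj).2 hj
    have hβ0 : gradPlus W y j = 0 := gradPlus_eq_zero_of_active hact
      (by rw [outward_congr hyj]; exact hneg.le)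
    have hupd : (WithLp.toLp 2 (Function.update (gradPlus W y) j (grad W y j)) : Space d) =
        gradPlus W y + EuclideanSpace.single j (grad W y j) := by
      ext l
      by_cases hl : l = j
      · subst hl; simp [hβ0]
      · simp [hl]
    have h1 := hW.eq_zero_update hH hyF.1 hy0 hact
    rw [hupd] at h1
    have h2 := hH.subgradient y (gradPlus W y + EuclideanSpace.single j (grad W y j))
      (gradPlus W y)
    rw [h1, hW.eq_zero hyF.1 hy0, sub_add_cancel_left, inner_neg_right, inner_single_right,
      zero_add] at h2
    set g := gradAlpha H y (gradPlus W y + EuclideanSpace.single j (grad W y j)) j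
    have h3 : grad W y j * g = (outward x j * grad W y j) * (outward x j * g) := by
      have := outward_mul_self x j
      linear_combination (-(grad W y j * g)) * this
    have h4 := mul_neg_of_neg_of_pos hneg hyb
    linarith

/-- Near `x`, on the sliding face, the modified gradient is the gradient with the sliding
components removed. -/
lemma eventually_gradPlus_eq (hW : IsClassicalSolution H W) (hH : IsRegularHamiltonian H b)
    {x : Space d} (hx : x ∈ cube d) (hx0 : x ≠ 0) :
    ∀ᶠ y in 𝓝[slidingFace W x] x, ∀ l, (l ∈ sliding W x → gradPlus W y l = 0) ∧
      (l ∉ sliding W x → gradPlus W y l = grad W y l) := by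
  rw [eventually_all]
  intro l
  by_cases hl : l ∈ sliding W x
  · filter_upwards [mem_nhdsWithin_of_mem_nhds hl.2, self_mem_nhdsWithin] with y hy hyF
    have hyl := hyF.2 l hl
    refine ⟨fun _ => gradPlus_eq_zero_of_active ((isActive_congr hyl).2 hl.1) ?_,
      fun h => absurd hl h⟩
    rw [outward_congr hyl]
    exact hy hyF.1 hyl
  · by_cases hact : IsActive x l
    · filter_upwards [eventually_outward_grad_nonneg hW hH hx hx0 hact hl,
        mem_nhdsWithin_of_mem_nhds (eventually_active_eq hx l)] with y hy hy'
      refine ⟨fun h => absurd h hl, fun _ => ?_⟩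
      by_cases hay : IsActive y l
      · have hyl := (hy' hay).2
        exact gradPlus_eq_grad_of_active hay (by rw [outward_congr hyl]; exact hy hyl)
      · exact gradPlus_eq_grad_of_not_active hay
    · filter_upwards [mem_nhdsWithin_of_mem_nhds (eventually_not_active hx hact)] with y hy
      exact ⟨fun h => absurd h hl, fun _ => gradPlus_eq_grad_of_not_active hy⟩

end Sliding

/-! ### Local existence for the time-reversed equation -/

section LocalExistence

variable {d : ℕ} {H : Space d → Space d → ℝ} {b : Space d → Space d} {W : Space d → ℝ}

/-- `v` is an admissible velocity at `y` for the time-reversed equation. -/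
def IsReversedVelocity (H : Space d → Space d → ℝ) (W : Space d → ℝ) (y v : Space d) : Prop :=
  optDrift H W y + v ∈ normalCone y ∧ inner ℝ (optDrift H W y + v) (gradPlus W y) = 0

/-- `z` solves the time-reversed equation on `[0,T]`, starting from `x` and avoiding the origin. -/
structure IsReversedPath (H : Space d → Space d → ℝ) (W : Space d → ℝ) (x : Space d) (T : ℝ)
    (z : ℝ → Space d) : Prop where
  start : z 0 = x
  lipschitz : LipschitzOnWith 1 z (Icc 0 T)
  mem : ∀ t ∈ Icc 0 T, z t ∈ cube d ∧ z t ≠ 0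
  velocity : ∀ t ∈ Ico 0 T, ∃ v, HasDerivWithinAt z v (Ici t) t ∧ IsReversedVelocity H W (z t) v

lemma hasDerivWithinAt_coord {φ : ℝ → Space d} {v : Space d} {t : ℝ} {S : Set ℝ}
    (h : HasDerivWithinAt φ v S t) (j : Fin d) :
    HasDerivWithinAt (fun s => φ s j) (v j) S t :=
  ((EuclideanSpace.proj j : Space d →L[ℝ] ℝ).hasFDerivAt.comp_hasDerivWithinAt t h)

lemma norm_le_norm_of_abs_le {u v : Space d} (h : ∀ j, |u j| ≤ |v j|) : ‖u‖ ≤ ‖v‖ := by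
  rw [EuclideanSpace.norm_eq, EuclideanSpace.norm_eq]
  refine Real.sqrt_le_sqrt (Finset.sum_le_sum fun j _ => ?_)
  rw [Real.norm_eq_abs, Real.norm_eq_abs]
  exact pow_le_pow_left₀ (abs_nonneg _) (h j) 2

/-- A function that cannot increase while it is positive stays nonpositive. -/
lemma nonpos_of_right_deriv {f f' : ℝ → ℝ} {T : ℝ} (hf : ContinuousOn f (Icc 0 T))
    (hf' : ∀ t ∈ Ico 0 T, HasDerivWithinAt f (f' t) (Ici t) t) (h0 : f 0 ≤ 0)
    (h : ∀ t ∈ Ico 0 T, 0 < f t → f' t ≤ 0) : ∀ t ∈ Icc 0 T, f t ≤ 0 := by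
  intro t ht
  -- Barrier with positive slope: where `f` meets `ε (1 + t)` it is positive, hence has slope at
  -- most `0 < ε`.
  have key : ∀ ε > 0, f t ≤ ε * (1 + t) := by
    intro ε hε
    refine image_le_of_deriv_right_lt_deriv_boundary (B := fun t => ε * (1 + t))
      (B' := fun _ => ε) hf hf' ?_ ?_ ?_ ht
    · simp only [add_zero, mul_one]; linarith
    · intro s
      have := ((hasDerivAt_id s).const_add 1).const_mul ε
      simpa using this
    · intro s hs hfs
      have hpos : 0 < f s := by rw [hfs]; exact mul_pos hε (by linarith [hs.1])
      exact (h s hs hpos).trans_lt hε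
  have h1 : 0 < 1 + t := by linarith [ht.1]
  refine le_of_forall_pos_le_add fun ε hε => ?_
  have := key (ε / (1 + t)) (div_pos hε h1)
  rw [div_mul_cancel₀ _ h1.ne'] at this
  linarith

/-- The push is the normal part of the drift along the sliding directions: it points outwards by the
sign condition on the drift, and it is orthogonal to `∇₊W`, which vanishes in these directions. -/
lemma IsReversedVelocity.of_sliding (hW : IsClassicalSolution H W) {x y v : Space d}
    (hy : y ∈ slidingFace W x) (hy0 : y ≠ 0)
    (hgp : ∀ l ∈ sliding W x, gradPlus W y l = 0) (hv0 : ∀ l ∈ sliding W x, v l = 0)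
    (hv : ∀ l ∉ sliding W x, v l = -optDrift H W y l) : IsReversedVelocity H W y v := by
  refine ⟨?_, ?_⟩
  · rw [mem_normalCone_iff hy.1]
    intro l
    rw [PiLp.add_apply]
    by_cases hl : l ∈ sliding W x
    · rw [hv0 l hl, add_zero]
      have hact : IsActive y l := (isActive_congr (hy.2 l hl)).2 hl.1
      have hs := hW.outward_mul_optDrift_nonneg (H := H) hy.1 hy0 hact
      unfold outward at hs
      rcases hact with h | h
      · rw [if_pos h] at hs
        exact ⟨fun _ => by linarith, fun hpos => absurd h hpos.ne'⟩
      · rw [if_neg (by rw [h]; exact one_ne_zero), one_mul] at hs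
        exact ⟨fun hlt => absurd h hlt.ne, fun _ => hs⟩
    · rw [hv l hl, add_neg_cancel]
      exact ⟨fun _ => le_rfl, fun _ => le_rfl⟩
  · rw [inner_eq_sum]
    refine Finset.sum_eq_zero fun l _ => ?_
    by_cases hl : l ∈ sliding W x
    · rw [hgp l hl, mul_zero]
    · rw [PiLp.add_apply, hv l hl, add_neg_cancel, zero_mul]

open Classical in
-- Freeze the sliding coordinates and follow the reversed drift in the others. In a small box of the
-- sliding face this field is continuous, and it points inwards on the remaining faces, so the Peano
-- solution does not leave the cube.
theorem exists_local_reversedPath (hW : IsClassicalSolution H W) (hH : IsRegularHamiltonian H b)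
    {x : Space d} (hx : x ∈ cube d) (hx0 : x ≠ 0) :
    ∃ T > 0, ∃ z, IsReversedPath H W x T z := by
  set A := sliding W x with hA
  -- a neighbourhood on which everything is controlled
  have hev : ∀ᶠ y in 𝓝 x, (y ∈ slidingFace W x → ∀ l, (l ∈ A → gradPlus W y l = 0) ∧
      (l ∉ A → gradPlus W y l = grad W y l)) ∧ y ≠ 0 :=
    (eventually_nhdsWithin_iff.1 (eventually_gradPlus_eq hW hH hx hx0)).and
      (isOpen_ne.mem_nhds hx0)
  obtain ⟨r, hr, hball⟩ := Metric.eventually_nhds_iff.1 hev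
  -- `d ρ < r` places the box in the controlled ball, `ρ ≤ 1` keeps a coordinate that starts on one
  -- face from passing the opposite one, and the last condition keeps inactive coordinates in `[0,
  -- 1]`.
  have hρ : ∃ ρ > 0, ρ ≤ 1 ∧ d * ρ < r ∧ ∀ l, ¬ IsActive x l → ρ ≤ x l ∧ ρ ≤ 1 - x l := by
    have h1 : ∀ l, ∀ᶠ ρ in 𝓝[>] (0 : ℝ), ¬ IsActive x l → ρ ≤ x l ∧ ρ ≤ 1 - x l := by
      intro l
      by_cases hl : IsActive x l
      · exact Eventually.of_forall fun _ h => absurd hl h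
      · have hl' := hl
        unfold IsActive at hl'
        push Not at hl'
        have e1 : 0 < x l := lt_of_le_of_ne (hx l).1 (Ne.symm hl'.1)
        have e2 : 0 < 1 - x l := sub_pos.2 (lt_of_le_of_ne (hx l).2 hl'.2)
        filter_upwards [Ioo_mem_nhdsGT e1, Ioo_mem_nhdsGT e2] with ρ h1 h2 _
        exact ⟨h1.2.le, h2.2.le⟩
    have h2 : ∀ᶠ ρ in 𝓝[>] (0 : ℝ), d * ρ < r := by
      have : Tendsto (fun ρ : ℝ => d * ρ) (𝓝[>] 0) (𝓝 (d * 0)) :=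
        (Continuous.tendsto (by fun_prop) 0).mono_left nhdsWithin_le_nhds
      rw [mul_zero] at this
      exact this.eventually_lt_const hr
    obtain ⟨ρ, ⟨h3, h4⟩, h6⟩ := (((eventually_all.2 h1).and h2).and
      (Ioo_mem_nhdsGT one_pos)).exists
    exact ⟨ρ, h6.1, h6.2.le, h4, h3⟩
  obtain ⟨ρ, hρ0, hρ1, hρr, hρx⟩ := hρ
  set lo : Fin d → ℝ := fun l => if l ∈ A then x l else max 0 (x l - ρ) with hlo
  set hi : Fin d → ℝ := fun l => if l ∈ A then x l else min 1 (x l + ρ) with hhi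
  have hlox : ∀ l, lo l ≤ x l := fun l => by
    simp only [hlo]; split_ifs
    · exact le_rfl
    · exact max_le (hx l).1 (by linarith)
  have hxhi : ∀ l, x l ≤ hi l := fun l => by
    simp only [hhi]; split_ifs
    · exact le_rfl
    · exact le_min (hx l).2 (by linarith)
  set box : Set (Space d) := {y | ∀ l, lo l ≤ y l ∧ y l ≤ hi l} with hbox
  have hbox_face : ∀ y ∈ box, y ∈ slidingFace W x := by
    intro y hy
    refine ⟨fun l => ?_, fun l hl => ?_⟩
    · have h1 := hy l
      simp only [hlo, hhi] at h1
      split_ifs at h1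
      · rw [le_antisymm h1.2 h1.1]; exact hx l
      · exact ⟨(le_max_left _ _).trans h1.1, h1.2.trans (min_le_left _ _)⟩
    · have h1 := hy l
      simp only [hlo, hhi, if_pos (show l ∈ A from hl)] at h1
      exact le_antisymm h1.2 h1.1
  have hbox_dist : ∀ y ∈ box, dist y x < r := by
    intro y hy
    rw [dist_eq_norm]
    refine (norm_le_sum_abs _).trans_lt (lt_of_le_of_lt ?_ hρr)
    calc ∑ l, |(y - x) l| ≤ ∑ _l : Fin d, ρ := Finset.sum_le_sum fun l _ => by
          have h1 := hy l
          rw [PiLp.sub_apply, abs_le]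
          simp only [hlo, hhi] at h1
          split_ifs at h1
          · constructor <;> linarith
          · have h2 := (le_max_right 0 (x l - ρ)).trans h1.1
            have h3 := h1.2.trans (min_le_right 1 (x l + ρ))
            constructor <;> linarith
      _ = d * ρ := by simp
  have hbox0 : ∀ y ∈ box, y ≠ 0 := fun y hy => (hball (hbox_dist y hy)).2
  have hbox_gp : ∀ y ∈ box, ∀ l, (l ∈ A → gradPlus W y l = 0) ∧
      (l ∉ A → gradPlus W y l = grad W y l) := fun y hy =>
    (hball (hbox_dist y hy)).1 (hbox_face y hy)
  have hbox_compact : IsCompact box := by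
    have hcl : IsClosed box := by
      have : box = ⋂ l, {y : Space d | lo l ≤ y l ∧ y l ≤ hi l} := by
        ext y; simp [hbox]
      rw [this]
      exact isClosed_iInter fun l => (isClosed_le continuous_const (continuous_coord l)).inter
        (isClosed_le (continuous_coord l) continuous_const)
    exact (isCompact_cube d).of_isClosed_subset hcl fun y hy => (hbox_face y hy).1
  have hgp_cont : ContinuousOn (gradPlus W) box := by
    refine continuousOn_space fun l => ?_
    by_cases hl : l ∈ A
    · exact continuousOn_const.congr fun y hy => (hbox_gp y hy l).1 hl
    · refine ContinuousOn.congr ?_ fun y hy => (hbox_gp y hy l).2 hl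
      exact (continuous_coord l).comp_continuousOn ((continuousOn_grad hW.contDiffOn).mono
        fun y hy => ⟨(hbox_face y hy).1, hbox0 y hy⟩)
  have hdrift_cont : ContinuousOn (optDrift H W) box :=
    hH.continuous_grad.comp_continuousOn (continuousOn_id.prodMk hgp_cont)
  -- the vector field, extended by clamping
  set clamp : Space d → Space d := fun z =>
    WithLp.toLp 2 fun l => max (lo l) (min (hi l) (z l)) with hclamp
  have hclamp_box : ∀ z, clamp z ∈ box := fun z l =>
    ⟨le_max_left _ _, max_le ((hlox l).trans (hxhi l)) (min_le_left _ _)⟩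
  have hclamp_lip : ∀ y z, ‖clamp y - clamp z‖ ≤ ‖y - z‖ := fun y z => by
    refine norm_le_norm_of_abs_le fun l => ?_
    simp only [hclamp, PiLp.sub_apply]
    refine (abs_max_sub_max_le_max _ _ _ _).trans ?_
    rw [sub_self, abs_zero, max_eq_right (abs_nonneg _)]
    refine (abs_min_sub_min_le_max _ _ _ _).trans ?_
    rw [sub_self, abs_zero, max_eq_right (abs_nonneg _)]
  set g : Space d → Space d := fun y =>
    WithLp.toLp 2 fun l => if l ∈ A then 0 else -optDrift H W y l with hg
  have hg_cont : ContinuousOn g box := by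
    refine continuousOn_space fun l => ?_
    by_cases hl : l ∈ A
    · simp only [hg, if_pos hl]; exact continuousOn_const
    · simp only [hg, if_neg hl]
      exact ((continuous_coord l).comp_continuousOn hdrift_cont).neg
  have hF : UniformContinuous fun z => g (clamp z) := by
    have h1 := hbox_compact.uniformContinuousOn_of_continuous hg_cont
    rw [Metric.uniformContinuous_iff]
    rw [Metric.uniformContinuousOn_iff] at h1
    intro ε hε
    obtain ⟨δ, hδ, h2⟩ := h1 ε hε
    refine ⟨δ, hδ, fun {y z} hyz => h2 _ (hclamp_box y) _ (hclamp_box z) ?_⟩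
    rw [dist_eq_norm] at hyz ⊢
    exact (hclamp_lip y z).trans_lt hyz
  have hF1 : ∀ z, ‖g (clamp z)‖ ≤ 1 := fun z => by
    refine (norm_le_norm_of_abs_le (v := optDrift H W (clamp z)) fun l => ?_).trans
      (hH.norm_grad_le _ _)
    simp only [hg]
    split_ifs
    · simp
    · rw [abs_neg]
  obtain ⟨z, hz0, hzl, hzd⟩ := exists_peano hF hF1 x
  have hlip : LipschitzOnWith 1 z (Ici 0) := by
    refine LipschitzOnWith.of_dist_le_mul fun s hs t ht => ?_
    rw [NNReal.coe_one, one_mul]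
    rcases le_total s t with h | h
    · rw [dist_comm, dist_eq_norm, dist_comm, Real.dist_eq, abs_of_nonneg (sub_nonneg.2 h)]
      exact hzl s t hs h
    · rw [dist_eq_norm, Real.dist_eq, abs_of_nonneg (sub_nonneg.2 h)]
      exact hzl t s ht h
  have hzc : ContinuousOn z (Icc 0 ρ) := (hlip.mono Icc_subset_Ici_self).continuousOn
  have hzlc : ∀ l, ContinuousOn (fun t => z t l) (Icc 0 ρ) := fun l =>
    (continuous_coord l).comp_continuousOn hzc
  have hnear : ∀ t ∈ Icc 0 ρ, ∀ l, |z t l - x l| ≤ ρ := by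
    intro t ht l
    have h1 := hzl 0 t le_rfl ht.1
    rw [hz0, sub_zero] at h1
    have h2 := abs_coord_le_norm (z t - x) l
    rw [PiLp.sub_apply] at h2
    linarith [ht.2]
  have hzA : ∀ t ∈ Icc 0 ρ, ∀ l ∈ A, z t l = x l := by
    intro t ht l hl
    have h1 : ∀ s ∈ Ico (0 : ℝ) ρ, HasDerivWithinAt (fun t => z t l) 0 (Ici s) s := by
      intro s hs
      have := hasDerivWithinAt_coord (hzd s hs.1) l
      simpa only [hg, if_pos hl] using this
    have := constant_of_has_deriv_right_zero (hzlc l) h1 t ht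
    rw [this, hz0]
  -- Outside the cube in direction `l`, the clamped point lies on the face, where the reversed drift
  -- does not point outwards; hence the excursion can never begin.
  have hzout : ∀ t ∈ Icc 0 ρ, ∀ l ∉ A, IsActive x l → outward x l * (z t l - x l) ≤ 0 := by
    intro t ht l hl hact
    refine nonpos_of_right_deriv (T := ρ) (f := fun t => outward x l * (z t l - x l))
      (f' := fun t => outward x l * g (clamp (z t)) l)
      (((hzlc l).sub continuousOn_const).const_mul _ |>.congr fun _ _ => rfl) ?_ ?_ ?_ t ht
    · intro s hs
      exact ((hasDerivWithinAt_coord (hzd s hs.1) l).sub_const (x l)).const_mul _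
    · rw [hz0, sub_self, mul_zero]
    · intro s hs hpos
      have hcl : clamp (z s) l = x l := by
        simp only [hclamp, hlo, hhi, if_neg hl]
        unfold outward at hpos
        rcases hact with h | h
        · rw [if_pos h, h] at hpos
          rw [h, max_eq_left (by linarith : (0 : ℝ) - ρ ≤ 0)]
          exact max_eq_left ((min_le_right _ _).trans (by linarith))
        · rw [if_neg (by rw [h]; exact one_ne_zero), h, one_mul] at hpos
          rw [h, min_eq_left (by linarith : (1 : ℝ) ≤ 1 + ρ), min_eq_left (by linarith),
            max_eq_right (max_le zero_le_one (by linarith))]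
      have hact' : IsActive (clamp (z s)) l := (isActive_congr hcl).2 hact
      have h1 := hW.outward_mul_optDrift_nonneg (H := H) (hbox_face _ (hclamp_box (z s))).1
        (hbox0 _ (hclamp_box (z s))) hact'
      rw [outward_congr hcl] at h1
      simp only [hg, if_neg hl]
      linarith
  have hzbox : ∀ t ∈ Icc 0 ρ, z t ∈ box := by
    intro t ht l
    by_cases hl : l ∈ A
    · simp only [hlo, hhi, if_pos hl, hzA t ht l hl, le_refl, and_self]
    · simp only [hlo, hhi, if_neg hl]
      have h1 := abs_le.1 (hnear t ht l)
      have h2 : 0 ≤ z t l ∧ z t l ≤ 1 := by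
        by_cases hact : IsActive x l
        · have h3 := hzout t ht l hl hact
          unfold outward at h3
          rcases hact with h | h
          · rw [if_pos h] at h3
            rw [h] at h1 h3
            constructor <;> linarith
          · rw [if_neg (by rw [h]; exact one_ne_zero)] at h3
            rw [h] at h1 h3
            constructor <;> linarith
        · have h3 := hρx l hact
          constructor <;> linarith
      exact ⟨max_le h2.1 (by linarith), le_min h2.2 (by linarith)⟩
  have hclamp_eq : ∀ t ∈ Icc 0 ρ, clamp (z t) = z t := by
    intro t ht
    ext l
    have h1 := hzbox t ht l
    simp only [hclamp]
    rw [min_eq_right h1.2, max_eq_right h1.1]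
  refine ⟨ρ, hρ0, z, hz0, hlip.mono Icc_subset_Ici_self, fun t ht =>
    ⟨(hbox_face _ (hzbox t ht)).1, hbox0 _ (hzbox t ht)⟩, fun t ht => ⟨g (z t), ?_, ?_⟩⟩
  · have := hzd t ht.1
    rwa [hclamp_eq t (Ico_subset_Icc_self ht)] at this
  · have hb := hzbox t (Ico_subset_Icc_self ht)
    refine IsReversedVelocity.of_sliding hW (hbox_face _ hb) (hbox0 _ hb)
      (fun l hl => (hbox_gp _ hb l).1 hl) (fun l hl => ?_) (fun l hl => ?_)
    · simp only [hg]; exact if_pos hl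
    · simp only [hg]; exact if_neg hl

end LocalExistence

/-! ### Extension of reversed solutions up to the origin -/

section GlobalExistence

variable {d : ℕ} {H : Space d → Space d → ℝ} {b : Space d → Space d} {W : Space d → ℝ}

/-- A Lipschitz path in the cube which solves the time-reversed equation, away from the origin,
before the time `life`. -/
structure PartialReversedPath (H : Space d → Space d → ℝ) (W : Space d → ℝ) (x : Space d) where
  life : EReal
  path : ℝ → Space d
  life_nonneg : 0 ≤ life
  start : path 0 = x
  lipschitz : LipschitzOnWith 1 path (Ici 0)
  mem : ∀ t, 0 ≤ t → path t ∈ cube d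
  velocity : ∀ t : ℝ, 0 ≤ t → (t : EReal) < life → path t ≠ 0 ∧
    ∃ v, HasDerivWithinAt path v (Ici t) t ∧ IsReversedVelocity H W (path t) v

/-- Extension order. Agreement is required only strictly before the shorter life, since after it the
equation does not constrain the path. -/
instance (x : Space d) : Preorder (PartialReversedPath H W x) where
  le y z := y.life ≤ z.life ∧ ∀ t : ℝ, 0 ≤ t → (t : EReal) < y.life → z.path t = y.path t
  le_refl _ := ⟨le_rfl, fun _ _ _ => rfl⟩
  le_trans _ _ _ h h' := ⟨h.1.trans h'.1, fun t ht htl =>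
    (h'.2 t ht (htl.trans_le h.1)).trans (h.2 t ht htl)⟩

lemma isClosed_cube (d : ℕ) : IsClosed (cube d) := (isCompact_cube d).isClosed

lemma PartialReversedPath.eventually_eq {f g : ℝ → Space d} {i : EReal} {t : ℝ} (ht : 0 ≤ t)
    (hti : (t : EReal) < i) (h : ∀ s : ℝ, 0 ≤ s → (s : EReal) < i → f s = g s) :
    f =ᶠ[𝓝[Ici t] t] g := by
  have h1 : ∀ᶠ s : ℝ in 𝓝 t, (s : EReal) < i :=
    (continuous_coe_real_ereal.tendsto t).eventually_lt_const hti
  filter_upwards [nhdsWithin_le_nhds h1, self_mem_nhdsWithin] with s hs hs'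
  exact h s (ht.trans hs') hs

/-- Take pointwise limits along an ultrafilter on the chain: at times before some life the values
are eventually constant, and at later times compactness of the cube gives a limit. The Lipschitz
bound survives, so the limit is defined for all times, including the supremum of the lives. -/
lemma PartialReversedPath.exists_upperBound {x : Space d} (c : Set (PartialReversedPath H W x))
    (hc : IsChain (· ≤ ·) c) (hne : c.Nonempty) : BddAbove c := by
  have hnec : Nonempty c := hne.to_subtype
  have hdir : IsDirected c (· ≤ ·) := ⟨fun y z => by
    obtain ⟨w, hw, h1, h2⟩ := hc.directedOn y y.2 z z.2
    exact ⟨⟨w, hw⟩, h1, h2⟩⟩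
  set F : Ultrafilter c := Ultrafilter.of atTop
  have hF : (F : Filter c) ≤ atTop := Ultrafilter.of_le atTop
  have hlim : ∀ t : ℝ, ∃ p, 0 ≤ t → p ∈ cube d ∧
      Tendsto (fun y : c => y.1.path t) (F : Filter c) (𝓝 p) := by
    intro t
    by_cases ht : 0 ≤ t
    · obtain ⟨p, hp, h⟩ := (isCompact_cube d).ultrafilter_le_nhds (F.map fun y : c => y.1.path t)
        (tendsto_principal.2 (Eventually.of_forall fun y : c => y.1.mem t ht) :
          Tendsto (fun y : c => y.1.path t) (F : Filter c) (𝓟 (cube d)))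
      exact ⟨p, fun _ => ⟨hp, h⟩⟩
    · exact ⟨0, fun h => absurd h ht⟩
  choose q hq using hlim
  have heq : ∀ y ∈ c, ∀ t : ℝ, 0 ≤ t → (t : EReal) < y.life → q t = y.path t := by
    intro y hy t ht htl
    refine tendsto_nhds_unique (hq t ht).2 (tendsto_const_nhds.congr' ?_)
    filter_upwards [hF (eventually_ge_atTop (⟨y, hy⟩ : c))] with z hz
    exact (hz.2 t ht htl).symm
  refine ⟨⟨⨆ y : c, y.1.life, q, ?_, ?_, ?_, fun t ht => (hq t ht).1, ?_⟩, fun y hy =>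
    ⟨le_iSup (fun y : c => y.1.life) ⟨y, hy⟩, heq y hy⟩⟩
  · obtain ⟨y, hy⟩ := hne
    exact y.life_nonneg.trans (le_iSup (fun y : c => y.1.life) ⟨y, hy⟩)
  · refine tendsto_nhds_unique (hq 0 le_rfl).2 (tendsto_const_nhds.congr fun y => ?_)
    exact y.1.start.symm
  · refine LipschitzOnWith.of_dist_le_mul fun s hs t ht => ?_
    refine le_of_tendsto ((hq s hs).2.dist (hq t ht).2) (Eventually.of_forall fun y => ?_)
    exact y.1.lipschitz.dist_le_mul s hs t ht
  · intro t ht htl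
    obtain ⟨y, hy⟩ := lt_iSup_iff.1 htl
    obtain ⟨h0, v, hv, hv'⟩ := y.1.velocity t ht hy
    have h1 := heq y.1 y.2 t ht hy
    rw [h1]
    exact ⟨h0, v, hv.congr_of_eventuallyEq (eventually_eq ht hy (heq y.1 y.2)) h1, hv'⟩

lemma lipschitzOnWith_Ici_of_le {f : ℝ → Space d} {K : NNReal}
    (h : ∀ s t, 0 ≤ s → s ≤ t → ‖f t - f s‖ ≤ K * (t - s)) : LipschitzOnWith K f (Ici 0) := by
  refine LipschitzOnWith.of_dist_le_mul fun s hs t ht => ?_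
  rcases le_total s t with h' | h'
  · rw [dist_comm, dist_eq_norm, dist_comm, Real.dist_eq, abs_of_nonneg (sub_nonneg.2 h')]
    exact h s t hs h'
  · rw [dist_eq_norm, Real.dist_eq, abs_of_nonneg (sub_nonneg.2 h')]
    exact h t s ht h'

/-- Concatenation at time `T` with a local solution from the end point, frozen after its own
duration. -/
lemma PartialReversedPath.exists_lt {x : Space d} (hW : IsClassicalSolution H W)
    (hH : IsRegularHamiltonian H b) (y : PartialReversedPath H W x) {T : ℝ}
    (hT : y.life = (T : EReal)) (h0 : y.path T ≠ 0) : ∃ z, y ≤ z ∧ y.life < z.life := by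
  have hT0 : 0 ≤ T := by
    have := y.life_nonneg
    rw [hT] at this
    exact_mod_cast this
  obtain ⟨δ, hδ, z, hz⟩ := exists_local_reversedPath hW hH (y.mem T hT0) h0
  set w : ℝ → Space d := fun t => if t < T then y.path t else z (min (t - T) δ) with hw
  have hw1 : ∀ t < T, w t = y.path t := fun t ht => if_pos ht
  have hw2 : ∀ t, T ≤ t → w t = z (min (t - T) δ) := fun t ht => if_neg (not_lt.2 ht)
  have hmin : ∀ t, T ≤ t → min (t - T) δ ∈ Icc 0 δ := fun t ht =>
    ⟨le_min (sub_nonneg.2 ht) hδ.le, min_le_right _ _⟩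
  have hwT : w T = y.path T := by
    rw [hw2 T le_rfl, sub_self, min_eq_left hδ.le, hz.start]
  have hlip1 : ∀ s t, 0 ≤ s → s ≤ t → t ≤ T → ‖w t - w s‖ ≤ t - s := by
    intro s t hs hst ht
    have e : ∀ r ≤ T, w r = y.path r := fun r hr => hr.lt_or_eq.elim (hw1 r) fun h => by
      rw [h, hwT]
    rw [e t ht, e s (hst.trans ht)]
    have := y.lipschitz.dist_le_mul t (hs.trans hst) s hs
    rwa [NNReal.coe_one, one_mul, dist_eq_norm, Real.dist_eq, abs_of_nonneg (sub_nonneg.2 hst)]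
      at this
  have hlip2 : ∀ s t, T ≤ s → s ≤ t → ‖w t - w s‖ ≤ t - s := by
    intro s t hs hst
    rw [hw2 t (hs.trans hst), hw2 s hs]
    have h1 := hz.lipschitz.dist_le_mul _ (hmin t (hs.trans hst)) _ (hmin s hs)
    rw [NNReal.coe_one, one_mul, dist_eq_norm, Real.dist_eq] at h1
    refine h1.trans ((abs_min_sub_min_le_max _ _ _ _).trans ?_)
    rw [sub_self, abs_zero, max_eq_left (abs_nonneg _), sub_sub_sub_cancel_right,
      abs_of_nonneg (sub_nonneg.2 hst)]
  have hlife : y.life < ((T + δ : ℝ) : EReal) := by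
    rw [hT]; exact_mod_cast (by linarith : T < T + δ)
  refine ⟨⟨((T + δ : ℝ) : EReal), w, ?_, ?_, ?_, ?_, ?_⟩, ⟨hlife.le, fun t _ htl => ?_⟩, hlife⟩
  · exact_mod_cast (by linarith : 0 ≤ T + δ)
  · rcases hT0.lt_or_eq with h | h
    · rw [hw1 0 h, y.start]
    · rw [← h] at hwT
      rw [hwT, y.start]
  · refine lipschitzOnWith_Ici_of_le fun s t hs hst => ?_
    rw [NNReal.coe_one, one_mul]
    rcases le_total t T with ht | ht
    · exact hlip1 s t hs hst ht
    · rcases le_total s T with hs' | hs'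
      · have h1 := hlip1 s T hs hs' le_rfl
        have h2 := hlip2 T t le_rfl ht
        have h3 := norm_add_le (w t - w T) (w T - w s)
        rw [sub_add_sub_cancel] at h3
        linarith
      · exact hlip2 s t hs' hst
  · intro t ht
    rcases lt_or_ge t T with h | h
    · rw [hw1 t h]; exact y.mem t ht
    · rw [hw2 t h]; exact (hz.mem _ (hmin t h)).1
  · intro t ht htl
    have htl' : t < T + δ := by exact_mod_cast htl
    rcases lt_or_ge t T with h | h
    · have h' : (t : EReal) < y.life := by rw [hT]; exact_mod_cast h
      obtain ⟨e0, v, hv, hv'⟩ := y.velocity t ht h'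
      rw [hw1 t h]
      refine ⟨e0, v, hv.congr_of_eventuallyEq (eventually_eq ht h' fun s _ hs => hw1 s ?_)
        (hw1 t h), hv'⟩
      rw [hT] at hs
      exact_mod_cast hs
    · have ht' : t - T ∈ Ico 0 δ := ⟨sub_nonneg.2 h, by linarith⟩
      have e : w t = z (t - T) := by rw [hw2 t h, min_eq_left ht'.2.le]
      obtain ⟨v, hv, hv'⟩ := hz.velocity _ ht'
      rw [e]
      refine ⟨(hz.mem _ (Ico_subset_Icc_self ht')).2, v, ?_, hv'⟩
      have h1 : HasDerivWithinAt (fun s => z (s - T)) v (Ici t) t := by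
        have h2 : HasDerivWithinAt (fun s : ℝ => s - T) 1 (Ici t) t :=
          ((hasDerivAt_id t).sub_const T).hasDerivWithinAt
        have := HasDerivWithinAt.scomp (t' := Ici (t - T)) t hv h2 fun s hs => by
          simp only [mem_Ici] at hs ⊢; linarith
        simpa [Function.comp_def] using this
      refine h1.congr_of_eventuallyEq ?_ e
      filter_upwards [nhdsWithin_le_nhds (Iio_mem_nhds htl'), self_mem_nhdsWithin] with s hs hs'
      rw [hw2 s (h.trans hs'), min_eq_left]
      simp only [mem_Iio] at hs
      linarith
  · refine hw1 t ?_
    rw [hT] at htl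
    exact_mod_cast htl

/-- The time-reversed equation has a solution up to the time when it reaches the origin. -/
theorem exists_reversedPath (hW : IsClassicalSolution H W) (hH : IsRegularHamiltonian H b)
    {x : Space d} (hx : x ∈ cube d) (hx0 : x ≠ 0) :
    ∃ y : PartialReversedPath H W x, 0 < y.life ∧
      ∀ t : ℝ, 0 ≤ t → y.life ≤ (t : EReal) → y.path t = 0 := by
  -- The constant path with life zero, for which the equation is void.
  have : Nonempty (PartialReversedPath H W x) := ⟨⟨0, fun _ => x, le_rfl, rfl,
    (LipschitzWith.const' x).lipschitzOnWith, fun _ _ => hx, fun t ht htl =>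
    absurd htl (not_lt.2 (by exact_mod_cast ht))⟩⟩
  obtain ⟨y, hy⟩ := zorn_le_nonempty
    (PartialReversedPath.exists_upperBound (H := H) (W := W) (x := x))
  by_cases htop : y.life = ⊤
  · refine ⟨y, htop ▸ EReal.zero_lt_top, fun t _ ht => ?_⟩
    rw [htop, top_le_iff] at ht
    exact absurd ht (EReal.coe_ne_top t)
  have hbot : y.life ≠ ⊥ := (EReal.bot_lt_zero.trans_le y.life_nonneg).ne'
  obtain ⟨T, hT⟩ : ∃ T : ℝ, y.life = (T : EReal) := ⟨_, (EReal.coe_toReal htop hbot).symm⟩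
  have hT0 : 0 ≤ T := by
    have := y.life_nonneg
    rw [hT] at this
    exact_mod_cast this
  have hend : y.path T = 0 := by
    by_contra h0
    obtain ⟨z, hyz, hlt⟩ := y.exists_lt hW hH hT h0
    exact absurd (hy hyz).1 (not_le.2 hlt)
  have hTpos : 0 < T := hT0.lt_of_ne fun h => hx0 <| by rw [← y.start, h, hend]
  have hle : ∀ t : ℝ, (t : EReal) < y.life → min t T = t := fun t ht => by
    rw [hT] at ht
    exact min_eq_left (by exact_mod_cast ht.le)
  -- Beyond its life a maximal path is arbitrary; it is stopped at the origin.
  refine ⟨⟨y.life, fun t => y.path (min t T), y.life_nonneg, ?_, ?_, ?_, ?_⟩, ?_, ?_⟩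
  · simp only [min_eq_left hT0, y.start]
  · refine lipschitzOnWith_Ici_of_le fun s t hs hst => ?_
    have := y.lipschitz.dist_le_mul _ (le_min (hs.trans hst) hT0 : 0 ≤ min t T) _
      (le_min hs hT0 : 0 ≤ min s T)
    rw [dist_eq_norm, Real.dist_eq] at this
    refine this.trans (mul_le_mul_of_nonneg_left ?_ (NNReal.coe_nonneg _))
    refine (abs_min_sub_min_le_max _ _ _ _).trans ?_
    rw [sub_self, abs_zero, max_eq_left (abs_nonneg _), abs_of_nonneg (sub_nonneg.2 hst)]
  · exact fun t ht => y.mem _ (le_min ht hT0)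
  · intro t ht htl
    obtain ⟨e0, v, hv, hv'⟩ := y.velocity t ht htl
    simp only [hle t htl]
    refine ⟨e0, v, hv.congr_of_eventuallyEq (PartialReversedPath.eventually_eq ht htl
      fun s _ hs => by rw [hle s hs]) (by rw [hle t htl]), hv'⟩
  · simp only [hT]
    exact_mod_cast hTpos
  · intro t _ htl
    simp only [hT] at htl
    have : T ≤ t := by exact_mod_cast htl
    simp only [min_eq_right this, hend]

end GlobalExistence

/-! ### Existence of backward reflected paths -/

section BackwardPath

variable {d : ℕ} {H : Space d → Space d → ℝ} {b : Space d → Space d} {W : Space d → ℝ}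

lemma measurable_space {α : Type*} [MeasurableSpace α] {f : α → Space d}
    (h : ∀ j, Measurable fun a => f a j) : Measurable f :=
  (PiLp.continuous_toLp 2 _).measurable.comp (measurable_pi_lambda (fun a j => f a j) h)

open Classical in
-- At the origin and off the cube nothing is known about `∇₊W`; a measurable version is needed to
-- integrate the velocity of the push.
lemma exists_measurable_gradPlus (hW : ContDiffOn ℝ 1 W (cube d \ {0})) :
    ∃ G : Space d → Space d, Measurable G ∧ ∀ y ∈ cube d, y ≠ 0 → G y = gradPlus W y := by
  set g : Space d → Space d := (cube d \ {0}).piecewise (grad W) 0 with hg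
  have hgm : Measurable g := ContinuousOn.measurable_piecewise (continuousOn_grad hW)
    continuousOn_const ((isClosed_cube d).measurableSet.diff (measurableSet_singleton 0))
  have hgj : ∀ j, Measurable fun y => g y j := fun j => (continuous_coord j).measurable.comp hgm
  have hset : ∀ (j : Fin d) (c : ℝ), MeasurableSet {y : Space d | y j = c} := fun j c =>
    (continuous_coord j).measurable (measurableSet_singleton c)
  refine ⟨fun y => WithLp.toLp 2 fun j => if y j = 0 then min (g y j) 0
    else if y j = 1 then max (g y j) 0 else g y j, measurable_space fun j => ?_, fun y hy hy0 => ?_⟩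
  · exact Measurable.ite (hset j 0) ((hgj j).min measurable_const)
      (Measurable.ite (hset j 1) ((hgj j).max measurable_const) (hgj j))
  · have : g y = grad W y := piecewise_eq_of_mem _ _ _ ⟨hy, hy0⟩
    simp only [this, gradPlus]

lemma exists_measurable_optDrift (hW : ContDiffOn ℝ 1 W (cube d \ {0}))
    (hH : IsRegularHamiltonian H b) :
    ∃ G : Space d → Space d, Measurable G ∧ (∀ y, ‖G y‖ ≤ 1) ∧
      ∀ y ∈ cube d, y ≠ 0 → G y = optDrift H W y := by
  obtain ⟨G, hG, hG'⟩ := exists_measurable_gradPlus hW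
  refine ⟨fun y => gradAlpha H y (G y), hH.continuous_grad.measurable.comp
    (measurable_id.prodMk hG), fun y => hH.norm_grad_le _ _, fun y hy hy0 => ?_⟩
  simp only [hG' y hy hy0, optDrift]

/-- Backward reflected paths exist; they can be chosen Lipschitz, with a Lipschitz push. -/
theorem exists_backwardReflectedPath (hW : IsClassicalSolution H W)
    (hH : IsRegularHamiltonian H b) {x : Space d} (hx : x ∈ cube d) (hx0 : x ≠ 0) :
    ∃ (φ k : ℝ → Space d) (i : EReal), IsBackwardReflectedPath H W x φ k i ∧
      LipschitzOnWith 1 φ (Iic 0) ∧ LipschitzWith 2 k := by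
  obtain ⟨y, hlife, hzero⟩ := exists_reversedPath hW hH hx hx0
  obtain ⟨G, hGm, hG1, hG⟩ := exists_measurable_optDrift hW.contDiffOn hH
  set φ : ℝ → Space d := fun t => y.path (-t) with hφ
  have hlip : LipschitzOnWith 1 φ (Iic 0) := by
    refine LipschitzOnWith.of_dist_le_mul fun s hs t ht => ?_
    have := y.lipschitz.dist_le_mul (-s) (mem_Ici.2 (neg_nonneg.2 hs)) (-t)
      (mem_Ici.2 (neg_nonneg.2 ht))
    rwa [dist_neg_neg] at this
  have hφc : Continuous fun t => φ (min t 0) :=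
    hlip.continuousOn.comp_continuous (by fun_prop) fun t => mem_Iic.2 (min_le_right _ _)
  have hlt : ∀ t : ℝ, -y.life < (t : EReal) ↔ ((-t : ℝ) : EReal) < y.life := fun t => by
    rw [EReal.neg_lt_comm, EReal.coe_neg]
  have hderiv : ∀ t < 0, ‖deriv φ t‖ ≤ 1 := fun t ht => by
    refine norm_deriv_le_of_lip' zero_le_one ?_
    filter_upwards [Iio_mem_nhds ht] with s hs
    simpa [dist_eq_norm] using hlip.dist_le_mul s (mem_Iic.2 (le_of_lt hs)) t ht.le
  set S : Set ℝ := {t : ℝ | -y.life < (t : EReal)} ∩ Iio 0 with hS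
  have hSm : MeasurableSet S :=
    (measurableSet_lt measurable_const measurable_coe_real_ereal).inter measurableSet_Iio
  -- Velocity of the push, optimal drift minus `φ'`, cut off outside the life. Both terms have norm
  -- at most one there, so its primitive `k` is `2`-Lipschitz.
  set κ : ℝ → Space d := S.indicator fun t => G (φ (min t 0)) - deriv φ t with hκ
  have hκm : Measurable κ :=
    ((hGm.comp hφc.measurable).sub (measurable_deriv φ)).indicator hSm
  have hκ2 : ∀ t, ‖κ t‖ ≤ 2 := fun t => by
    by_cases ht : t ∈ S
    · rw [hκ, indicator_of_mem ht]
      exact (norm_sub_le _ _).trans (by linarith [hG1 (φ (min t 0)), hderiv t ht.2])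
    · rw [hκ, indicator_of_notMem ht, norm_zero]
      exact zero_le_two
  have hκi : LocallyIntegrable κ volume := by
    refine (locallyIntegrable_const (2 : ℝ)).mono hκm.aestronglyMeasurable
      (Eventually.of_forall fun t => ?_)
    rw [Real.norm_eq_abs, abs_two]
    exact hκ2 t
  set k : ℝ → Space d := fun t => ∫ s in (0 : ℝ)..t, κ s with hk
  have hii : ∀ s t, IntervalIntegrable κ volume s t := fun s t =>
    intervalIntegrable_iff.2 ((hκi.integrableOn_isCompact isCompact_uIcc).mono_set
      uIoc_subset_uIcc)
  have hklip : LipschitzWith 2 k := by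
    refine LipschitzWith.of_dist_le_mul fun s t => ?_
    rw [dist_comm, dist_eq_norm, hk]
    simp only
    rw [intervalIntegral.integral_interval_sub_left (hii _ _) (hii _ _), dist_comm, Real.dist_eq]
    exact intervalIntegral.norm_integral_le_of_norm_le_const fun u _ => hκ2 u
  have hac : IsACOnNonpos φ := fun a ha => by
    refine LipschitzOnWith.absolutelyContinuousOnInterval (K := 1) (hlip.mono ?_)
    rw [uIcc_of_le ha]
    exact Icc_subset_Iic_self
  have hdiff : ∀ᵐ t : ℝ, t ∈ Iio 0 → DifferentiableAt ℝ φ t := by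
    have : ∀ n : ℕ, ∀ᵐ t : ℝ, t ∈ uIcc (-(n : ℝ)) 0 → DifferentiableAt ℝ φ t := fun n =>
      ae_differentiableAt_of_ac (hac _ (by simp))
    filter_upwards [ae_all_iff.2 this] with t h ht
    obtain ⟨n, hn⟩ := exists_nat_ge (-t)
    refine h n ?_
    rw [uIcc_of_le (by simp)]
    exact ⟨by linarith, le_of_lt ht⟩
  have main : ∀ᵐ (t : ℝ) ∂(volume.restrict (Iic (0 : ℝ))), -y.life < (t : EReal) →
      deriv k t = optDrift H W (φ t) - deriv φ t ∧
      IsReversedVelocity H W (φ t) (-deriv φ t) := by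
    rw [← restrict_Iio_eq_restrict_Iic, ae_restrict_iff' measurableSet_Iio]
    filter_upwards [hdiff, LocallyIntegrable.ae_hasDerivAt_integral hκi] with t h1 h2 ht hti
    have ht' : t < 0 := ht
    have hlt' := (hlt t).1 hti
    obtain ⟨h0, v, hv, hrev⟩ := y.velocity (-t) (neg_nonneg.2 ht'.le) hlt'
    -- The equation gives right derivatives in reversed time; at almost every time the two-sided
    -- derivative of the Lipschitz path exists and must coincide with them.
    have hve : v = -deriv φ t := by
      have h3 : HasDerivAt y.path (-deriv φ t) (-t) := by
        have h4 : HasDerivAt φ (deriv φ t) (-(-t)) := by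
          rw [neg_neg]; exact (h1 ht).hasDerivAt
        have := HasDerivAt.scomp (-t) h4 (hasDerivAt_neg (-t))
        simpa [Function.comp_def, hφ] using this
      exact (uniqueDiffWithinAt_Ici (-t)).eq_deriv _ hv h3.hasDerivWithinAt
    refine ⟨?_, hve ▸ hrev⟩
    rw [(h2 0).deriv, hκ, indicator_of_mem (show t ∈ S from ⟨hti, ht⟩), min_eq_left ht'.le,
      hG _ (y.mem _ (neg_nonneg.2 ht'.le)) h0]
  refine ⟨φ, k, y.life, ⟨hac, fun t ht => y.mem _ (neg_nonneg.2 ht), ?_, hlife, ?_, ?_, ?_, ?_, ?_,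
    ?_⟩, hlip, hklip⟩
  · simp only [hφ, neg_zero, y.start]
  · intro t ht hti
    refine hzero _ (neg_nonneg.2 ht) ?_
    rw [EReal.coe_neg]
    exact EReal.le_neg.1 hti
  · exact fun t ht hti => (y.velocity _ (neg_nonneg.2 ht) ((hlt t).1 hti)).1
  · exact fun a _ _ => hklip.lipschitzOnWith.absolutelyContinuousOnInterval
  · filter_upwards [main] with t h hti
    rw [(h hti).1, optDrift, sub_sub_cancel]
  · filter_upwards [main] with t h hti
    rw [(h hti).1, sub_eq_add_neg]
    exact (h hti).2.1
  · filter_upwards [main] with t h hti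
    rw [(h hti).1, sub_eq_add_neg]
    exact (h hti).2.2

end BackwardPath

/-! ### The quasi-potential is at most `W` -/

section UpperBound

variable {d : ℕ} {H : Space d → Space d → ℝ} {b : Space d → Space d} {W : Space d → ℝ}

/-- A Lipschitz push with velocity in the normal cone solves the Skorokhod problem. -/
lemma isSkorokhodSolution_of_deriv {T : ℝ} {x k : ℝ → Space d} {K : NNReal}
    (hx : ContinuousOn x (Icc 0 T)) (hmem : ∀ t ∈ Icc 0 T, x t ∈ cube d) (hk : LipschitzWith K k)
    (hk0 : k 0 = 0) (hder : ∀ᵐ t, t ∈ Ioo 0 T → deriv k t ∈ normalCone (x t)) :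
    IsSkorokhodSolution T (fun t => x t + k t) x k := by
  have hm : Measurable (deriv k) := measurable_deriv k
  have hbd : ∀ t, ‖deriv k t‖ ≤ K := fun t => norm_deriv_le_of_lipschitz hk
  have hac : ∀ a c, AbsolutelyContinuousOnInterval k a c := fun a c =>
    hk.lipschitzOnWith.absolutelyContinuousOnInterval
  have hint : ∀ t, IntegrableOn (deriv k) (Ioc 0 t) := fun t =>
    Measure.integrableOn_of_bounded (M := K) measure_Ioc_lt_top.ne hm.aestronglyMeasurable
      (Eventually.of_forall hbd)
  have hint_eq : ∀ t ≥ 0, ∫ s in Ioc 0 t, deriv k s = k t := by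
    intro t ht
    ext j
    have h1 : (∫ s in Ioc 0 t, deriv k s) j = ∫ s in Ioc 0 t, deriv k s j :=
      ((EuclideanSpace.proj j : Space d →L[ℝ] ℝ).integral_comp_comm (hint t)).symm
    have h2 : ∀ᵐ s ∂(volume.restrict (Ioc 0 t)), deriv k s j = deriv (fun u => k u j) s := by
      rw [ae_restrict_iff' measurableSet_Ioc]
      filter_upwards [ae_differentiableAt_of_ac (hac 0 t)] with s hs hmem
      rw [uIcc_of_le ht] at hs
      exact (hasDerivAt_coord (hs (Ioc_subset_Icc_self hmem)).hasDerivAt j).deriv.symm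
    rw [h1, integral_congr_ae h2, ← intervalIntegral.integral_of_le ht,
      (ac_coord (hac 0 t) j).integral_deriv_eq_sub, hk0, PiLp.zero_apply, sub_zero]
  -- Total variation measure `‖k'‖ dt` with direction `k' / ‖k'‖`. Times with `k' = 0` are null for
  -- this measure, so the value `0` of the direction there is harmless.
  refine ⟨hx, hk.continuous.continuousOn, hmem, fun _ _ => rfl,
    (volume.restrict (Ioc 0 T)).withDensity fun s => (‖deriv k s‖₊ : ℝ≥0∞),
    fun s => ‖deriv k s‖⁻¹ • deriv k s, ?_, ?_, ?_, ?_⟩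
  · refine isFiniteMeasure_withDensity (ne_of_lt ?_)
    exact (hint T).hasFiniteIntegral
  · exact hm.norm.inv.smul hm
  · refine ae_restrict_of_ae ?_
    rw [ae_withDensity_iff (by fun_prop), ← restrict_Ioo_eq_restrict_Ioc,
      ae_restrict_iff' measurableSet_Ioo]
    filter_upwards [hder] with s hs hmem' hne
    have hne' : deriv k s ≠ 0 := by simpa using hne
    have hsc := hmem s (Ioo_subset_Icc_self hmem')
    have hn : ‖deriv k s‖⁻¹ • deriv k s ∈ normals (x s) := by
      rcases hs hmem' with h | ⟨β, hβ, n, hn, h⟩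
      · exact absurd h hne'
      · have hβ0 : β ≠ 0 := fun h0 => hne' (by rw [h, h0, zero_smul])
        rw [h, norm_smul, hn.1, mul_one, Real.norm_of_nonneg hβ, smul_smul, inv_mul_cancel₀ hβ0,
          one_smul]
        exact hn
    exact ⟨(normals_nonempty_iff hsc).1 ⟨_, hn⟩, hn⟩
  · intro t ht
    rw [setIntegral_withDensity_eq_setIntegral_smul (by fun_prop) _ measurableSet_Ioc,
      Measure.restrict_restrict measurableSet_Ioc, inter_eq_left.2 (Ioc_subset_Ioc_right ht.2),
      ← hint_eq t ht.1]
    refine integral_congr_ae (Eventually.of_forall fun s => ?_)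
    simp only [NNReal.smul_def, coe_nnnorm, smul_smul]
    by_cases h : deriv k s = 0
    · rw [h, smul_zero]
    · rw [mul_inv_cancel₀ (norm_ne_zero_iff.2 h), one_smul]

/-- The Lagrangian is bounded on the velocities in the `ℓ¹` unit ball. -/
lemma exists_lagrangian_le (hH : IsRegularHamiltonian H b) (hd : 0 < d) :
    ∃ C : ℝ, 0 ≤ C ∧ ∀ y ∈ cube d, ∀ v : Space d, ∑ j, |v j| ≤ 1 → lagrangian H y v ≤ C := by
  obtain ⟨C, hC⟩ := hH.coercive
  have hstep : ∀ (α : Space d) (j : Fin d), inner ℝ α (stepVec (j, true)) = α j ∧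
      inner ℝ α (stepVec (j, false)) = -α j := fun α j => by
    constructor <;> simp [stepVec, EuclideanSpace.inner_single_right]
  have habs : ∀ y ∈ cube d, ∀ (α : Space d) j, |α j| ≤ H y α + C := by
    intro y hy α j
    have h1 := hC y hy α (j, true)
    have h2 := hC y hy α (j, false)
    rw [(hstep α j).1] at h1
    rw [(hstep α j).2] at h2
    exact abs_le.2 ⟨by linarith, by linarith⟩
  have hpos : ∀ y ∈ cube d, ∀ α : Space d, 0 ≤ H y α + C := fun y hy α =>
    (abs_nonneg _).trans (habs y hy α ⟨0, hd⟩)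
  refine ⟨C, ?_, fun y hy v hv => iSup_le fun α => EReal.coe_le_coe_iff.2 ?_⟩
  · have := hpos 0 zero_mem_cube 0
    rwa [hH.map_zero, zero_add] at this
  -- Duality of the `ℓ^∞` and `ℓ¹` norms: coercivity in the directions `±e_j` bounds every `|α j|`
  -- by `H y α + C`.
  have h1 : inner ℝ α v ≤ (H y α + C) * ∑ j, |v j| := by
    rw [inner_eq_sum, Finset.mul_sum]
    refine Finset.sum_le_sum fun j _ => (le_abs_self _).trans ?_
    rw [abs_mul]
    exact mul_le_mul_of_nonneg_right (habs y hy α j) (abs_nonneg _)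
  have h2 := mul_le_mul_of_nonneg_left hv (hpos y hy α)
  linarith

/-- The duration must be positive; resting at the origin for a time `T` costs at most `C T`, which
is made arbitrarily small. -/
lemma quasiPotential_zero_le (hH : IsRegularHamiltonian H b) (hd : 0 < d) :
    quasiPotential H 0 (0 : Space d) ≤ 0 := by
  obtain ⟨C, hC0, hC⟩ := exists_lagrangian_le hH hd
  refine ENNReal.le_of_forall_pos_le_add fun ε hε _ => ?_
  set T : ℝ := ε / (C + 1) with hT
  have hC1 : 0 < C + 1 := by linarith
  have hTpos : 0 < T := div_pos hε hC1
  have hCT : C * T ≤ ε := by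
    rw [hT, mul_div_assoc', div_le_iff₀ hC1]
    nlinarith [hε.le]
  have hsk : IsSkorokhodSolution T (fun _ => (0 : Space d) + 0) (fun _ => 0) fun _ => 0 :=
    isSkorokhodSolution_of_deriv (K := 0) continuousOn_const (fun _ _ => zero_mem_cube)
      (LipschitzWith.const 0) rfl (Eventually.of_forall fun t _ => Or.inl (deriv_const t 0))
  calc quasiPotential H 0 (0 : Space d)
      ≤ action H T fun _ => (0 : Space d) := by
        refine iInf_le_of_le T (iInf_le_of_le hTpos (iInf_le_of_le (fun _ => 0) ?_))
        exact iInf_le_of_le rfl (iInf_le_of_le rfl le_rfl)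
    _ ≤ ∫⁻ t in Icc 0 T, (lagrangian H 0 (deriv (fun _ : ℝ => (0 : Space d) + 0) t)).toENNReal :=
        iInf₂_le (fun _ => (0 : Space d) + 0)
          ⟨(LipschitzWith.const (_ : Space d)).lipschitzOnWith.absolutelyContinuousOnInterval, _, hsk⟩
    _ ≤ ∫⁻ _ in Icc 0 T, ENNReal.ofReal C := by
        refine lintegral_mono fun t => ?_
        rw [← EReal.real_coe_toENNReal, deriv_const]
        exact EReal.toENNReal_le_toENNReal (hC 0 zero_mem_cube 0 (by simp))
    _ = ENNReal.ofReal (C * T) := by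
        rw [setLIntegral_const, Real.volume_Icc, sub_zero, ← ENNReal.ofReal_mul hC0]
    _ ≤ 0 + ε := by
        rw [zero_add, ← ENNReal.ofReal_coe_nnreal]
        exact ENNReal.ofReal_le_ofReal hCT

variable {x : Space d} {φ k : ℝ → Space d} {i : EReal}

/-- The cost of reaching `x` along a backward reflected path entered at time `t`, after a straight
move from the origin during a time `τ`. -/
lemma IsBackwardReflectedPath.quasiPotential_le (h : IsBackwardReflectedPath H W x φ k i)
    (hW : IsClassicalSolution H W) (hH : IsRegularHamiltonian H b)
    (hφ : LipschitzOnWith 1 φ (Iic 0)) (hk : LipschitzWith 2 k) {C : ℝ} (hC0 : 0 ≤ C)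
    (hC : ∀ y ∈ cube d, ∀ v : Space d, ∑ j, |v j| ≤ 1 → lagrangian H y v ≤ C)
    {t τ : ℝ} (hτ : 0 < τ) (ht0 : t ≤ 0) (hti : -i < (t : EReal)) (ht : ∑ j, |φ t j| ≤ τ) :
    quasiPotential H 0 x ≤ ENNReal.ofReal (C * τ) + ENNReal.ofReal (W x - W (φ t)) := by
  set p := φ t with hp
  set T : ℝ := τ - t with hT
  -- Clock that waits at `t` on `[0, τ]` and then runs to `0`. It writes the segment and the path,
  -- and likewise the push, by single formulas whose Lipschitz bounds are immediate.
  set θ : ℝ → ℝ := fun s => max (s - τ) 0 + t with hθ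
  set Φ : ℝ → Space d := fun s => (min s τ / τ) • p + (φ (θ s) - p) with hΦ
  set K : ℝ → Space d := fun s => k (θ s) - k t with hK
  have hτT : τ ≤ T := by linarith
  have hpc : p ∈ cube d := h.mem_cube t ht0
  have hθlip : LipschitzWith 1 θ := by
    refine LipschitzWith.of_dist_le_mul fun s u => ?_
    rw [NNReal.coe_one, one_mul, Real.dist_eq, Real.dist_eq, hθ, add_sub_add_right_eq_sub]
    refine (abs_max_sub_max_le_max _ _ _ _).trans ?_
    rw [sub_self, abs_zero, max_eq_left (abs_nonneg _), sub_sub_sub_cancel_right]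
  have hθ0 : ∀ s ≤ T, θ s ≤ 0 := fun s hs => by
    have : max (s - τ) 0 ≤ -t := max_le (by linarith) (by linarith)
    simp only [hθ]; linarith
  have hθ1 : ∀ s ≤ τ, θ s = t := fun s hs => by
    simp only [hθ]; rw [max_eq_right (by linarith), zero_add]
  have hθ2 : ∀ s, τ ≤ s → θ s = s + (t - τ) := fun s hs => by
    simp only [hθ]; rw [max_eq_left (by linarith)]; ring
  have hΦ1 : ∀ s ≤ τ, Φ s = (s / τ) • p := fun s hs => by
    simp only [hΦ]; rw [hθ1 s hs, ← hp, sub_self, add_zero, min_eq_left hs]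
  have hΦ2 : ∀ s, τ ≤ s → Φ s = φ (s + (t - τ)) := fun s hs => by
    simp only [hΦ]
    rw [hθ2 s hs, min_eq_right hs, div_self hτ.ne', one_smul, add_sub_cancel]
  have hK1 : ∀ s ≤ τ, K s = 0 := fun s hs => by simp only [hK]; rw [hθ1 s hs, sub_self]
  have hK2 : ∀ s, τ ≤ s → K s = k (s + (t - τ)) - k t := fun s hs => by
    simp only [hK]; rw [hθ2 s hs]
  have hKlip : LipschitzWith 2 K := by
    have := (hk.comp hθlip).sub (LipschitzWith.const (k t))
    simpa using this
  have hΦac : AbsolutelyContinuousOnInterval Φ 0 T := by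
    have h1 : LipschitzWith (Real.toNNReal (‖p‖ / τ)) fun s : ℝ => (min s τ / τ) • p := by
      refine LipschitzWith.of_dist_le_mul fun s u => ?_
      rw [dist_eq_norm, ← sub_smul, norm_smul, ← sub_div, norm_div, Real.norm_of_nonneg hτ.le,
        Real.coe_toNNReal _ (by positivity), Real.dist_eq, Real.norm_eq_abs]
      have : |min s τ - min u τ| ≤ |s - u| := by
        refine (abs_min_sub_min_le_max _ _ _ _).trans ?_
        rw [sub_self, abs_zero, max_eq_left (abs_nonneg _)]
      calc |min s τ - min u τ| / τ * ‖p‖ ≤ |s - u| / τ * ‖p‖ := by gcongr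
        _ = ‖p‖ / τ * |s - u| := by ring
    have h2 : LipschitzOnWith 1 (fun s => φ (θ s)) (Icc 0 T) := by
      have := hφ.comp (g := φ) (f := θ) (s := Icc 0 T) (t := Iic 0) hθlip.lipschitzOnWith
        fun s hs => hθ0 s hs.2
      simpa [Function.comp_def] using this
    have h3 : LipschitzOnWith 1 (fun s => φ (θ s)) (uIcc 0 T) := by
      rwa [uIcc_of_le (hτ.le.trans hτT)]
    exact (h1.lipschitzOnWith.absolutelyContinuousOnInterval).add
      (h3.absolutelyContinuousOnInterval.sub
        (LipschitzWith.const p).lipschitzOnWith.absolutelyContinuousOnInterval)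
  have hcont : ContinuousOn Φ (Icc 0 T) := by
    have := hΦac.continuousOn
    rwa [uIcc_of_le (hτ.le.trans hτT)] at this
  have hmem : ∀ s ∈ Icc 0 T, Φ s ∈ cube d := by
    intro s hs
    rcases le_total s τ with hsτ | hsτ
    · rw [hΦ1 s hsτ]
      exact convex_cube.smul_mem_of_zero_mem zero_mem_cube hpc
        ⟨div_nonneg hs.1 hτ.le, (div_le_one hτ).2 hsτ⟩
    · rw [hΦ2 s hsτ, ← hθ2 s hsτ]
      exact h.mem_cube _ (hθ0 s hs.2)
  -- Translations preserve null sets, so almost everywhere statements on the path carry over to the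
  -- shifted one.
  have hshift : ∀ {P : ℝ → Prop}, (∀ᵐ u, u ∈ Ioo t 0 → P u) →
      ∀ᵐ s, s ∈ Ioo τ T → P (s + (t - τ)) := by
    intro P hP
    filter_upwards [(measurePreserving_add_right volume (t - τ)).quasiMeasurePreserving.ae hP]
      with s hs hmem
    exact hs ⟨by linarith [hmem.1], by linarith [hmem.2]⟩
  have hvel := hshift (h.ae_velocity hti ht0 le_rfl)
  have hder := hshift (h.ae_deriv hW hH hti ht0 le_rfl)
  have hkdiff : ∀ᵐ s, s ∈ Ioo τ T → DifferentiableAt ℝ k (s + (t - τ)) := by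
    refine hshift (P := fun u => DifferentiableAt ℝ k u) ?_
    filter_upwards [ae_differentiableAt_of_ac (a := t) (b := 0)
      hk.lipschitzOnWith.absolutelyContinuousOnInterval] with u hu hmem
    rw [uIcc_of_le ht0] at hu
    exact hu (Ioo_subset_Icc_self hmem)
  have hKder : ∀ s, τ < s → deriv K s = deriv k (s + (t - τ)) := by
    intro s hs
    have : K =ᶠ[𝓝 s] fun u => k (u + (t - τ)) - k t := by
      filter_upwards [Ioi_mem_nhds hs] with u hu using hK2 u (le_of_lt hu)
    rw [this.deriv_eq, deriv_sub_const, deriv_comp_add_const]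
  have hne : ∀ᵐ s : ℝ, s ≠ τ := by simp [ae_iff, measure_singleton]
  have hsk : IsSkorokhodSolution T (fun s => Φ s + K s) Φ K := by
    refine isSkorokhodSolution_of_deriv hcont hmem hKlip (hK1 0 hτ.le) ?_
    filter_upwards [hvel, hne] with s hs hsne hmem'
    rcases lt_or_gt_of_ne hsne with hlt | hgt
    · have : K =ᶠ[𝓝 s] fun _ => 0 := by
        filter_upwards [Iio_mem_nhds hlt] with u hu using hK1 u (le_of_lt hu)
      exact Or.inl (this.deriv_eq.trans (deriv_const s 0))
    · rw [hKder s hgt, hΦ2 s hgt.le]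
      exact (hs ⟨hgt, hmem'.2⟩).2.2.1
  have hcost1 : ∫⁻ s in Icc 0 τ,
      (lagrangian H (Φ s) (deriv (fun s => Φ s + K s) s)).toENNReal ≤ ENNReal.ofReal (C * τ) := by
    calc ∫⁻ s in Icc 0 τ, (lagrangian H (Φ s) (deriv (fun s => Φ s + K s) s)).toENNReal
        ≤ ∫⁻ _ in Icc 0 τ, ENNReal.ofReal C := by
          rw [← restrict_Ioo_eq_restrict_Icc]
          refine setLIntegral_mono' measurableSet_Ioo fun s hs => ?_
          have : (fun s => Φ s + K s) =ᶠ[𝓝 s] fun u => (u / τ) • p := by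
            filter_upwards [Iio_mem_nhds hs.2] with u hu
            rw [hΦ1 u (le_of_lt hu), hK1 u (le_of_lt hu), add_zero]
          have hd : HasDerivAt (fun u : ℝ => (u / τ) • p) ((1 / τ) • p) s :=
            ((hasDerivAt_id s).div_const τ).smul_const p
          rw [this.deriv_eq, hd.deriv, ← EReal.real_coe_toENNReal]
          refine EReal.toENNReal_le_toENNReal (hC _ (hmem s ⟨hs.1.le, hs.2.le.trans hτT⟩) _ ?_)
          -- The segment has velocity `p / τ`, in the `ℓ¹` unit ball by `ht`, and no push acts on
          -- it.
          simp only [PiLp.smul_apply, smul_eq_mul, abs_mul]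
          rw [← Finset.mul_sum, abs_of_pos (by positivity), one_div, inv_mul_le_iff₀ hτ, mul_one]
          exact ht
      _ = ENNReal.ofReal (C * τ) := by
          rw [setLIntegral_const, Real.volume_Icc, sub_zero, ← ENNReal.ofReal_mul hC0]
  have hcost2 : ∫⁻ s in Icc τ T,
      (lagrangian H (Φ s) (deriv (fun s => Φ s + K s) s)).toENNReal ≤
        ENNReal.ofReal (W x - W p) := by
    have hu : ∀ s ∈ Icc τ T, s + (t - τ) ∈ Icc t 0 := fun s hs =>
      ⟨by linarith [hs.1], by linarith [hs.2]⟩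
    have hmem' : ∀ s ∈ Icc τ T, Φ s ∈ cube d ∧ Φ s ≠ 0 := fun s hs => by
      rw [hΦ2 s hs.1]
      exact h.mem_ne hti le_rfl _ (hu s hs)
    have hWac : AbsolutelyContinuousOnInterval (fun s => W (Φ s)) τ T := by
      refine ac_comp_path hW.contDiffOn hτT (hΦac.mono ?_) hmem'
      rw [uIcc_of_le hτT, uIcc_of_le (hτ.le.trans hτT)]
      exact Icc_subset_Icc_left hτ.le
    have hends : W x - W p = W (Φ T) - W (Φ τ) := by
      rw [hΦ2 T hτT, hΦ2 τ le_rfl, add_sub_cancel, show T + (t - τ) = 0 by rw [hT]; ring,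
        h.terminal]
    rw [hends]
    refine lintegral_le_ofReal_sub hτT hWac ?_
    filter_upwards [hvel, hder, hkdiff] with s h1 h2 h3 hs
    obtain ⟨hd, -, -, -, heq⟩ := h1 hs
    obtain ⟨hWd, hnn, -⟩ := h2 hs
    obtain ⟨hc, hne0⟩ := hmem' s (Ioo_subset_Icc_self hs)
    have e1 : Φ =ᶠ[𝓝 s] fun u => φ (u + (t - τ)) := by
      filter_upwards [Ioi_mem_nhds hs.1] with u hu using hΦ2 u (le_of_lt hu)
    -- The driver moves with the optimal drift, for which the Lagrangian is exactly the derivative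
    -- of `W` along the path.
    have e2 : deriv (fun s => Φ s + K s) s = optDrift H W (Φ s) := by
      have e3 : (fun s => Φ s + K s) =ᶠ[𝓝 s]
          fun u => φ (u + (t - τ)) + (k (u + (t - τ)) - k t) := by
        filter_upwards [Ioi_mem_nhds hs.1] with u hu
        rw [hΦ2 u (le_of_lt hu), hK2 u (le_of_lt hu)]
      have e4 := (hd.hasDerivAt.comp_add_const s (t - τ)).add
        (((h3 hs).hasDerivAt.comp_add_const s (t - τ)).sub_const (k t))
      rw [e3.deriv_eq, hΦ2 s hs.1.le, ← heq]
      exact e4.deriv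
    have e5 : deriv (fun s => W (Φ s)) s =
        inner ℝ (gradPlus W (Φ s)) (optDrift H W (Φ s)) := by
      have e6 : (fun s => W (Φ s)) =ᶠ[𝓝 s] fun u => W (φ (u + (t - τ))) := e1.fun_comp W
      rw [e6.deriv_eq, hΦ2 s hs.1.le]
      exact (hWd.comp_add_const s (t - τ)).deriv
    rw [e5, e2, hW.lagrangian_optDrift hH hc hne0, EReal.real_coe_toENNReal]
    refine ⟨?_, le_rfl⟩
    rw [hΦ2 s hs.1.le]
    exact hnn
  calc quasiPotential H 0 x ≤ action H T Φ := by
        refine iInf_le_of_le T (iInf_le_of_le (hτ.trans_le hτT) (iInf_le_of_le Φ ?_))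
        refine iInf_le_of_le ?_ (iInf_le_of_le ?_ le_rfl)
        · rw [hΦ1 0 hτ.le, zero_div, zero_smul]
        · rw [hΦ2 T hτT, show T + (t - τ) = 0 by rw [hT]; ring, h.terminal]
    _ ≤ ∫⁻ s in Icc 0 T, (lagrangian H (Φ s) (deriv (fun s => Φ s + K s) s)).toENNReal :=
        iInf₂_le (fun s => Φ s + K s) ⟨hΦac.add
          hKlip.lipschitzOnWith.absolutelyContinuousOnInterval, K, hsk⟩
    _ ≤ ∫⁻ s in Icc 0 τ ∪ Icc τ T,
          (lagrangian H (Φ s) (deriv (fun s => Φ s + K s) s)).toENNReal :=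
        lintegral_mono_set (Icc_union_Icc_eq_Icc hτ.le hτT).ge
    _ ≤ _ := (lintegral_union_le _ _ _).trans (add_le_add hcost1 hcost2)

/-- A backward path passes arbitrarily close to the origin; joining it there costs at most `ε`, and
the rest costs `W x - W (φ t) ≤ W x`. -/
theorem IsClassicalSolution.quasiPotential_le (hW : IsClassicalSolution H W) (hW0 : W 0 = 0)
    (hH : IsRegularHamiltonian H b) (hd : 0 < d)
    (hdrift : ∀ x ∈ cube d, x ≠ 0 → inner ℝ x (b x) < 0) (hx : x ∈ cube d) :
    quasiPotential H 0 x ≤ ENNReal.ofReal (W x) := by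
  by_cases hx0 : x = 0
  · rw [hx0, hW0, ENNReal.ofReal_zero]
    exact quasiPotential_zero_le hH hd
  obtain ⟨φ, k, i, h, hφ, hk⟩ := exists_backwardReflectedPath hW hH hx hx0
  obtain ⟨C, hC0, hC⟩ := exists_lagrangian_le hH hd
  have hi : -i < ((0 : ℝ) : EReal) := by
    rw [EReal.neg_lt_comm, EReal.coe_zero, neg_zero]; exact h.life_pos
  refine ENNReal.le_of_forall_pos_le_add fun ε hε _ => ?_
  set τ : ℝ := ε / (C + 1) with hτ
  have hC1 : 0 < C + 1 := by linarith
  have hτpos : 0 < τ := div_pos hε hC1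
  have hCτ : C * τ ≤ ε := by
    rw [hτ, mul_div_assoc', div_le_iff₀ hC1]
    nlinarith [hε.le]
  have hd' : (0 : ℝ) < d := Nat.cast_pos.2 hd
  -- A Euclidean norm below `τ / d` makes the `ℓ¹` norm at most `τ`.
  obtain ⟨t, ht0, hti, hsmall, -⟩ := h.exists_small hW hW0 hH hdrift hi le_rfl (div_pos hτpos hd')
  have hsum : ∑ j, |φ t j| ≤ τ := by
    calc ∑ j, |φ t j| ≤ ∑ _j : Fin d, τ / d :=
          Finset.sum_le_sum fun j _ => (abs_coord_le_norm _ j).trans hsmall.le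
      _ = τ := by
          rw [Finset.sum_const, Finset.card_univ, Fintype.card_fin, nsmul_eq_mul,
            mul_div_cancel₀ _ hd'.ne']
  refine (h.quasiPotential_le hW hH hφ hk hC0 hC hτpos ht0 hti hsum).trans ?_
  rw [add_comm]
  refine add_le_add (ENNReal.ofReal_le_ofReal ?_) ?_
  · linarith [h.nonneg hW hW0 hH hdrift hti ht0]
  · rw [← ENNReal.ofReal_coe_nnreal]
    exact ENNReal.ofReal_le_ofReal hCτ

end UpperBound

end ReflectedWalk

end

/-! ### The main theorem -/

open ReflectedWalk in
theorem mainTheorem6 {d : ℕ} {E : Type*} [Fintype E] [DecidableEq E]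
    (P : Matrix E E ℝ) (hP : P ∈ Matrix.rowStochastic ℝ E)
    (p : Space d → E → Step d → ℝ) (hp : IsStepLaw p)
    (hA1 : LipschitzSteps p) (hA2 : EllipticSteps p) (hA3 : P.IsIrreducible)
    (μ : E → ℝ) (hμ : IsInvariantProbability P μ)
    (ℓ : ℝ) (hℓ : 0 < ℓ) (hℓd : ℓ < d) (hA4 : IsAttractingOrigin (avgDrift p μ) ℓ)
    (hdrift : ∀ x ∈ cube d, x ≠ 0 → inner ℝ x (avgDrift p μ x) < 0)
    (i₀ : E) (W : Space d → ℝ)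
    (hW : IsClassicalSolution (hamiltonian P p i₀) W) (hW0 : W 0 = 0) :
    (∀ x ∈ cube d, (quasiPotential (hamiltonian P p i₀) 0 x : EReal) = (W x : EReal)) ∧
    ∀ x ∈ cube d, x ≠ 0 →
      (∃ (φ k : ℝ → Space d) (i : EReal),
        IsBackwardReflectedPath (hamiltonian P p i₀) W x φ k i) ∧
      ∀ (φ k : ℝ → Space d) (i : EReal),
        IsBackwardReflectedPath (hamiltonian P p i₀) W x φ k i →
          Filter.Tendsto φ Filter.atBot (nhds 0) ∧
          backwardAction (hamiltonian P p i₀) φ = quasiPotential (hamiltonian P p i₀) 0 x ∧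
          IsLeast (backwardAction (hamiltonian P p i₀) '' backwardPaths x)
            (backwardAction (hamiltonian P p i₀) φ) := by
  have hH := isRegularHamiltonian hP hp hA1 hA2 hA3 hμ i₀
  have hd : 0 < d := Nat.cast_pos.1 (hℓ.trans hℓd)
  have hb0 : ∀ j, avgDrift p μ 0 j ≤ 0 := fun j =>
    drift_zero_nonpos_of_equilibrium ((hA4.equilibrium 0 zero_mem_cube).2 rfl) j
  have hV : ∀ x ∈ cube d, quasiPotential (hamiltonian P p i₀) 0 x = ENNReal.ofReal (W x) :=
    fun x hx => le_antisymm (hW.quasiPotential_le hW0 hH hd hdrift hx) (hW.le_quasiPotential hW0 x)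
  -- Needed to read `ENNReal.ofReal (W x)` as `W x`.
  have hnonneg : ∀ x ∈ cube d, 0 ≤ W x := by
    intro x hx
    by_cases hx0 : x = 0
    · rw [hx0, hW0]
    · obtain ⟨φ, k, i, h, -⟩ := exists_backwardReflectedPath hW hH hx hx0
      have := h.nonneg hW hW0 hH hdrift (a := 0)
        (by rw [EReal.neg_lt_comm, EReal.coe_zero, neg_zero]; exact h.life_pos) le_rfl
      rwa [h.terminal] at this
  refine ⟨fun x hx => ?_, fun x hx hx0 => ⟨?_, fun φ k i h => ?_⟩⟩
  · rw [hV x hx, EReal.coe_ennreal_ofReal, max_eq_left (hnonneg x hx)]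
  · obtain ⟨φ, k, i, h, -⟩ := exists_backwardReflectedPath hW hH hx hx0
    exact ⟨φ, k, i, h⟩
  · have hmem := h.mem_backwardPaths hW hH hdrift
    have hact : backwardAction (hamiltonian P p i₀) φ = ENNReal.ofReal (W x) :=
      le_antisymm (h.backwardAction_le hW hW0 hH hdrift hb0) (hW.le_backwardAction hW0 hmem)
    refine ⟨h.tendsto_zero hW hH hdrift, hact.trans (hV x hx).symm, ⟨φ, hmem, rfl⟩, ?_⟩
    rintro _ ⟨ψ, hψ, rfl⟩
    rw [hact]
    exact hW.le_backwardAction hW0 hψ
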